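/- Let $S^3\subset\mathbb H$ be the sphere of unit quaternions, let $A(x)=xi$ be the unit vector field tangent to the Hopf circles $\theta\mapsto x(\cos\theta+i\sin\theta)$, let $\alpha_x(v)=\langle xi,v\rangle$ be its dual one-form (the standard contact form, $\xi=\ker\alpha$), and let $p\colon S^3\to S^2$, $p(x)=x\,i\,x^{-1}$, be the Hopf projection onto the unit sphere $S^2$ of imaginary quaternions. Let - $\mathrm{Aut}_1(\xi)$ be the group of diffeomorphisms $F$ of $S^3$ with $F^*\alpha=\alpha$ (strict contactomorphisms); - $S^1\subset\mathrm{Aut}_1(\xi)$ be the subgroup of the rotations $x\mapsto x(\cos\theta+i\sin\theta)$; - $\mathrm{SDiff}^+(S^2)$ be the group of orientation-preserving, area-preserving diffeomorphisms of $S^2$. All diffeomorphisms are smooth ($C^\infty$). For a group $G$ of diffeomorphisms of $M$ ($M=S^3$ or $S^2$), let $T_{\mathrm{id}}G$ be the set of vector fields $X(x)=\frac{d}{dt}\big|_{t=0}F_t(x)$, where $F_t\in G$ ($t\in\mathbb R$), $F_0=\mathrm{id}$ and $(t,x)\mapsto F_t(x)$ is smooth on $\mathbb R\times M$. **Proposition.**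 The sets $T_{\mathrm{id}}S^1$ and $T_{\mathrm{id}}\mathrm{Aut}_1(\xi)$ are Lie subalgebras of the Lie algebra of smooth vector fields on $S^3$, and $T_{\mathrm{id}}\mathrm{SDiff}^+(S^2)$ is a Lie subalgebra of the Lie algebra of smooth vector fields on $S^2$. Let $J\colon T_{\mathrm{id}}S^1\to T_{\mathrm{id}}\mathrm{Aut}_1(\xi)$ be the inclusion. There is a map $P\colon T_{\mathrm{id}}\mathrm{Aut}_1(\xi)\to T_{\mathrm{id}}\mathrm{SDiff}^+(S^2)$ that pushes vector fields forward along $p$, that is, $dp_x(X(x))=(PX)(p(x))$ for all $x\in S^3$. It is the differential at the identity of $F\mapsto p\circ F\circ p^{-1}$: if $F_t$ is a smooth curve in $\mathrm{Aut}_1(\xi)$ with $F_0=\mathrm{id}$ and initial velocity $X$, then there is a smooth curve $f_t$ in $\mathrm{SDiff}^+(S^2)$ with $f_0=\mathrm{id}$, $f_t\circ p=p\circ F_t$ for all $t$, and initial velocity $PX$. The maps $J$ and $P$ are homomorphisms of Lie algebras, and the sequence $$0\to T_{\mathrm{id}}S^1\xrightarrow{\ J\ }T_{\mathrm{id}}\mathrm{Aut}_1(\xi)\xrightarrow{\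 P\ }T_{\mathrm{id}}\mathrm{SDiff}^+(S^2)\to 0$$ is exact. -/

import Mathlib

open scoped Manifold ContDiff Quaternion
open VectorField

noncomputable section

namespace Hopf

/-! ### The Lie algebra of smooth vector fields, and tangent spaces of diffeomorphism groups -/

section General

theorem two_le_infty : (2 : ℕ∞ω) ≤ ∞ := WithTop.coe_le_coe.2 le_top

theorem three_le_infty : (3 : ℕ∞ω) ≤ ∞ := WithTop.coe_le_coe.2 le_top

variable {E : Type*} [NormedAddCommGroup E] [NormedSpace ℝ E]
  {H : Type*} [TopologicalSpace H] (I : ModelWithCorners ℝ E H)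
  (M : Type*) [TopologicalSpace M] [ChartedSpace H M] [IsManifold I ∞ M]

/-- The real vector space of smooth vector fields on `M`. -/
abbrev SmoothVF : Type _ := ContMDiffSection I E ∞ (fun x : M => TangentSpace I x)

variable {I M}

theorem SmoothVF.mdifferentiableAt (X : SmoothVF I M) (x : M) :
    MDifferentiableAt I I.tangent
      (fun y => (⟨y, X y⟩ : Bundle.TotalSpace E (TangentSpace I : M → Type _))) x :=
  (X.contMDiff x).mdifferentiableAt (by simp)

section

variable [CompleteSpace E]

/-- The Lie bracket of vector fields. -/
instance : Bracket (SmoothVF I M) (SmoothVF I M) where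
  bracket X Y :=
    ⟨mlieBracket I X Y, by
      have : IsManifold I (((⊤ : ℕ∞) : ℕ∞ω) + 1) M := ‹IsManifold I ∞ M›
      have : IsManifold I (minSmoothness ℝ 2) M :=
        IsManifold.of_le (n := ∞) (by
          rw [minSmoothness_of_isRCLikeNormedField]; exact two_le_infty)
      exact ContDiff.mlieBracket_vectorField (m := ⊤) (n := ⊤) X.contMDiff Y.contMDiff
        (by simp)⟩

instance : LieRing (SmoothVF I M) where
  add_lie X Y Z := by
    have : IsManifold I 2 M := IsManifold.of_le (n := ∞) two_le_infty
    ext x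
    exact mlieBracket_add_left (X.mdifferentiableAt x) (Y.mdifferentiableAt x)
  lie_add X Y Z := by
    have : IsManifold I 2 M := IsManifold.of_le (n := ∞) two_le_infty
    ext x
    exact mlieBracket_add_right (Y.mdifferentiableAt x) (Z.mdifferentiableAt x)
  lie_self X := by
    ext x
    exact congrFun (mlieBracket_self (I := I) (V := X)) x
  leibniz_lie X Y Z := by
    have : IsManifold I (minSmoothness ℝ 3) M :=
      IsManifold.of_le (n := ∞) (by
        rw [minSmoothness_of_isRCLikeNormedField]; exact three_le_infty)
    have h : minSmoothness ℝ 2 ≤ (∞ : ℕ∞ω) := by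
      rw [minSmoothness_of_isRCLikeNormedField]; exact two_le_infty
    ext x
    exact leibniz_identity_mlieBracket_apply ((X.contMDiff x).of_le h) ((Y.contMDiff x).of_le h)
      ((Z.contMDiff x).of_le h)

instance : LieAlgebra ℝ (SmoothVF I M) where
  lie_smul c X Y := by
    have : IsManifold I 2 M := IsManifold.of_le (n := ∞) two_le_infty
    ext x
    exact mlieBracket_const_smul_right (Y.mdifferentiableAt x)

end

end General

section Tangent

variable {E : Type*} [NormedAddCommGroup E] [NormedSpace ℝ E]
  {H : Type*} [TopologicalSpace H] {I : ModelWithCorners ℝ E H}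
  {M : Type*} [TopologicalSpace M] [ChartedSpace H M]

/-- A smooth curve `t ↦ F t` of diffeomorphisms lying in `G` and starting at the identity;
smoothness of the curve means that `(t, x) ↦ F t x` is smooth. -/
structure IsSmoothCurveAtId (G : Set (M ≃ₘ^∞⟮I, I⟯ M)) (F : ℝ → (M ≃ₘ^∞⟮I, I⟯ M)) : Prop where
  mem : ∀ t, F t ∈ G
  zero : F 0 = Diffeomorph.refl I M ∞
  smooth : ContMDiff (𝓘(ℝ, ℝ).prod I) I ∞ (fun q : ℝ × M => F q.1 q.2)

/-- `d/dt F t x = X x` at `t = 0`, for all `x` (where `F 0 = id`). -/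
def HasInitialVelocity (F : ℝ → (M ≃ₘ^∞⟮I, I⟯ M)) (X : ∀ x : M, TangentSpace I x) : Prop :=
  ∀ x : M, HasMFDerivAt 𝓘(ℝ, ℝ) I (fun t : ℝ => F t x) 0
    ((1 : ℝ →L[ℝ] ℝ).smulRight (X (F 0 x)))

/-- The tangent space at the identity of a group `G` of diffeomorphisms: the initial velocities
of smooth curves in `G` starting at the identity. -/
def tangentAtId [IsManifold I ∞ M] (G : Set (M ≃ₘ^∞⟮I, I⟯ M)) : Set (SmoothVF I M) :=
  {X | ∃ F : ℝ → (M ≃ₘ^∞⟮I, I⟯ M), IsSmoothCurveAtId G F ∧ HasInitialVelocity F X}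

end Tangent

/-! ### The spheres and the Hopf projection -/

instance factFinrankQuaternion : Fact (Module.finrank ℝ ℍ[ℝ] = 3 + 1) :=
  ⟨Quaternion.finrank_eq_four⟩

/-- The three-sphere of unit quaternions. -/
abbrev S3 : Type := Metric.sphere (0 : ℍ[ℝ]) 1

/-- The unit two-sphere in Euclidean three-space. -/
abbrev S2 : Type := Metric.sphere (0 : EuclideanSpace ℝ (Fin 3)) 1

abbrev DiffS3 : Type := S3 ≃ₘ^∞⟮𝓡 3, 𝓡 3⟯ S3

abbrev DiffS2 : Type := S2 ≃ₘ^∞⟮𝓡 2, 𝓡 2⟯ S2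

/-- The unit quaternion `i`. -/
def qi : ℍ[ℝ] := ⟨0, 1, 0, 0⟩

@[simp] theorem qi_re : qi.re = 0 := rfl
@[simp] theorem qi_imI : qi.imI = 1 := rfl
@[simp] theorem qi_imJ : qi.imJ = 0 := rfl
@[simp] theorem qi_imK : qi.imK = 0 := rfl

/-- The unit quaternion `cos θ + i sin θ`. -/
def expI (θ : ℝ) : ℍ[ℝ] := ⟨Real.cos θ, Real.sin θ, 0, 0⟩

/-- The Hopf projection `x ↦ x i x⁻¹`, whose values are unit imaginary quaternions, written as
vectors of Euclidean three-space. Its fibres are the circles `θ ↦ x (cos θ + i sin θ)`. -/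
def hopf (x : S3) : S2 :=
  ⟨!₂[((x : ℍ[ℝ]) * qi * star (x : ℍ[ℝ])).imI, ((x : ℍ[ℝ]) * qi * star (x : ℍ[ℝ])).imJ,
      ((x : ℍ[ℝ]) * qi * star (x : ℍ[ℝ])).imK], by
    have hx : ‖(x : ℍ[ℝ])‖ = 1 := mem_sphere_zero_iff_norm.1 x.2
    have h1 : ‖(x : ℍ[ℝ]) * qi * star (x : ℍ[ℝ])‖ ^ 2 = 1 := by
      have hq : ‖qi‖ ^ 2 = 1 := by
        rw [sq, ← Quaternion.normSq_eq_norm_mul_self, Quaternion.normSq_def']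
        simp
      rw [norm_mul, norm_mul, norm_star, hx]
      simp [hq]
    rw [sq, ← Quaternion.normSq_eq_norm_mul_self, Quaternion.normSq_def'] at h1
    have h0 : ((x : ℍ[ℝ]) * qi * star (x : ℍ[ℝ])).re = 0 := by
      simp
      ring
    rw [h0] at h1
    rw [mem_sphere_zero_iff_norm, EuclideanSpace.norm_eq, Real.sqrt_eq_one]
    simpa [Fin.sum_univ_three] using h1⟩

/-! ### The three groups of diffeomorphisms -/

/-- The standard contact form `α` on the three-sphere, dual to the Hopf field `A x = x i`:
`α x v = ⟨x i, v⟩`. -/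
def contactForm (x : S3) (v : TangentSpace (𝓡 3) x) : ℝ :=
  inner ℝ ((x : ℍ[ℝ]) * qi) (mfderiv (𝓡 3) 𝓘(ℝ, ℍ[ℝ]) ((↑) : S3 → ℍ[ℝ]) x v : ℍ[ℝ])

/-- The oriented area form of the two-sphere: `ω y (u, v) = det (y, u, v)`. -/
def areaForm (y : S2) (u v : TangentSpace (𝓡 2) y) : ℝ :=
  let ι : TangentSpace (𝓡 2) y → EuclideanSpace ℝ (Fin 3) :=
    mfderiv (𝓡 2) 𝓘(ℝ, EuclideanSpace ℝ (Fin 3)) ((↑) : S2 → EuclideanSpace ℝ (Fin 3)) y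
  Matrix.det (Matrix.of ![(y : EuclideanSpace ℝ (Fin 3)).ofLp, (ι u).ofLp, (ι v).ofLp])

/-- The strict contactomorphisms of the standard contact structure `ker α`: the
diffeomorphisms `F` of the three-sphere with `F^* α = α`. -/
def strictContact : Set DiffS3 :=
  {F | ∀ (x : S3) (v : TangentSpace (𝓡 3) x),
    contactForm (F x) (mfderiv (𝓡 3) (𝓡 3) F x v) = contactForm x v}

/-- The diffeomorphisms of the two-sphere that preserve area and orientation, that is, the
oriented area form. -/
def sDiffPlus : Set DiffS2 :=
  {f | ∀ (y : S2) (u v : TangentSpace (𝓡 2) y),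
    areaForm (f y) (mfderiv (𝓡 2) (𝓡 2) f y u) (mfderiv (𝓡 2) (𝓡 2) f y v) = areaForm y u v}

/-- The circle group of diffeomorphisms of the three-sphere that rotate all Hopf fibres by the
same angle. -/
def circleRotations : Set DiffS3 :=
  {F | ∃ θ : ℝ, ∀ x : S3, (F x : ℍ[ℝ]) = (x : ℍ[ℝ]) * expI θ}

end Hopf

end

/-! Everything on the spheres is transported to the punctured ambient space by extending maps and
fields homogeneously of degree one. With ω(u,v) = ⟨ui,v⟩ and λ_x(v) = ω(x,v), a diffeomorphism F of
the three-sphere preserves α exactly when its extension preserves λ; differentiating, the extension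
is symplectic (`symplectic_of_mem_strictContact`). Infinitesimally, X is the velocity of a curve of
strict contactomorphisms exactly when its extension V is Hamiltonian, that is, DV is skew for ω
(`mem_tangentAtId_strictContact_iff`). Euler's relation DV(x)x = V(x) links λ and ω. This condition
is linear and closed under brackets.

To realise a Hamiltonian V by a curve, the flow is replaced by the implicit midpoint rule m - sV(m)
↦ m + sV(m). It is symplectic because it is a nonlinear Cayley transform, preserves the norm because
V(m) ⟂ m, and is homogeneous; V is globally Lipschitz by homogeneity, so the rule is defined for all
small s (`mem_tangentAtId_of_isHamiltonian`).

A symplectic, norm-preserving extension carries xi to f(x)i, so strict contactomorphisms commute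
with the Hopf rotations and descend to the two-sphere. The Hopf projection extends to the quadratic
map x ↦ x i x̄, which pulls the area form back to an expression in ω, λ and ⟨x,·⟩, so the descended
maps preserve oriented area (`exists_descend_curve`). P respects brackets because brackets of
related fields are related.

Kernel: a field that projects to zero is vertical, X = K·xi, and the contact condition forces K to
be constant (`eq_smul_hopfField_of_isPushForward_zero`). Surjectivity: for an area-preserving Y,
contraction with the area form gives a closed one-form. It has a primitive H, and the field with
Hamiltonian proportional to |q|H, pulled back along q = x i x̄, is a lift of Y (`exists_lift`). -/

noncomputable section

namespace Hopf

/-! ### Homogeneous maps of degree one -/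

section Homogeneous

variable {E F : Type*} [NormedAddCommGroup E] [NormedSpace ℝ E]
  [NormedAddCommGroup F] [NormedSpace ℝ F]

/-- Positive homogeneity of degree one. -/
def IsHomogeneous (f : E → F) : Prop := ∀ r : ℝ, 0 < r → ∀ x, f (r • x) = r • f x

theorem IsHomogeneous.map_zero {f : E → F} (hf : IsHomogeneous f) : f 0 = 0 := by
  have h := hf 2 (by norm_num) 0
  rw [smul_zero, two_smul] at h
  exact left_eq_add.1 h

/-- Euler's relation: differentiate `f (r • x) = r • f x` in `r` at 1. -/
theorem IsHomogeneous.fderiv_self {f : E → F} (hf : IsHomogeneous f) {x : E}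
    (hd : DifferentiableAt ℝ f x) : fderiv ℝ f x x = f x := by
  have h1 : HasDerivAt (fun r : ℝ => r • x) x 1 := by
    simpa using (hasDerivAt_id (1 : ℝ)).smul_const x
  have h2 : HasDerivAt (fun r : ℝ => f (r • x)) (fderiv ℝ f x x) 1 := by
    have h3 : HasFDerivAt f (fderiv ℝ f x) ((1 : ℝ) • x) := by
      rw [one_smul]; exact hd.hasFDerivAt
    exact h3.comp_hasDerivAt (1 : ℝ) h1
  have h4 : HasDerivAt (fun r : ℝ => r • f x) (f x) 1 := by
    simpa using (hasDerivAt_id (1 : ℝ)).smul_const (f x)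
  refine h2.unique (h4.congr_of_eventuallyEq ?_)
  filter_upwards [lt_mem_nhds (zero_lt_one' ℝ)] with r hr using hf r hr x

theorem IsHomogeneous.fderiv_smul {f : E → F} (hf : IsHomogeneous f) {r : ℝ} (hr : 0 < r) (x : E) :
    fderiv ℝ f (r • x) = fderiv ℝ f x := by
  have h1 : (fun y => f (r • y)) = fun y => r • f y := funext fun y => hf r hr y
  have h2 := fderiv_comp_smul (𝕜 := ℝ) (f := f) (x := x) r
  rw [h1] at h2
  have h3 : fderiv ℝ (fun y => r • f y) x = r • fderiv ℝ f x :=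
    by
    exact congrFun (fderiv_const_smul_field (f := f) r) x
  rw [h3] at h2
  exact (smul_right_injective _ hr.ne' h2).symm

/-- The mean value inequality applies to segments that avoid the origin, where `f` may fail to be
differentiable. If the segment meets the origin, then ‖x‖ + ‖y‖ = ‖x - y‖ and Euler's relation
bounds each value separately. -/
theorem IsHomogeneous.norm_sub_le {f : E → F} (hf : IsHomogeneous f)
    (hd : ∀ x ≠ 0, DifferentiableAt ℝ f x) {C : ℝ} (hC : ∀ x ≠ 0, ‖fderiv ℝ f x‖ ≤ C) (x y : E) :
    ‖f x - f y‖ ≤ C * ‖x - y‖ := by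
  have hb : ∀ x, ‖f x‖ ≤ C * ‖x‖ := fun x => by
    by_cases hx : x = 0
    · simp [hx, hf.map_zero]
    · rw [← hf.fderiv_self (hd x hx)]
      exact (fderiv ℝ f x).le_of_opNorm_le (hC x hx) x
  by_cases h0 : (0 : E) ∈ segment ℝ x y
  · calc ‖f x - f y‖ ≤ ‖f x‖ + ‖f y‖ := _root_.norm_sub_le _ _
      _ ≤ C * ‖x‖ + C * ‖y‖ := add_le_add (hb x) (hb y)
      _ = C * (dist x 0 + dist 0 y) := by rw [dist_zero_right, dist_zero_left]; ring
      _ = C * ‖x - y‖ := by rw [dist_add_dist_of_mem_segment h0, dist_eq_norm]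
  · have hne : ∀ z ∈ segment ℝ x y, z ≠ 0 := fun z hz h => h0 (h ▸ hz)
    rw [norm_sub_rev (f x), norm_sub_rev x]
    exact (convex_segment x y).norm_image_sub_le_of_norm_hasFDerivWithin_le
      (fun z hz => (hd z (hne z hz)).hasFDerivAt.hasFDerivWithinAt)
      (fun z hz => hC z (hne z hz)) (left_mem_segment ℝ x y) (right_mem_segment ℝ x y)

/-- The derivative is homogeneous of degree zero, so it is bounded by its maximum on the compact
unit sphere. -/
theorem IsHomogeneous.exists_lipschitz [FiniteDimensional ℝ E] {f : E → F} (hf : IsHomogeneous f)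
    (hd : ∀ x ≠ 0, ContDiffAt ℝ 1 f x) :
    ∃ C, 0 < C ∧ (∀ x ≠ 0, ‖fderiv ℝ f x‖ ≤ C) ∧ ∀ x y, ‖f x - f y‖ ≤ C * ‖x - y‖ := by
  have hc : ContinuousOn (fun x => ‖fderiv ℝ f x‖) (Metric.sphere (0 : E) 1) := fun x hx => by
    have hx0 : x ≠ 0 := by
      rintro rfl; simp at hx
    exact (((hd x hx0).fderiv_right (m := 0) (by simp)).continuousAt.norm).continuousWithinAt
  obtain ⟨C, hC⟩ := (isCompact_sphere (0 : E) 1).bddAbove_image hc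
  -- The maximum with 1 makes the constant positive, so that it may be inverted when the time
  -- parameter is chosen.
  have hC' : ∀ x ≠ 0, ‖fderiv ℝ f x‖ ≤ max C 1 := fun x hx => by
    rw [← hf.fderiv_smul (inv_pos.2 (norm_pos_iff.2 hx)) x]
    refine le_trans (hC ⟨_, ?_, rfl⟩) (le_max_left _ _)
    simp [norm_smul, hx]
  exact ⟨max C 1, by positivity, hC', hf.norm_sub_le
    (fun x hx => (hd x hx).differentiableAt one_ne_zero) hC'⟩

end Homogeneous

/-! ### Brackets of related vector fields -/

section Related

variable {E F : Type*} [NormedAddCommGroup E] [NormedSpace ℝ E]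
  [NormedAddCommGroup F] [NormedSpace ℝ F]

/-- The Lie brackets of `f`-related vector fields are `f`-related. -/
theorem fderiv_lieBracket_of_related {f : E → F} {V W : E → E} {V' W' : F → F} {x : E}
    (hf : ContDiffAt ℝ 2 f x) (hV : DifferentiableAt ℝ V x) (hW : DifferentiableAt ℝ W x)
    (hV' : DifferentiableAt ℝ V' (f x)) (hW' : DifferentiableAt ℝ W' (f x))
    (hVV : ∀ᶠ y in nhds x, fderiv ℝ f y (V y) = V' (f y))
    (hWW : ∀ᶠ y in nhds x, fderiv ℝ f y (W y) = W' (f y)) :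
    fderiv ℝ f x (lieBracket ℝ V W x) = lieBracket ℝ V' W' (f x) := by
  have hd : DifferentiableAt ℝ (fderiv ℝ f) x :=
    (hf.fderiv_right (m := 1) (by norm_num)).differentiableAt one_ne_zero
  have hf1 : DifferentiableAt ℝ f x := hf.differentiableAt (by norm_num)
  -- Differentiating Df(U) = U' ∘ f leaves one term in the second derivative of `f`; in the bracket
  -- these terms cancel by symmetry.
  have key : ∀ (U : E → E) (U' : F → F), DifferentiableAt ℝ U x → DifferentiableAt ℝ U' (f x) →
      (∀ᶠ y in nhds x, fderiv ℝ f y (U y) = U' (f y)) → ∀ v,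
      fderiv ℝ f x (fderiv ℝ U x v) =
        fderiv ℝ U' (f x) (fderiv ℝ f x v) - fderiv ℝ (fderiv ℝ f) x v (U x) := by
    intro U U' hU hU' h v
    have h1 := (hd.hasFDerivAt.clm_apply hU.hasFDerivAt).unique
      ((hU'.hasFDerivAt.comp x hf1.hasFDerivAt).congr_of_eventuallyEq h)
    have h2 := DFunLike.congr_fun h1 v
    simp only [add_apply, ContinuousLinearMap.comp_apply,
      ContinuousLinearMap.flip_apply] at h2
    rw [← h2]; abel
  have hs : IsSymmSndFDerivAt ℝ f x := hf.isSymmSndFDerivAt (by simp)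
  rw [lieBracket, lieBracket, map_sub, key W W' hW hW' hWW, key V V' hV hV' hVV,
    hVV.self_of_nhds, hWW.self_of_nhds, hs.eq (V x) (W x)]
  abel

end Related

/-! ### Explicit and implicit Euler steps -/

section Cayley

variable {E : Type*} [NormedAddCommGroup E] [NormedSpace ℝ E]

/-- A global left inverse must agree near `Φ a` with the smooth local inverse from the inverse
function theorem, so no continuity of `Ψ` is needed beforehand. -/
theorem contDiffAt_of_inverse {A : Type*} [NormedAddCommGroup A] [NormedSpace ℝ A]
    [CompleteSpace A] {Φ Ψ : A → A}
    (hl : ∀ a, Ψ (Φ a) = a) {a : A} (hΦ : ContDiffAt ℝ ∞ Φ a) {Φ' : A ≃L[ℝ] A}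
    (hd : HasFDerivAt Φ (Φ' : A →L[ℝ] A) a) : ContDiffAt ℝ ∞ Ψ (Φ a) := by
  have hn : (∞ : ℕ∞ω) ≠ 0 := by simp
  refine (hΦ.to_localInverse hd hn).congr_of_eventuallyEq ?_
  filter_upwards [(hΦ.hasStrictFDerivAt' hd hn).eventually_right_inverse] with y hy
  have := hl ((hΦ.hasStrictFDerivAt' hd hn).localInverse Φ Φ' a y)
  rw [hy] at this
  exact this

/-- One explicit Euler step of the vector field `V`. -/
def eulerStep (V : E → E) (s : ℝ) (m : E) : E := m + s • V m

/-- One implicit Euler step of the vector field `V`. -/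
def eulerStepInv (V : E → E) (s : ℝ) : E → E := Function.invFun (eulerStep V s)

variable {V : E → E} {C : ℝ}

/-- `s • V` is a contraction: this gives injectivity, and solving m = y - sV(m) is Banach's fixed
point theorem. -/
theorem eulerStep_bijective [CompleteSpace E] (hC : ∀ x y, ‖V x - V y‖ ≤ C * ‖x - y‖) {s : ℝ}
    (hs : |s| * C < 1) : Function.Bijective (eulerStep V s) := by
  have hle : ∀ x y, ‖s • V x - s • V y‖ ≤ |s| * C * ‖x - y‖ := fun x y => by
    rw [← smul_sub, norm_smul, Real.norm_eq_abs, mul_assoc]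
    exact mul_le_mul_of_nonneg_left (hC x y) (abs_nonneg s)
  constructor
  · intro x y h
    have h1 : x - y = -(s • V x - s • V y) := by
      simp only [eulerStep] at h
      have h' : x - y - -(s • V x - s • V y) = x + s • V x - (y + s • V y) := by abel
      rw [h, sub_self] at h'
      exact sub_eq_zero.1 h'
    have h2 := hle x y
    rw [← norm_neg (s • V x - s • V y), ← h1] at h2
    have h3 : ‖x - y‖ ≤ 0 := by nlinarith [norm_nonneg (x - y)]
    exact sub_eq_zero.1 (norm_le_zero_iff.1 h3)
  · intro y
    have hcontr : ContractingWith (Real.toNNReal (|s| * C)) (fun m => y - s • V m) := by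
      refine ⟨by rw [Real.toNNReal_lt_one]; exact hs, LipschitzWith.of_dist_le_mul fun a b => ?_⟩
      rw [dist_eq_norm, dist_eq_norm]
      have h1 : y - s • V a - (y - s • V b) = -(s • V a - s • V b) := by abel
      rw [h1, norm_neg]
      exact (hle a b).trans (mul_le_mul_of_nonneg_right (Real.le_coe_toNNReal _) (norm_nonneg _))
    have := hcontr.fixedPoint_isFixedPt
    refine ⟨hcontr.fixedPoint, ?_⟩
    rw [Function.IsFixedPt] at this
    rw [eulerStep]
    nth_rewrite 1 [← this]
    abel

theorem eulerStepInv_eulerStep [CompleteSpace E] (hC : ∀ x y, ‖V x - V y‖ ≤ C * ‖x - y‖) {s : ℝ}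
    (hs : |s| * C < 1) (m : E) : eulerStepInv V s (eulerStep V s m) = m :=
  Function.leftInverse_invFun (eulerStep_bijective hC hs).1 m

theorem eulerStep_eulerStepInv [CompleteSpace E] (hC : ∀ x y, ‖V x - V y‖ ≤ C * ‖x - y‖) {s : ℝ}
    (hs : |s| * C < 1) (m : E) : eulerStep V s (eulerStepInv V s m) = m :=
  Function.rightInverse_invFun (eulerStep_bijective hC hs).2 m

/-- Joint smoothness in time and space comes from inverting (t, m) ↦ (t, m + s(t)V(m)); its
derivative is injective since |s|‖DV‖ < 1. -/
theorem contDiffAt_eulerStepInv [FiniteDimensional ℝ E]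
    (hC : ∀ x y, ‖V x - V y‖ ≤ C * ‖x - y‖) (hC0 : 0 ≤ C) {s : ℝ → ℝ} (hs : ContDiff ℝ ∞ s)
    (hsC : ∀ t, |s t| * C < 1) {t : ℝ} {x : E} (hV : ContDiffAt ℝ ∞ V (eulerStepInv V (s t) x)) :
    ContDiffAt ℝ ∞ (fun q : ℝ × E => eulerStepInv V (s q.1) q.2) (t, x) := by
  have : CompleteSpace E := FiniteDimensional.complete ℝ E
  set m := eulerStepInv V (s t) x with hm
  have hmx : eulerStep V (s t) m = x := eulerStep_eulerStepInv hC (hsC t) x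
  let Φ : ℝ × E → ℝ × E := fun q => (q.1, eulerStep V (s q.1) q.2)
  let Ψ : ℝ × E → ℝ × E := fun q => (q.1, eulerStepInv V (s q.1) q.2)
  have hl : ∀ a, Ψ (Φ a) = a := fun a =>
    Prod.ext rfl (eulerStepInv_eulerStep hC (hsC a.1) a.2)
  have hΦ : ContDiffAt ℝ ∞ Φ (t, m) := by
    have h2 : ContDiffAt ℝ ∞ (fun q : ℝ × E => V q.2) (t, m) :=
      ContDiffAt.comp (t, m) (g := V) (f := Prod.snd) hV contDiffAt_snd
    exact contDiffAt_fst.prodMk (contDiffAt_snd.add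
      ((hs.contDiffAt.comp (t, m) contDiffAt_fst).smul h2))
  have hΦd : DifferentiableAt ℝ Φ (t, m) := hΦ.differentiableAt (by simp)
  have hVd : DifferentiableAt ℝ V m := hV.differentiableAt (by simp)
  have hnorm : ‖fderiv ℝ V m‖ ≤ C :=
    norm_fderiv_le_of_lip' ℝ hC0 (Filter.Eventually.of_forall fun y => hC y m)
  have hder : ∀ τ : ℝ, ∀ μ : E, fderiv ℝ Φ (t, m) (τ, μ) =
      (τ, μ + (s t • fderiv ℝ V m μ + (deriv s t * τ) • V m)) := by
    intro τ μ
    have h1 : HasFDerivAt (fun q : ℝ × E => s q.1)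
        ((ContinuousLinearMap.toSpanSingleton ℝ (deriv s t)).comp (ContinuousLinearMap.fst ℝ ℝ E))
        (t, m) :=
      HasFDerivAt.comp (t, m) (g := s)
        ((hs.differentiable (by simp)) t).hasDerivAt.hasFDerivAt hasFDerivAt_fst
    have h2 : HasFDerivAt (fun q : ℝ × E => V q.2)
        ((fderiv ℝ V m).comp (ContinuousLinearMap.snd ℝ ℝ E)) (t, m) :=
      HasFDerivAt.comp (t, m) (g := V) hVd.hasFDerivAt hasFDerivAt_snd
    have h3 : HasFDerivAt Φ _ (t, m) :=
      HasFDerivAt.prodMk hasFDerivAt_fst (HasFDerivAt.add hasFDerivAt_snd (h1.smul h2))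
    rw [h3.fderiv]
    simp [mul_comm]
  have hinj : Function.Injective (fderiv ℝ Φ (t, m)) := by
    rw [injective_iff_map_eq_zero]
    rintro ⟨τ, μ⟩ h
    rw [hder] at h
    obtain ⟨rfl, h2⟩ := Prod.mk.inj h
    have h3 : μ = -(s t • fderiv ℝ V m μ) := by
      simpa [add_eq_zero_iff_eq_neg] using h2
    have h4 : ‖μ‖ ≤ |s t| * C * ‖μ‖ := by
      conv_lhs => rw [h3]
      rw [norm_neg, norm_smul, Real.norm_eq_abs, mul_assoc]
      exact mul_le_mul_of_nonneg_left ((fderiv ℝ V m).le_of_opNorm_le hnorm μ) (abs_nonneg _)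
    have h5 : ‖μ‖ ≤ 0 := by nlinarith [norm_nonneg μ, hsC t]
    rw [norm_le_zero_iff.1 h5]
    rfl
  let Φ' : (ℝ × E) ≃L[ℝ] (ℝ × E) := (LinearEquiv.ofInjectiveEndo
    ((fderiv ℝ Φ (t, m) : (ℝ × E) →L[ℝ] (ℝ × E)) : (ℝ × E) →ₗ[ℝ] (ℝ × E)) hinj).toContinuousLinearEquiv
  have hΦ' : HasFDerivAt Φ (Φ' : (ℝ × E) →L[ℝ] (ℝ × E)) (t, m) := by
    convert! hΦd.hasFDerivAt using 1
  have h := contDiffAt_of_inverse hl hΦ hΦ'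
  have h' : Φ (t, m) = (t, x) := Prod.ext rfl hmx
  rw [h'] at h
  exact h.snd

end Cayley

/-! ### Closed one-forms on punctured three-space -/

section Primitive

variable {E : Type*} [NormedAddCommGroup E] [NormedSpace ℝ E]

/-- On the connected overlap the two primitives differ by a constant, which is absorbed into one of
them. -/
theorem exists_primitive_union {U V : Set E} (hU : IsOpen U) (hV : IsOpen V)
    (hUV : IsPreconnected (U ∩ V)) {β : E → E →L[ℝ] ℝ}
    (hfU : ∃ f : E → ℝ, ∀ x ∈ U, HasFDerivAt f (β x) x)
    (hfV : ∃ f : E → ℝ, ∀ x ∈ V, HasFDerivAt f (β x) x) :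
    ∃ f : E → ℝ, ∀ x ∈ U ∪ V, HasFDerivAt f (β x) x := by
  classical
  obtain ⟨f, hf⟩ := hfU
  obtain ⟨g, hg⟩ := hfV
  obtain ⟨c, hc⟩ : ∃ c, ∀ x ∈ U ∩ V, f x - g x = c := by
    have hd : ∀ x ∈ U ∩ V, HasFDerivAt (fun x => f x - g x) (0 : E →L[ℝ] ℝ) x := fun x hx => by
      simpa using (hf x hx.1).fun_sub (hg x hx.2)
    exact (hU.inter hV).exists_is_const_of_fderiv_eq_zero hUV
      (fun x hx => (hd x hx).differentiableAt.differentiableWithinAt) (fun x hx => (hd x hx).fderiv)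
  refine ⟨fun x => if x ∈ U then f x else g x + c, fun x hx => ?_⟩
  by_cases hxU : x ∈ U
  · refine (hf x hxU).congr_of_eventuallyEq ?_
    filter_upwards [hU.mem_nhds hxU] with y hy using if_pos hy
  · have hxV : x ∈ V := hx.resolve_left hxU
    refine ((hg x hxV).add_const c).congr_of_eventuallyEq ?_
    filter_upwards [hV.mem_nhds hxV] with y hy
    by_cases hyU : y ∈ U
    · rw [if_pos hyU, ← hc y ⟨hyU, hy⟩]; ring
    · rw [if_neg hyU]

/-- A closed one-form on the complement of the origin of Euclidean three-space is exact. -/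
theorem exists_primitive_compl_zero {β : EuclideanSpace ℝ (Fin 3) → EuclideanSpace ℝ (Fin 3) →L[ℝ] ℝ}
    (hβ : ∀ x ≠ 0, DifferentiableAt ℝ β x)
    (hsymm : ∀ x ≠ 0, ∀ u v, fderiv ℝ β x u v = fderiv ℝ β x v u) :
    ∃ f : EuclideanSpace ℝ (Fin 3) → ℝ, ∀ x ≠ 0, HasFDerivAt f (β x) x := by
  let A : EuclideanSpace ℝ (Fin 3) → Set (EuclideanSpace ℝ (Fin 3)) := fun a => {x | 0 < inner ℝ a x}
  have hAo : ∀ a, IsOpen (A a) := fun a => isOpen_lt continuous_const (by fun_prop)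
  have hAc : ∀ a, Convex ℝ (A a) := fun a =>
    convex_halfSpace_gt (f := fun x => inner ℝ a x)
      ⟨fun x y => inner_add_right a x y, fun c x => real_inner_smul_right a x c⟩ 0
  have hA0 : ∀ a, ∀ x ∈ A a, x ≠ 0 := by
    rintro a x hx rfl
    simp [A] at hx
  have hAp : ∀ a, ∃ f : EuclideanSpace ℝ (Fin 3) → ℝ, ∀ x ∈ A a, HasFDerivAt f (β x) x := fun a =>
    (hAc a).exists_forall_hasFDerivAt_of_fderiv_symmetric (hAo a)
      (fun x hx => (hβ x (hA0 a x hx)).differentiableWithinAt) fun x hx => hsymm x (hA0 a x hx)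
  have hmem : ∀ a x : EuclideanSpace ℝ (Fin 3), x ∈ A a ↔
      0 < a 0 * x 0 + a 1 * x 1 + a 2 * x 2 := fun a x => by
    simp [A, PiLp.inner_apply, Fin.sum_univ_three, mul_comm]
  -- Four open half-spaces cover the complement of the origin: if all coordinates are ≤ 0 and their
  -- sum is ≥ 0, the vector vanishes. Each half-space is convex, so the Poincaré lemma holds on it;
  -- explicit common points show that the successive overlaps are connected.
  let a₁ : EuclideanSpace ℝ (Fin 3) := !₂[1, 0, 0]
  let a₂ : EuclideanSpace ℝ (Fin 3) := !₂[0, 1, 0]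
  let a₃ : EuclideanSpace ℝ (Fin 3) := !₂[0, 0, 1]
  let a₄ : EuclideanSpace ℝ (Fin 3) := !₂[-1, -1, -1]
  have h12 := exists_primitive_union (hAo a₁) (hAo a₂) ((hAc a₁).inter (hAc a₂)).isPreconnected
    (hAp a₁) (hAp a₂)
  have c13 := (hAc a₁).inter (hAc a₃)
  have c23 := (hAc a₂).inter (hAc a₃)
  have h123 := exists_primitive_union ((hAo a₁).union (hAo a₂)) (hAo a₃) (by
    rw [Set.union_inter_distrib_right]
    refine c13.isPreconnected.union' ⟨!₂[1, 1, 1], ?_⟩ c23.isPreconnected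
    simp [hmem, a₁, a₂, a₃]) h12 (hAp a₃)
  have h1234 := exists_primitive_union (((hAo a₁).union (hAo a₂)).union (hAo a₃)) (hAo a₄) (by
    rw [Set.union_inter_distrib_right, Set.union_inter_distrib_right]
    refine (((hAc a₁).inter (hAc a₄)).isPreconnected.union' ⟨!₂[1, 1, -3], ?_⟩
      ((hAc a₂).inter (hAc a₄)).isPreconnected).union' ⟨!₂[1, -3, 1], ?_⟩
      ((hAc a₃).inter (hAc a₄)).isPreconnected
    · simp [hmem, a₁, a₂, a₄]; norm_num
    · simp [hmem, a₁, a₂, a₃, a₄]; norm_num) h123 (hAp a₄)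
  obtain ⟨f, hf⟩ := h1234
  refine ⟨f, fun x hx => hf x ?_⟩
  by_contra hcon
  simp only [Set.mem_union, hmem, not_or, not_lt] at hcon
  obtain ⟨⟨⟨h1, h2⟩, h3⟩, h4⟩ := hcon
  simp [a₁, a₂, a₃, a₄] at h1 h2 h3 h4
  apply hx
  ext i
  fin_cases i <;> simp <;> linarith

end Primitive

open Metric Module

/-! ### Tangent spaces of the unit sphere as hyperplanes -/

section Inclusion

variable {E : Type*} [NormedAddCommGroup E]

theorem ne_zero_of_mem_sphere (x : sphere (0 : E) 1) : (x : E) ≠ 0 :=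
  ne_zero_of_mem_unit_sphere x

theorem norm_coe_sphere (x : sphere (0 : E) 1) : ‖(x : E)‖ = 1 := mem_sphere_zero_iff_norm.1 x.2

variable [InnerProductSpace ℝ E] {n : ℕ} [Fact (finrank ℝ E = n + 1)]

/-- The differential of the inclusion of the unit sphere. -/
def incl (x : sphere (0 : E) 1) : TangentSpace (𝓡 n) x →L[ℝ] E :=
  mfderiv (𝓡 n) 𝓘(ℝ, E) ((↑) : sphere (0 : E) 1 → E) x

theorem incl_injective (x : sphere (0 : E) 1) : Function.Injective (incl (n := n) x) :=
  injective_mvfderiv_subtypeVal_sphere x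

theorem mem_range_incl (x : sphere (0 : E) 1) {w : E} :
    (∃ v, incl (n := n) x v = w) ↔ inner ℝ (x : E) w = 0 := by
  rw [← Submodule.mem_orthogonal_singleton_iff_inner_right, ← range_mvfderiv_subtypeVal (n := n) x]
  rfl

theorem inner_incl (x : sphere (0 : E) 1) (v : TangentSpace (𝓡 n) x) :
    inner ℝ (x : E) (incl x v) = 0 := (mem_range_incl x).1 ⟨v, rfl⟩

theorem mdifferentiableAt_coe (x : sphere (0 : E) 1) :
    MDifferentiableAt (𝓡 n) 𝓘(ℝ, E) ((↑) : sphere (0 : E) 1 → E) x :=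
  (contMDiff_coe_sphere (m := 1) x).mdifferentiableAt one_ne_zero

theorem mfderiv_comp_coe {F : Type*} [NormedAddCommGroup F] [NormedSpace ℝ F] {f : E → F}
    (x : sphere (0 : E) 1) (hf : DifferentiableAt ℝ f x) (v : TangentSpace (𝓡 n) x) :
    (mfderiv (𝓡 n) 𝓘(ℝ, F) (fun y : sphere (0 : E) 1 => f y) x v : F) =
      fderiv ℝ f x (incl x v) := by
  have h := mfderiv_comp x (I' := 𝓘(ℝ, E)) (g := f) hf.mdifferentiableAt
    (mdifferentiableAt_coe (n := n) x)
  rw [mfderiv_eq_fderiv] at h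
  exact DFunLike.congr_fun h v

end Inclusion

/-! ### Radial projection and homogeneous extension -/

section Sphere

variable {E : Type*} [NormedAddCommGroup E] [InnerProductSpace ℝ E] [Nontrivial E]

/-- The radial projection of a nonzero vector to the unit sphere. -/
def toSphere (x : E) : sphere (0 : E) 1 :=
  haveI : Nonempty (sphere (0 : E) 1) := (NormedSpace.sphere_nonempty.2 zero_le_one).to_subtype
  open Classical in
  if h : x ≠ 0 then ⟨‖x‖⁻¹ • x, by simp [norm_smul, h]⟩ else Classical.arbitrary _

theorem coe_toSphere {x : E} (hx : x ≠ 0) : (toSphere x : E) = ‖x‖⁻¹ • x := by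
  rw [toSphere, dif_pos hx]

theorem toSphere_coe (x : sphere (0 : E) 1) : toSphere (x : E) = x :=
  Subtype.ext (by rw [coe_toSphere (ne_zero_of_mem_sphere x), norm_coe_sphere, inv_one, one_smul])

theorem norm_smul_toSphere {x : E} (hx : x ≠ 0) : ‖x‖ • (toSphere x : E) = x := by
  rw [coe_toSphere hx, smul_inv_smul₀ (norm_ne_zero_iff.2 hx)]

theorem toSphere_smul {r : ℝ} (hr : 0 < r) (x : E) : toSphere (r • x) = toSphere x := by
  by_cases hx : x = 0
  · rw [hx, smul_zero]
  · refine Subtype.ext ?_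
    rw [coe_toSphere hx, coe_toSphere (smul_ne_zero hr.ne' hx), norm_smul, Real.norm_eq_abs,
      abs_of_pos hr, smul_smul]
    congr 1
    field_simp

section HomExt

variable {F : Type*} [NormedAddCommGroup F] [NormedSpace ℝ F]

/-- The extension of a map on the unit sphere that is homogeneous of degree one. -/
def homExt (g : sphere (0 : E) 1 → F) (x : E) : F := ‖x‖ • g (toSphere x)

theorem homExt_coe (g : sphere (0 : E) 1 → F) (x : sphere (0 : E) 1) : homExt g x = g x := by
  rw [homExt, toSphere_coe, norm_coe_sphere, one_smul]

theorem isHomogeneous_homExt (g : sphere (0 : E) 1 → F) : IsHomogeneous (homExt g) := by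
  intro r hr x
  rw [homExt, homExt, toSphere_smul hr, norm_smul, Real.norm_eq_abs, abs_of_pos hr, mul_smul]

theorem homExt_eq_of_isHomogeneous {g : sphere (0 : E) 1 → F} {f : E → F} (hf : IsHomogeneous f)
    (h : ∀ x : sphere (0 : E) 1, g x = f x) (x : E) : homExt g x = f x := by
  by_cases hx : x = 0
  · rw [hx, (isHomogeneous_homExt g).map_zero, hf.map_zero]
  · rw [homExt, h, ← hf _ (norm_pos_iff.2 hx), norm_smul_toSphere hx]

end HomExt

variable {n : ℕ} [Fact (finrank ℝ E = n + 1)]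

theorem contMDiffAt_toSphere {x : E} (hx : x ≠ 0) :
    ContMDiffAt 𝓘(ℝ, E) (𝓡 n) ∞ (toSphere : E → sphere (0 : E) 1) x := by
  have : FiniteDimensional ℝ E := .of_fact_finrank_eq_succ n
  have hpos : 0 < ‖x‖ := norm_pos_iff.2 hx
  -- The projection is first composed with a smooth map `g` that is the identity near `x` and stays
  -- within ‖x‖/2 of `x`. It thus never vanishes, and g/‖g‖ is a globally smooth sphere-valued map.
  let χ : ContDiffBump x := ⟨‖x‖ / 4, ‖x‖ / 2, by positivity, by linarith⟩
  let g : E → E := fun y => x + χ y • (y - x)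
  have hg : ContDiff ℝ ∞ g := contDiff_const.add (χ.contDiff.smul (contDiff_id.sub contDiff_const))
  have hg0 : ∀ y, g y ≠ 0 := fun y h => by
    have h1 : ‖χ y • (y - x)‖ = ‖x‖ := by
      rw [← norm_neg x, ← eq_neg_of_add_eq_zero_right h]
    by_cases hy : y ∈ ball x (‖x‖ / 2)
    · rw [norm_smul, Real.norm_of_nonneg χ.nonneg, ← dist_eq_norm] at h1
      have h2 : χ y * dist y x ≤ 1 * (‖x‖ / 2) :=
        mul_le_mul χ.le_one (mem_ball.1 hy).le dist_nonneg zero_le_one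
      linarith
    · rw [χ.zero_of_le_dist (not_lt.1 hy), zero_smul, norm_zero] at h1
      linarith
  have hG : ContDiff ℝ ∞ (fun y => ‖g y‖⁻¹ • g y) :=
    ((hg.norm ℝ hg0).inv fun y => norm_ne_zero_iff.2 (hg0 y)).smul hg
  have hmem : ∀ y, ‖g y‖⁻¹ • g y ∈ sphere (0 : E) 1 := fun y => by simp [norm_smul, hg0 y]
  refine ((hG.contMDiff.codRestrict_sphere hmem) x).congr_of_eventuallyEq ?_
  filter_upwards [χ.eventuallyEq_one] with y hy
  have hgy : g y = y := by simp [g, hy]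
  refine Subtype.ext ?_
  rw [Set.val_codRestrict_apply, hgy, coe_toSphere]
  rw [← hgy]; exact hg0 y

section HomExt

variable {F : Type*} [NormedAddCommGroup F] [NormedSpace ℝ F]

theorem contDiffAt_homExt_curve {G : ℝ → sphere (0 : E) 1 → F}
    (hG : ContMDiff (𝓘(ℝ, ℝ).prod (𝓡 n)) 𝓘(ℝ, F) ∞ (fun q : ℝ × sphere (0 : E) 1 => G q.1 q.2))
    (t : ℝ) {x : E} (hx : x ≠ 0) : ContDiffAt ℝ ∞ (fun q : ℝ × E => homExt (G q.1) q.2) (t, x) := by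
  have h1 : ContMDiffAt 𝓘(ℝ, ℝ × E) (𝓘(ℝ, ℝ).prod (𝓡 n)) ∞
      (fun q : ℝ × E => (q.1, toSphere q.2)) (t, x) := by
    refine ContMDiffAt.prodMk contDiffAt_fst.contMDiffAt ?_
    exact ContMDiffAt.comp (t, x) (I' := 𝓘(ℝ, E)) (g := toSphere) (f := Prod.snd)
      (contMDiffAt_toSphere hx) contDiffAt_snd.contMDiffAt
  have h2 : ContMDiffAt 𝓘(ℝ, ℝ × E) 𝓘(ℝ, F) ∞
      (fun q : ℝ × E => G q.1 (toSphere q.2)) (t, x) :=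
    ContMDiffAt.comp (t, x) (g := fun q : ℝ × sphere (0 : E) 1 => G q.1 q.2) (hG _) h1
  exact (contDiffAt_snd.norm ℝ hx).smul h2.contDiffAt

theorem contDiffAt_homExt {g : sphere (0 : E) 1 → F} (hg : ContMDiff (𝓡 n) 𝓘(ℝ, F) ∞ g)
    {x : E} (hx : x ≠ 0) : ContDiffAt ℝ ∞ (homExt g) x := by
  have h1 : ContMDiff (𝓘(ℝ, ℝ).prod (𝓡 n)) 𝓘(ℝ, F) ∞
      (fun q : ℝ × sphere (0 : E) 1 => g q.2) := hg.comp contMDiff_snd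
  exact ContDiffAt.comp x (f := fun y : E => ((0 : ℝ), y))
    (contDiffAt_homExt_curve (G := fun _ => g) h1 0 hx) (contDiffAt_const.prodMk contDiffAt_id)

end HomExt

theorem mfderiv_eq_fderiv_homExt {F : Type*} [NormedAddCommGroup F] [NormedSpace ℝ F]
    {g : sphere (0 : E) 1 → F} (hg : ContMDiff (𝓡 n) 𝓘(ℝ, F) ∞ g)
    (x : sphere (0 : E) 1) (v : TangentSpace (𝓡 n) x) :
    (mfderiv (𝓡 n) 𝓘(ℝ, F) g x v : F) = fderiv ℝ (homExt g) x (incl x v) := by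
  have h := mfderiv_comp_coe x ((contDiffAt_homExt hg (ne_zero_of_mem_sphere x)).differentiableAt
    (by simp)) v
  have h2 : (fun y : sphere (0 : E) 1 => homExt g y) = g := funext (homExt_coe g)
  rwa [h2] at h

/-- This turns conditions on manifold differentials into calculus in the ambient vector space. -/
theorem incl_mfderiv {E' : Type*} [NormedAddCommGroup E'] [InnerProductSpace ℝ E'] [Nontrivial E']
    {m : ℕ} [Fact (finrank ℝ E' = m + 1)] {f : sphere (0 : E) 1 → sphere (0 : E') 1}
    (hf : ContMDiff (𝓡 n) (𝓡 m) ∞ f) (x : sphere (0 : E) 1) (v : TangentSpace (𝓡 n) x) :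
    incl (f x) (mfderiv (𝓡 n) (𝓡 m) f x v) =
      fderiv ℝ (homExt fun y => (f y : E')) x (incl x v) := by
  have hc : ContMDiff (𝓡 n) 𝓘(ℝ, E') ∞ (fun y => (f y : E')) := contMDiff_coe_sphere.comp hf
  rw [← mfderiv_eq_fderiv_homExt hc]
  have h := mfderiv_comp x (I' := 𝓡 m) (g := ((↑) : sphere (0 : E') 1 → E'))
    (mdifferentiableAt_coe (n := m) (f x)) ((hf x).mdifferentiableAt (by simp))
  exact (DFunLike.congr_fun h v).symm

end Sphere

/-! ### Vector fields on the sphere as ambient maps -/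

section SphereVF

variable {E : Type*} [NormedAddCommGroup E] [InnerProductSpace ℝ E]
  {n : ℕ} [Fact (finrank ℝ E = n + 1)]

/-- A vector field on the unit sphere, as a map into the ambient space. -/
def ambient (X : SmoothVF (𝓡 n) (sphere (0 : E) 1)) (x : sphere (0 : E) 1) : E := incl x (X x)

theorem ambient_injective : Function.Injective
    (ambient : SmoothVF (𝓡 n) (sphere (0 : E) 1) → sphere (0 : E) 1 → E) := fun X Y h => by
  ext x : 1
  exact incl_injective x (congrFun h x)

theorem ambient_add (X Y : SmoothVF (𝓡 n) (sphere (0 : E) 1)) (x : sphere (0 : E) 1) :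
    ambient (X + Y) x = ambient X x + ambient Y x := map_add (incl x) (X x) (Y x)

theorem ambient_smul (c : ℝ) (X : SmoothVF (𝓡 n) (sphere (0 : E) 1)) (x : sphere (0 : E) 1) :
    ambient (c • X) x = c • ambient X x := map_smul (incl x) c (X x)

theorem ambient_zero (x : sphere (0 : E) 1) :
    ambient (0 : SmoothVF (𝓡 n) (sphere (0 : E) 1)) x = 0 := map_zero (incl x)

theorem inner_ambient (X : SmoothVF (𝓡 n) (sphere (0 : E) 1)) (x : sphere (0 : E) 1) :
    inner ℝ (x : E) (ambient X x) = 0 := inner_incl x (X x)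

theorem contMDiff_ambient (X : SmoothVF (𝓡 n) (sphere (0 : E) 1)) :
    ContMDiff (𝓡 n) 𝓘(ℝ, E) ∞ (ambient X) := by
  have h1 : ContMDiff (𝓡 n).tangent 𝓘(ℝ, E).tangent ∞
      (tangentMap (𝓡 n) 𝓘(ℝ, E) ((↑) : sphere (0 : E) 1 → E)) :=
    (contMDiff_coe_sphere (m := ∞)).contMDiff_tangentMap (by simp)
  exact ((contMDiff_snd_tangentBundle_modelSpace E 𝓘(ℝ, E)).comp h1).comp X.contMDiff

variable [Nontrivial E]

/-- The field is the image of `V` under the differential of the radial projection. That differential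
fixes tangent vectors because the projection restricts to the identity on the sphere. -/
theorem exists_ambient_eq {V : sphere (0 : E) 1 → E} (hV : ContMDiff (𝓡 n) 𝓘(ℝ, E) ∞ V)
    (hV0 : ∀ x : sphere (0 : E) 1, inner ℝ (x : E) (V x) = 0) :
    ∃ X : SmoothVF (𝓡 n) (sphere (0 : E) 1), ∀ x, ambient X x = V x := by
  have hto : ContMDiffOn 𝓘(ℝ, E) (𝓡 n) ∞ (toSphere : E → sphere (0 : E) 1) {0}ᶜ :=
    fun x hx => (contMDiffAt_toSphere hx).contMDiffWithinAt
  let W₀ : E → E := homExt V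
  have ho : IsOpen ({0}ᶜ : Set E) := isOpen_compl_singleton
  have h1 := hto.contMDiffOn_tangentMapWithin (m := ∞) (by simp) ho.uniqueMDiffOn
  have h2 : ContMDiffOn 𝓘(ℝ, E) 𝓘(ℝ, E).tangent ∞
      (fun x => (⟨x, W₀ x⟩ : Bundle.TotalSpace E (TangentSpace 𝓘(ℝ, E) : E → Type _)))
      {0}ᶜ :=
    contMDiffOn_vectorSpace_iff_contDiffOn.2
      fun x hx => (contDiffAt_homExt hV hx).contDiffWithinAt
  have h3 := (h1.comp h2 fun x hx => hx).comp_contMDiff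
    (contMDiff_coe_sphere (m := ∞) (E := E) (n := n)) (fun x => ne_zero_of_mem_sphere x)
  let W : ∀ x : sphere (0 : E) 1, TangentSpace (𝓡 n) x := fun x =>
    mfderiv 𝓘(ℝ, E) (𝓡 n) (toSphere : E → sphere (0 : E) 1) (x : E) (V x)
  refine ⟨⟨W, h3.congr fun x => ?_⟩, fun x => ?_⟩
  · have hx : (x : E) ∈ ({0}ᶜ : Set E) := ne_zero_of_mem_sphere x
    refine Bundle.TotalSpace.ext (toSphere_coe x).symm (heq_of_eq ?_)
    change mfderiv 𝓘(ℝ, E) (𝓡 n) toSphere (x : E) (V x) =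
      mfderivWithin 𝓘(ℝ, E) (𝓡 n) toSphere {0}ᶜ (x : E) (W₀ x)
    rw [mfderivWithin_of_isOpen ho hx]
    exact congrArg _ (homExt_coe V x).symm
  · have hd : MDifferentiableAt 𝓘(ℝ, E) (𝓡 n) (toSphere : E → sphere (0 : E) 1) (x : E) :=
      (contMDiffAt_toSphere (ne_zero_of_mem_sphere x)).mdifferentiableAt (by simp)
    obtain ⟨w, hw⟩ := (mem_range_incl (n := n) x).2 (hV0 x)
    have h4 := mfderiv_comp x hd (mdifferentiableAt_coe (n := n) x)
    have h5 : (toSphere : E → sphere (0 : E) 1) ∘ ((↑) : sphere (0 : E) 1 → E) = id :=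
      funext toSphere_coe
    rw [h5, mfderiv_id] at h4
    have h6 : w = mfderiv 𝓘(ℝ, E) (𝓡 n) (toSphere : E → sphere (0 : E) 1) (x : E) (incl x w) :=
      DFunLike.congr_fun h4 w
    rw [hw] at h6
    change incl x (W x) = V x
    rw [← hw]
    exact congrArg (incl x) h6.symm

/-- The extension of a vector field on the unit sphere to a vector field on the ambient space that
is homogeneous of degree one. -/
def extend (X : SmoothVF (𝓡 n) (sphere (0 : E) 1)) : E → E := homExt (ambient X)

theorem extend_coe (X : SmoothVF (𝓡 n) (sphere (0 : E) 1)) (x : sphere (0 : E) 1) :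
    extend X x = ambient X x := homExt_coe _ x

theorem isHomogeneous_extend (X : SmoothVF (𝓡 n) (sphere (0 : E) 1)) :
    IsHomogeneous (extend X) := isHomogeneous_homExt _

theorem contDiffAt_extend (X : SmoothVF (𝓡 n) (sphere (0 : E) 1)) {x : E} (hx : x ≠ 0) :
    ContDiffAt ℝ ∞ (extend X) x := contDiffAt_homExt (contMDiff_ambient X) hx

theorem differentiableAt_extend (X : SmoothVF (𝓡 n) (sphere (0 : E) 1)) {x : E} (hx : x ≠ 0) :
    DifferentiableAt ℝ (extend X) x := (contDiffAt_extend X hx).differentiableAt (by simp)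

theorem inner_extend (X : SmoothVF (𝓡 n) (sphere (0 : E) 1)) (x : E) :
    inner ℝ x (extend X x) = 0 := by
  by_cases hx : x = 0
  · rw [hx, inner_zero_left]
  · rw [extend, homExt]
    nth_rewrite 1 [← norm_smul_toSphere hx]
    rw [inner_smul_left, inner_smul_right, inner_ambient, mul_zero, mul_zero]

theorem extend_add (X Y : SmoothVF (𝓡 n) (sphere (0 : E) 1)) :
    extend (X + Y) = fun x => extend X x + extend Y x := by
  funext x
  simp only [extend, homExt, ambient_add, smul_add]

theorem extend_smul (c : ℝ) (X : SmoothVF (𝓡 n) (sphere (0 : E) 1)) :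
    extend (c • X) = fun x => c • extend X x := by
  funext x
  simp only [extend, homExt, ambient_smul, smul_comm c]

theorem extend_zero : extend (0 : SmoothVF (𝓡 n) (sphere (0 : E) 1)) = 0 := by
  funext x
  simp only [extend, homExt, ambient_zero, smul_zero, Pi.zero_apply]

/-- An inverse chart followed by the inclusion relates the chart expression of a field to its
homogeneous extension, so the brackets are related too. -/
theorem incl_mlieBracket (X Y : SmoothVF (𝓡 n) (sphere (0 : E) 1)) (x : sphere (0 : E) 1) :
    incl x (mlieBracket (𝓡 n) X Y x) = lieBracket ℝ (extend X) (extend Y) (x : E) := by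
  have : IsManifold (𝓡 n) (minSmoothness ℝ 3) (sphere (0 : E) 1) :=
    IsManifold.of_le (n := ω) (by simp)
  have : IsManifold (𝓡 n) 2 (sphere (0 : E) 1) := IsManifold.of_le (n := ω) (by simp)
  have hms : minSmoothness ℝ 2 ≤ (∞ : ℕ∞ω) := by
    rw [minSmoothness_of_isRCLikeNormedField]; exact two_le_infty
  let φ := extChartAt (𝓡 n) x
  let σ : EuclideanSpace ℝ (Fin n) → sphere (0 : E) 1 := φ.symm
  let z := φ x
  have hz : z ∈ φ.target := mem_extChartAt_target x
  have hσz : σ z = x := extChartAt_to_inv x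
  have hto : IsOpen φ.target := isOpen_extChartAt_target x
  have hσ : ∀ y ∈ φ.target, ContMDiffAt 𝓘(ℝ, EuclideanSpace ℝ (Fin n)) (𝓡 n) ∞ σ y := fun y hy =>
    (contMDiffOn_extChartAt_symm x y hy).contMDiffAt (hto.mem_nhds hy)
  have hinv : ∀ y ∈ φ.target, (mfderiv 𝓘(ℝ, EuclideanSpace ℝ (Fin n)) (𝓡 n) σ y).IsInvertible :=
    fun y hy => by
      have := isInvertible_mfderivWithin_extChartAt_symm (I := 𝓡 n) (x := x) hy
      rwa [ModelWithCorners.range_eq_univ, mfderivWithin_univ] at this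
  have hg : ∀ y ∈ φ.target, ContDiffAt ℝ ∞ (fun y => (σ y : E)) y := fun y hy =>
    (ContMDiffAt.comp y (contMDiff_coe_sphere _) (hσ y hy)).contDiffAt
  have hD : ∀ y ∈ φ.target, ∀ v, fderiv ℝ (fun y => (σ y : E)) y v =
      incl (σ y) (mfderiv 𝓘(ℝ, EuclideanSpace ℝ (Fin n)) (𝓡 n) σ y v) := fun y hy v => by
    have h := mfderiv_comp y (mdifferentiableAt_coe (n := n) (σ y))
      ((hσ y hy).mdifferentiableAt (by simp))
    have h2 : mfderiv 𝓘(ℝ, EuclideanSpace ℝ (Fin n)) 𝓘(ℝ, E)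
      (((↑) : sphere (0 : E) 1 → E) ∘ σ) y v = _ := DFunLike.congr_fun h v
    rw [mfderiv_eq_fderiv] at h2
    exact h2
  let pb : SmoothVF (𝓡 n) (sphere (0 : E) 1) → EuclideanSpace ℝ (Fin n) → EuclideanSpace ℝ (Fin n) :=
    fun X => mpullback 𝓘(ℝ, EuclideanSpace ℝ (Fin n)) (𝓡 n) σ X
  have hpb : ∀ (U : ∀ y : sphere (0 : E) 1, TangentSpace (𝓡 n) y), ∀ y ∈ φ.target,
      fderiv ℝ (fun y => (σ y : E)) y
        (mpullback 𝓘(ℝ, EuclideanSpace ℝ (Fin n)) (𝓡 n) σ U y) = incl (σ y) (U (σ y)) :=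
    fun U y hy => by
      refine (hD y hy _).trans ?_
      exact congrArg (incl (σ y)) ((hinv y hy).self_apply_inverse (U (σ y)))
  have hpd : ∀ X : SmoothVF (𝓡 n) (sphere (0 : E) 1), DifferentiableAt ℝ (pb X) z := fun X => by
    have h1 := MDifferentiableAt.mpullback_vectorField (X.mdifferentiableAt (σ z)) (hσ z hz)
      (hinv z hz) two_le_infty
    have h2 := (contMDiff_snd_tangentBundle_modelSpace (n := 1) (EuclideanSpace ℝ (Fin n))
      𝓘(ℝ, EuclideanSpace ℝ (Fin n))).mdifferentiable one_ne_zero _ |>.comp z h1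
    exact mdifferentiableAt_iff_differentiableAt.1 h2
  have hpe : ∀ X : SmoothVF (𝓡 n) (sphere (0 : E) 1), ∀ᶠ y in nhds z,
      fderiv ℝ (fun y => (σ y : E)) y (pb X y) = extend X (σ y : E) := fun X => by
    filter_upwards [hto.mem_nhds hz] with y hy
    rw [extend_coe]
    exact hpb X y hy
  have key := fderiv_lieBracket_of_related ((hg z hz).of_le two_le_infty) (hpd X) (hpd Y)
    (differentiableAt_extend X (ne_zero_of_mem_sphere (σ z)))
    (differentiableAt_extend Y (ne_zero_of_mem_sphere (σ z))) (hpe X) (hpe Y)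
  have hb := mpullback_mlieBracket (X.mdifferentiableAt (σ z)) (Y.mdifferentiableAt (σ z))
    (hσ z hz) hms
  have hl : mlieBracket 𝓘(ℝ, EuclideanSpace ℝ (Fin n)) (pb X) (pb Y) z =
      lieBracket ℝ (pb X) (pb Y) z := by
    rw [← mlieBracketWithin_univ, mlieBracketWithin_eq_lieBracketWithin]
    exact congrFun (lieBracketWithin_univ (V := pb X) (W := pb Y)) z
  have h3 := hpb (mlieBracket (𝓡 n) X Y) z hz
  have h4 := (h3.symm.trans (congrArg (fderiv ℝ (fun y => (σ y : E)) z) (hb.trans hl))).trans key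
  rwa [hσz] at h4

/-- Both sides agree on the sphere and are homogeneous of degree one, the derivatives of the
extensions having degree zero. -/
theorem extend_lie (X Y : SmoothVF (𝓡 n) (sphere (0 : E) 1)) (x : E) :
    extend ⁅X, Y⁆ x = lieBracket ℝ (extend X) (extend Y) x := by
  refine homExt_eq_of_isHomogeneous (fun r hr x => ?_) (incl_mlieBracket X Y) x
  simp only [lieBracket, (isHomogeneous_extend X).fderiv_smul hr,
    (isHomogeneous_extend Y).fderiv_smul hr, isHomogeneous_extend X r hr,
    isHomogeneous_extend Y r hr, map_smul, smul_sub]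

end SphereVF

/-- The derivatives in `t` and in `x` commute. -/
theorem hasDerivAt_fderiv_of_hasDerivAt {E F : Type*} [NormedAddCommGroup E] [NormedSpace ℝ E]
    [NormedAddCommGroup F] [NormedSpace ℝ F] {G : ℝ → E → F} {V : E → F} {x : E}
    (hG : ContDiffAt ℝ ∞ (fun q : ℝ × E => G q.1 q.2) (0, x))
    (hV : ∀ᶠ y in nhds x, HasDerivAt (fun t => G t y) (V y) 0) (v : E) :
    HasDerivAt (fun t => fderiv ℝ (G t) x v) (fderiv ℝ V x v) 0 := by
  set g : ℝ × E → F := fun q => G q.1 q.2 with hgdef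
  have hnear : ∀ᶠ q in nhds ((0 : ℝ), x), DifferentiableAt ℝ g q := by
    filter_upwards [(hG.of_le (m := 1) (by simp)).eventually (by simp)] with q hq
    exact hq.differentiableAt one_ne_zero
  have hD : DifferentiableAt ℝ (fderiv ℝ g) (0, x) :=
    (hG.fderiv_right (m := 1) (by rw [one_add_one_eq_two]; exact two_le_infty)).differentiableAt one_ne_zero
  -- Both sides of the claim are the second derivative of `g` at `(0, x)` on the pair (1,0), (0,v),
  -- taken in the two orders.
  have hsymm : IsSymmSndFDerivAt ℝ g (0, x) :=
    (hG.of_le two_le_infty).isSymmSndFDerivAt (by simp)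
  have hline : HasDerivAt (fun t : ℝ => (t, x)) ((1 : ℝ), (0 : E)) 0 :=
    (hasDerivAt_id (0 : ℝ)).prodMk (hasDerivAt_const (0 : ℝ) x)
  have hslice : ∀ y, HasFDerivAt (fun y : E => ((0 : ℝ), y)) (ContinuousLinearMap.inr ℝ ℝ E) y :=
    fun y => hasFDerivAt_prodMk_right (0 : ℝ) y
  have h1 : HasDerivAt (fun t => fderiv ℝ g (t, x) (0, v))
      (fderiv ℝ (fderiv ℝ g) (0, x) (1, 0) (0, v)) 0 := by
    have h := (ContinuousLinearMap.apply ℝ F ((0 : ℝ), v)).hasFDerivAt.comp_hasDerivAt (0 : ℝ)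
      (hD.hasFDerivAt.comp_hasDerivAt (0 : ℝ) hline)
    exact h
  have h2 : HasFDerivAt V (((ContinuousLinearMap.apply ℝ F ((1 : ℝ), (0 : E))).comp
      (fderiv ℝ (fderiv ℝ g) (0, x))).comp (ContinuousLinearMap.inr ℝ ℝ E)) x := by
    have h : HasFDerivAt (fun y => fderiv ℝ g (0, y) (1, 0)) _ x :=
      (ContinuousLinearMap.apply ℝ F ((1 : ℝ), (0 : E))).hasFDerivAt.comp x
        (HasFDerivAt.comp x (g := fderiv ℝ g) hD.hasFDerivAt (hslice x))
    refine h.congr_of_eventuallyEq ?_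
    have hc : Filter.Tendsto (fun y : E => ((0 : ℝ), y)) (nhds x) (nhds (0, x)) :=
      (hslice x).continuousAt
    filter_upwards [hV, hc.eventually hnear] with y hy hdy
    have hly : HasDerivAt (fun t : ℝ => (t, y)) ((1 : ℝ), (0 : E)) 0 :=
      (hasDerivAt_id (0 : ℝ)).prodMk (hasDerivAt_const (0 : ℝ) y)
    exact hy.unique (HasFDerivAt.comp_hasDerivAt (0 : ℝ) (l := g) hdy.hasFDerivAt hly)
  have h3 : fderiv ℝ V x v = fderiv ℝ (fderiv ℝ g) (0, x) (1, 0) (0, v) := by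
    rw [h2.fderiv, hsymm.eq]
    rfl
  rw [h3]
  refine h1.congr_of_eventuallyEq ?_
  filter_upwards [hline.continuousAt.eventually hnear] with t ht
  have h4 : HasFDerivAt (fun y => g (t, y)) _ x :=
    HasFDerivAt.comp x (g := g) ht.hasFDerivAt (hasFDerivAt_prodMk_right t x)
  change fderiv ℝ (fun y => g (t, y)) x v = _
  rw [h4.fderiv]
  rfl

/-! ### Curves of diffeomorphisms of the sphere and their velocities -/

section Curve

variable {E : Type*} [NormedAddCommGroup E] [InnerProductSpace ℝ E]
  {n : ℕ} [Fact (finrank ℝ E = n + 1)]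

theorem hasMFDerivAt_curve_iff {γ : ℝ → sphere (0 : E) 1}
    (hγ : MDifferentiableAt 𝓘(ℝ, ℝ) (𝓡 n) γ 0) (w : TangentSpace (𝓡 n) (γ 0)) :
    HasMFDerivAt 𝓘(ℝ, ℝ) (𝓡 n) γ 0 ((1 : ℝ →L[ℝ] ℝ).smulRight w) ↔
      HasDerivAt (fun t => (γ t : E)) (incl (γ 0) w) 0 := by
  have h1 := (mdifferentiableAt_coe (n := n) (γ 0)).hasMFDerivAt.comp (0 : ℝ) hγ.hasMFDerivAt
  have h2 : HasFDerivAt (fun t => (γ t : E))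
      ((incl (γ 0)).comp (mfderiv 𝓘(ℝ, ℝ) (𝓡 n) γ 0)) 0 := h1.hasFDerivAt
  have h3 : HasDerivAt (fun t => (γ t : E)) (incl (γ 0) (mfderiv 𝓘(ℝ, ℝ) (𝓡 n) γ 0 (1 : ℝ))) 0 :=
    h2.hasDerivAt
  constructor
  · intro h
    have h4 : mfderiv 𝓘(ℝ, ℝ) (𝓡 n) γ 0 (1 : ℝ) = w := by
      rw [h.mfderiv]
      exact one_smul ℝ w
    rwa [h4] at h3
  · intro h
    have h4 := incl_injective (γ 0) (h3.unique h)
    have h5 : (mfderiv 𝓘(ℝ, ℝ) (𝓡 n) γ 0 : ℝ →L[ℝ] EuclideanSpace ℝ (Fin n)) =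
        (1 : ℝ →L[ℝ] ℝ).smulRight (w : EuclideanSpace ℝ (Fin n)) :=
      ContinuousLinearMap.ext_ring (h4.trans (one_smul ℝ w).symm)
    exact hγ.hasMFDerivAt.congr_mfderiv h5

theorem hasInitialVelocity_iff
    {F : ℝ → (sphere (0 : E) 1 ≃ₘ^∞⟮𝓡 n, 𝓡 n⟯ sphere (0 : E) 1)}
    (h0 : F 0 = Diffeomorph.refl (𝓡 n) (sphere (0 : E) 1) ∞)
    (hF : ContMDiff (𝓘(ℝ, ℝ).prod (𝓡 n)) (𝓡 n) ∞ (fun q : ℝ × sphere (0 : E) 1 => F q.1 q.2))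
    (X : SmoothVF (𝓡 n) (sphere (0 : E) 1)) :
    HasInitialVelocity F X ↔ ∀ x, HasDerivAt (fun t => (F t x : E)) (ambient X x) 0 := by
  refine forall_congr' fun x => ?_
  have hd : MDifferentiableAt 𝓘(ℝ, ℝ) (𝓡 n) (fun t => F t x) 0 :=
    ((hF.comp (contMDiff_id.prodMk contMDiff_const)) 0).mdifferentiableAt (by simp)
  rw [hasMFDerivAt_curve_iff hd]
  have h1 : F 0 x = x := by rw [h0]; rfl
  change HasDerivAt _ (ambient X (F 0 x)) 0 ↔ _
  rw [h1]

theorem exists_diffeomorph_curve {Φ Ψ : ℝ → E → E}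
    (hΦ : ∀ t, ∀ x : sphere (0 : E) 1, ContDiffAt ℝ ∞ (fun q : ℝ × E => Φ q.1 q.2) (t, (x : E)))
    (hΨ : ∀ t, ∀ x : sphere (0 : E) 1, ContDiffAt ℝ ∞ (fun q : ℝ × E => Ψ q.1 q.2) (t, (x : E)))
    (hΦS : ∀ t, ∀ x : sphere (0 : E) 1, ‖Φ t x‖ = 1)
    (hΨS : ∀ t, ∀ x : sphere (0 : E) 1, ‖Ψ t x‖ = 1)
    (hl : ∀ t, ∀ x : sphere (0 : E) 1, Ψ t (Φ t x) = x)
    (hr : ∀ t, ∀ x : sphere (0 : E) 1, Φ t (Ψ t x) = x) :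
    ∃ F : ℝ → (sphere (0 : E) 1 ≃ₘ^∞⟮𝓡 n, 𝓡 n⟯ sphere (0 : E) 1),
      (∀ t x, (F t x : E) = Φ t x) ∧
      ContMDiff (𝓘(ℝ, ℝ).prod (𝓡 n)) (𝓡 n) ∞ (fun q : ℝ × sphere (0 : E) 1 => F q.1 q.2) := by
  have smooth : ∀ {Φ : ℝ → E → E}
      (_ : ∀ t, ∀ x : sphere (0 : E) 1, ContDiffAt ℝ ∞ (fun q : ℝ × E => Φ q.1 q.2) (t, (x : E)))
      (hS : ∀ t, ∀ x : sphere (0 : E) 1, ‖Φ t x‖ = 1),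
      ContMDiff (𝓘(ℝ, ℝ).prod (𝓡 n)) (𝓡 n) ∞ (fun q : ℝ × sphere (0 : E) 1 =>
        (⟨Φ q.1 q.2, mem_sphere_zero_iff_norm.2 (hS q.1 q.2)⟩ : sphere (0 : E) 1)) := by
    intro Φ h hS
    refine ContMDiff.codRestrict_sphere (f := fun q : ℝ × sphere (0 : E) 1 => Φ q.1 q.2) ?_ _
    intro q
    have h1 : ContMDiffAt (𝓘(ℝ, ℝ).prod (𝓡 n)) 𝓘(ℝ, ℝ × E) ∞
        (fun q : ℝ × sphere (0 : E) 1 => (q.1, (q.2 : E))) q :=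
      ContMDiffAt.prodMk_space contMDiffAt_fst
        ((contMDiff_coe_sphere.comp contMDiff_snd) q)
    exact ContMDiffAt.comp q (g := fun q : ℝ × E => Φ q.1 q.2) (h q.1 q.2).contMDiffAt h1
  have slice : ∀ {f : ℝ × sphere (0 : E) 1 → sphere (0 : E) 1} (t : ℝ),
      ContMDiff (𝓘(ℝ, ℝ).prod (𝓡 n)) (𝓡 n) ∞ f →
      ContMDiff (𝓡 n) (𝓡 n) ∞ (fun x => f (t, x)) := fun t hf =>
    hf.comp (contMDiff_const.prodMk contMDiff_id)
  refine ⟨fun t =>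
    { toFun := fun x => ⟨Φ t x, mem_sphere_zero_iff_norm.2 (hΦS t x)⟩
      invFun := fun x => ⟨Ψ t x, mem_sphere_zero_iff_norm.2 (hΨS t x)⟩
      left_inv := fun x => Subtype.ext (hl t x)
      right_inv := fun x => Subtype.ext (hr t x)
      contMDiff_toFun := slice t (smooth hΦ hΦS)
      contMDiff_invFun := slice t (smooth hΨ hΨS) }, fun t x => rfl, smooth hΦ hΦS⟩

variable [Nontrivial E]

/-- The extension of a diffeomorphism of the unit sphere that is homogeneous of degree one. -/
def extendMap (f : sphere (0 : E) 1 ≃ₘ^∞⟮𝓡 n, 𝓡 n⟯ sphere (0 : E) 1) : E → E :=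
  homExt fun x => (f x : E)

theorem extendMap_coe (f : sphere (0 : E) 1 ≃ₘ^∞⟮𝓡 n, 𝓡 n⟯ sphere (0 : E) 1)
    (x : sphere (0 : E) 1) : extendMap f x = f x := homExt_coe _ x

theorem isHomogeneous_extendMap (f : sphere (0 : E) 1 ≃ₘ^∞⟮𝓡 n, 𝓡 n⟯ sphere (0 : E) 1) :
    IsHomogeneous (extendMap f) := isHomogeneous_homExt _

theorem norm_extendMap (f : sphere (0 : E) 1 ≃ₘ^∞⟮𝓡 n, 𝓡 n⟯ sphere (0 : E) 1) (x : E) :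
    ‖extendMap f x‖ = ‖x‖ := by
  rw [extendMap, homExt, norm_smul, norm_norm, norm_coe_sphere, mul_one]

theorem extendMap_refl : extendMap (Diffeomorph.refl (𝓡 n) (sphere (0 : E) 1) ∞) = id := by
  funext x
  exact homExt_eq_of_isHomogeneous (f := id) (fun r _ x => rfl) (fun x => rfl) x

theorem contDiffAt_extendMap (f : sphere (0 : E) 1 ≃ₘ^∞⟮𝓡 n, 𝓡 n⟯ sphere (0 : E) 1)
    {x : E} (hx : x ≠ 0) : ContDiffAt ℝ ∞ (extendMap f) x :=
  contDiffAt_homExt (contMDiff_coe_sphere.comp f.contMDiff) hx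

theorem differentiableAt_extendMap (f : sphere (0 : E) 1 ≃ₘ^∞⟮𝓡 n, 𝓡 n⟯ sphere (0 : E) 1)
    {x : E} (hx : x ≠ 0) : DifferentiableAt ℝ (extendMap f) x :=
  (contDiffAt_extendMap f hx).differentiableAt (by simp)

theorem incl_mfderiv_diffeomorph (f : sphere (0 : E) 1 ≃ₘ^∞⟮𝓡 n, 𝓡 n⟯ sphere (0 : E) 1)
    (x : sphere (0 : E) 1) (v : TangentSpace (𝓡 n) x) :
    incl (f x) (mfderiv (𝓡 n) (𝓡 n) f x v) = fderiv ℝ (extendMap f) x (incl x v) :=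
  incl_mfderiv f.contMDiff x v

variable {F : ℝ → (sphere (0 : E) 1 ≃ₘ^∞⟮𝓡 n, 𝓡 n⟯ sphere (0 : E) 1)}
  {G : Set (sphere (0 : E) 1 ≃ₘ^∞⟮𝓡 n, 𝓡 n⟯ sphere (0 : E) 1)}
  {X : SmoothVF (𝓡 n) (sphere (0 : E) 1)}

theorem IsSmoothCurveAtId.contDiffAt_extendMap (hF : IsSmoothCurveAtId G F) (t : ℝ) {x : E}
    (hx : x ≠ 0) : ContDiffAt ℝ ∞ (fun q : ℝ × E => extendMap (F q.1) q.2) (t, x) :=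
  contDiffAt_homExt_curve (G := fun t x => (F t x : E)) (contMDiff_coe_sphere.comp hF.smooth) t hx

theorem IsSmoothCurveAtId.hasDerivAt_extendMap (hF : IsSmoothCurveAtId G F)
    (hX : HasInitialVelocity F X) (x : E) :
    HasDerivAt (fun t => extendMap (F t) x) (extend X x) 0 :=
  ((hasInitialVelocity_iff hF.zero hF.smooth X).1 hX (toSphere x)).const_smul ‖x‖

theorem IsSmoothCurveAtId.hasDerivAt_fderiv_extendMap (hF : IsSmoothCurveAtId G F)
    (hX : HasInitialVelocity F X) {x : E} (hx : x ≠ 0) (v : E) :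
    HasDerivAt (fun t => fderiv ℝ (extendMap (F t)) x v) (fderiv ℝ (extend X) x v) 0 :=
  hasDerivAt_fderiv_of_hasDerivAt (G := fun t => extendMap (F t)) (hF.contDiffAt_extendMap 0 hx)
    (Filter.Eventually.of_forall (hF.hasDerivAt_extendMap hX)) v

theorem IsSmoothCurveAtId.extendMap_zero (hF : IsSmoothCurveAtId G F) (x : E) :
    extendMap (F 0) x = x := by
  rw [hF.zero, extendMap_refl]; rfl

theorem IsSmoothCurveAtId.fderiv_extendMap_zero (hF : IsSmoothCurveAtId G F) (x v : E) :
    fderiv ℝ (extendMap (F 0)) x v = v := by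
  rw [hF.zero, extendMap_refl, fderiv_id]; rfl

end Curve

/-! ### The implicit midpoint rule -/

section Cayley

variable {E : Type*} [NormedAddCommGroup E] [NormedSpace ℝ E] {V : E → E} {C : ℝ}

/-- One step of the implicit midpoint rule (of step size `2 * s`) for the vector field `V`. -/
def cayley (V : E → E) (s : ℝ) (x : E) : E := eulerStep V s (eulerStepInv V (-s) x)

theorem eulerStepInv_neg_sub [CompleteSpace E] (hC : ∀ x y, ‖V x - V y‖ ≤ C * ‖x - y‖) {s : ℝ}
    (hs : |s| * C < 1) (x : E) :
    eulerStepInv V (-s) x - s • V (eulerStepInv V (-s) x) = x := by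
  have h := eulerStep_eulerStepInv hC (s := -s) (by rwa [abs_neg]) x
  rwa [eulerStep, neg_smul, ← sub_eq_add_neg] at h

/-- A step and its reverse share the same midpoint. -/
theorem cayley_neg_cayley [CompleteSpace E] (hC : ∀ x y, ‖V x - V y‖ ≤ C * ‖x - y‖) {s : ℝ}
    (hs : |s| * C < 1) (x : E) : cayley V (-s) (cayley V s x) = x := by
  rw [cayley, cayley, neg_neg, eulerStepInv_eulerStep hC hs,
    eulerStep_eulerStepInv hC (by rwa [abs_neg])]

theorem isHomogeneous_eulerStepInv [CompleteSpace E] (hV : IsHomogeneous V)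
    (hC : ∀ x y, ‖V x - V y‖ ≤ C * ‖x - y‖) {s : ℝ} (hs : |s| * C < 1) :
    IsHomogeneous (eulerStepInv V s) := by
  intro r hr x
  apply (eulerStep_bijective hC hs).1
  have h := eulerStep_eulerStepInv hC hs x
  rw [eulerStep_eulerStepInv hC hs, eulerStep, hV r hr, smul_comm s r, ← smul_add]
  exact (congrArg (r • ·) h).symm

theorem isHomogeneous_cayley [CompleteSpace E] (hV : IsHomogeneous V)
    (hC : ∀ x y, ‖V x - V y‖ ≤ C * ‖x - y‖) {s : ℝ} (hs : |s| * C < 1) :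
    IsHomogeneous (cayley V s) := by
  intro r hr x
  rw [cayley, isHomogeneous_eulerStepInv hV hC (by rwa [abs_neg]) r hr, eulerStep, hV r hr,
    smul_comm s r, ← smul_add]
  rfl

theorem eulerStepInv_ne_zero [CompleteSpace E] (hV : IsHomogeneous V)
    (hC : ∀ x y, ‖V x - V y‖ ≤ C * ‖x - y‖) {s : ℝ} (hs : |s| * C < 1) {x : E} (hx : x ≠ 0) :
    eulerStepInv V s x ≠ 0 := fun h => hx <| by
  have h1 := eulerStep_eulerStepInv hC hs x
  rw [h, eulerStep, hV.map_zero, smul_zero, add_zero] at h1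
  exact h1.symm

theorem contDiffAt_cayley [FiniteDimensional ℝ E] (hV : IsHomogeneous V)
    (hVs : ∀ x ≠ 0, ContDiffAt ℝ ∞ V x)
    (hC : ∀ x y, ‖V x - V y‖ ≤ C * ‖x - y‖) (hC0 : 0 ≤ C) {s : ℝ → ℝ} (hs : ContDiff ℝ ∞ s)
    (hsC : ∀ t, |s t| * C < 1) (t : ℝ) {x : E} (hx : x ≠ 0) :
    ContDiffAt ℝ ∞ (fun q : ℝ × E => cayley V (s q.1) q.2) (t, x) := by
  have : CompleteSpace E := FiniteDimensional.complete ℝ E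
  have hsC' : ∀ t, |(-s t)| * C < 1 := fun t => by rw [abs_neg]; exact hsC t
  have hm := eulerStepInv_ne_zero hV hC (hsC' t) hx
  have h1 := contDiffAt_eulerStepInv hC hC0 hs.neg hsC' (t := t) (x := x) (hVs _ hm)
  have h2 : ContDiffAt ℝ ∞ (fun q : ℝ × E => V (eulerStepInv V (-s q.1) q.2)) (t, x) :=
    ContDiffAt.comp (t, x) (g := V) (hVs _ hm) h1
  exact h1.add ((hs.contDiffAt.comp (t, x) contDiffAt_fst).smul h2)

/-- The endpoints m ± sV(m) have equal norms because V(m) is orthogonal to m. -/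
theorem norm_cayley {E : Type*} [NormedAddCommGroup E] [InnerProductSpace ℝ E] [CompleteSpace E]
    {V : E → E} {C : ℝ} (hC : ∀ x y, ‖V x - V y‖ ≤ C * ‖x - y‖)
    (hV : ∀ x, inner ℝ x (V x) = 0) {s : ℝ} (hs : |s| * C < 1) (x : E) :
    ‖cayley V s x‖ = ‖x‖ := by
  rw [cayley, eulerStep]
  nth_rewrite 3 [← eulerStepInv_neg_sub hC hs x]
  set m := eulerStepInv V (-s) x
  refine (sq_eq_sq₀ (norm_nonneg _) (norm_nonneg _)).1 ?_
  rw [norm_add_sq_real, norm_sub_sq_real, inner_smul_right, hV m]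
  ring

end Cayley

/-! ### Symplectic linear algebra and Hamiltonian fields -/

section Contact

/-- Right multiplication by `i`. -/
def mulI : ℍ[ℝ] →L[ℝ] ℍ[ℝ] := (ContinuousLinearMap.mul ℝ ℍ[ℝ]).flip qi

theorem mulI_apply (x : ℍ[ℝ]) : mulI x = x * qi := rfl

theorem inner_eq (x y : ℍ[ℝ]) :
    inner ℝ x y = x.re * y.re + x.imI * y.imI + x.imJ * y.imJ + x.imK * y.imK := by
  rw [Quaternion.inner_def]
  simp

theorem inner_mulI_left (x y : ℍ[ℝ]) : inner ℝ (mulI x) y = -inner ℝ x (mulI y) := by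
  simp [inner_eq, mulI_apply]
  ring

theorem mulI_mulI (x : ℍ[ℝ]) : mulI (mulI x) = -x := by
  ext <;> simp [mulI_apply]

theorem inner_mulI_self (x : ℍ[ℝ]) : inner ℝ (mulI x) x = 0 := by
  have h := inner_mulI_left x x
  rw [real_inner_comm] at h
  rw [real_inner_comm]
  linarith

theorem inner_mulI_comm (x y : ℍ[ℝ]) : inner ℝ (mulI x) y = -inner ℝ (mulI y) x := by
  rw [inner_mulI_left, real_inner_comm]

theorem norm_mulI (x : ℍ[ℝ]) : ‖mulI x‖ = ‖x‖ := by
  have h : inner ℝ (mulI x) (mulI x) = inner ℝ x x := by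
    rw [inner_mulI_left, mulI_mulI, inner_neg_right, neg_neg]
  rw [real_inner_self_eq_norm_sq, real_inner_self_eq_norm_sq] at h
  exact (sq_eq_sq₀ (norm_nonneg _) (norm_nonneg _)).1 h

/-- A vector field on the complement of the origin is infinitesimally symplectic. -/
def IsHamiltonian (V : ℍ[ℝ] → ℍ[ℝ]) : Prop :=
  ∀ x ≠ 0, ∀ u v, inner ℝ (mulI (fderiv ℝ V x u)) v + inner ℝ (mulI u) (fderiv ℝ V x v) = 0

/-- The hypothesis says that the Lie derivative of λ along `V` vanishes; taking the exterior
derivative gives the same for ω. Concretely, differentiate along `u` and antisymmetrise in `u`, `v`,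
so that the second derivative of `V` drops out. -/
theorem isHamiltonian_of_contact {V : ℍ[ℝ] → ℍ[ℝ]} (hV : ∀ x ≠ 0, ContDiffAt ℝ 2 V x)
    (h : ∀ x ≠ 0, ∀ v, inner ℝ (mulI (V x)) v + inner ℝ (mulI x) (fderiv ℝ V x v) = 0) :
    IsHamiltonian V := by
  intro x hx u v
  have hd : HasFDerivAt V (fderiv ℝ V x) x := ((hV x hx).differentiableAt two_ne_zero).hasFDerivAt
  have hd2 : DifferentiableAt ℝ (fderiv ℝ V) x :=
    ((hV x hx).fderiv_right (m := 1) (by norm_num)).differentiableAt one_ne_zero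
  have hsymm : IsSymmSndFDerivAt ℝ V x := (hV x hx).isSymmSndFDerivAt (by simp)
  have key : ∀ u v, inner ℝ (mulI (fderiv ℝ V x u)) v + (inner ℝ (mulI u) (fderiv ℝ V x v) +
      inner ℝ (mulI x) (fderiv ℝ (fderiv ℝ V) x u v)) = 0 := by
    intro u v
    have h0 : HasFDerivAt (fun y => mulI (V y)) (mulI.comp (fderiv ℝ V x)) x :=
      mulI.hasFDerivAt.comp x hd
    have h1 : HasFDerivAt (fun y => fderiv ℝ V y v) _ x :=
      (ContinuousLinearMap.apply ℝ ℍ[ℝ] v).hasFDerivAt.comp x hd2.hasFDerivAt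
    have h2 := h0.inner ℝ (hasFDerivAt_const v x : HasFDerivAt (fun _ => v) (0 : ℍ[ℝ] →L[ℝ] ℍ[ℝ]) x)
    have h2' := h2.add ((mulI.hasFDerivAt (x := x)).inner ℝ h1)
    have h3 := h2'.congr_of_eventuallyEq (f₁ := fun _ : ℍ[ℝ] => (0 : ℝ)) (by
      filter_upwards [isOpen_compl_singleton.mem_nhds hx] with y hy
      exact (h y hy v).symm)
    have h4 := DFunLike.congr_fun (h3.unique (hasFDerivAt_const (0 : ℝ) x)) u
    simp [fderivInnerCLM_apply] at h4
    linarith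
  have h1 := key u v
  have h2 := key v u
  rw [hsymm.eq v u, inner_mulI_comm _ u, inner_mulI_comm v] at h2
  linarith

/-- Conversely, put `u = x` and use Euler's relation. -/
theorem IsHamiltonian.contact {V : ℍ[ℝ] → ℍ[ℝ]} (hV : IsHamiltonian V) (hh : IsHomogeneous V)
    {x : ℍ[ℝ]} (hx : x ≠ 0) (hd : DifferentiableAt ℝ V x) (v : ℍ[ℝ]) :
    inner ℝ (mulI (V x)) v + inner ℝ (mulI x) (fderiv ℝ V x v) = 0 := by
  have h := hV x hx x v
  rwa [hh.fderiv_self hd] at h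

/-- The potential λ([V,W]) equals 2ω(V,W). Differentiating this identity and using that `V` and `W`
are Hamiltonian yields the contact identity for the bracket. -/
theorem isHamiltonian_lieBracket {V W : ℍ[ℝ] → ℍ[ℝ]} (hV : IsHamiltonian V) (hW : IsHamiltonian W)
    (hVh : IsHomogeneous V) (hWh : IsHomogeneous W) (hVs : ∀ x ≠ 0, ContDiffAt ℝ ∞ V x)
    (hWs : ∀ x ≠ 0, ContDiffAt ℝ ∞ W x) : IsHamiltonian (lieBracket ℝ V W) := by
  have hs : ∀ x ≠ 0, ContDiffAt ℝ ∞ (lieBracket ℝ V W) x := fun x hx =>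
    (((hWs x hx).fderiv_right (m := ∞) (by simp)).clm_apply (hVs x hx)).sub
      (((hVs x hx).fderiv_right (m := ∞) (by simp)).clm_apply (hWs x hx))
  have hVd : ∀ x ≠ 0, DifferentiableAt ℝ V x := fun x hx => (hVs x hx).differentiableAt (by simp)
  have hWd : ∀ x ≠ 0, DifferentiableAt ℝ W x := fun x hx => (hWs x hx).differentiableAt (by simp)
  have hpot : ∀ x ≠ 0, inner ℝ (mulI x) (lieBracket ℝ V W x) =
      2 * inner ℝ (mulI (V x)) (W x) := fun x hx => by
    have h1 := hV.contact hVh hx (hVd x hx) (W x)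
    have h2 := hW.contact hWh hx (hWd x hx) (V x)
    rw [inner_mulI_comm (W x)] at h2
    rw [lieBracket, inner_sub_right]
    linarith
  refine isHamiltonian_of_contact (fun x hx => (hs x hx).of_le two_le_infty) fun x hx v => ?_
  have hZ : DifferentiableAt ℝ (lieBracket ℝ V W) x :=
    (hs x hx).differentiableAt (by simp)
  have h1 := (mulI.hasFDerivAt (x := x)).inner ℝ hZ.hasFDerivAt
  have h0 : HasFDerivAt (fun y => mulI (V y)) (mulI.comp (fderiv ℝ V x)) x :=
    mulI.hasFDerivAt.comp x (hVd x hx).hasFDerivAt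
  have h2 := (h0.inner ℝ (hWd x hx).hasFDerivAt).const_mul 2
  have h3 := h1.congr_of_eventuallyEq (f₁ := fun x => 2 * inner ℝ (mulI (V x)) (W x)) (by
    filter_upwards [isOpen_compl_singleton.mem_nhds hx] with y hy using (hpot y hy).symm)
  have h4 := DFunLike.congr_fun (h3.unique h2) v
  simp [fderivInnerCLM_apply] at h4
  have h5 := hV x hx v (W x)
  have h6 := hW x hx (V x) v
  have h7 : inner ℝ (mulI v) (lieBracket ℝ V W x) =
      inner ℝ (mulI v) (fderiv ℝ W x (V x)) - inner ℝ (mulI v) (fderiv ℝ V x (W x)) := by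
    rw [lieBracket, inner_sub_right]
  rw [inner_mulI_comm _ v] at h6 ⊢
  linarith

end Contact

/-! ### Strict contactomorphisms and their infinitesimal generators -/

section Strict

theorem fderiv_eq_of_tangent {V W : Type*} [NormedAddCommGroup V] [InnerProductSpace ℝ V]
    [NormedAddCommGroup W] [NormedSpace ℝ W] {L M : V →L[ℝ] W} {x : V} (hx : ‖x‖ = 1)
    (h0 : L x = M x) (h : ∀ w, inner ℝ x w = 0 → L w = M w) : L = M := by
  ext v
  have h1 : v = inner ℝ x v • x + (v - inner ℝ x v • x) := by abel
  rw [h1, map_add, map_add, map_smul, map_smul, h0, h]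
  rw [inner_sub_right, inner_smul_right, real_inner_self_eq_norm_sq, hx]
  ring

/-- The definition tests tangent vectors only. In the radial direction both sides vanish, since
Df(x)x = f(x) by Euler's relation and ω(y,y) = 0. -/
theorem mem_strictContact_iff {F : DiffS3} : F ∈ strictContact ↔ ∀ x ≠ 0, ∀ v,
    inner ℝ (mulI (extendMap F x)) (fderiv ℝ (extendMap F) x v) = inner ℝ (mulI x) v := by
  have hF := isHomogeneous_extendMap F
  constructor
  · intro h x hx v
    obtain ⟨y, r, hr, rfl⟩ : ∃ (y : S3) (r : ℝ), 0 < r ∧ x = r • (y : ℍ[ℝ]) :=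
      ⟨toSphere x, ‖x‖, norm_pos_iff.2 hx, (norm_smul_toSphere hx).symm⟩
    rw [hF.fderiv_smul hr, hF r hr, map_smul, map_smul, inner_smul_left, inner_smul_left]
    congr 1
    have hfd : fderiv ℝ (extendMap F) (y : ℍ[ℝ]) y = extendMap F y :=
      hF.fderiv_self (differentiableAt_extendMap F (ne_zero_of_mem_sphere y))
    have key : (innerSL ℝ (mulI (extendMap F y))).comp (fderiv ℝ (extendMap F) y) =
        innerSL ℝ (mulI (y : ℍ[ℝ])) := by
      refine fderiv_eq_of_tangent (norm_coe_sphere y) ?_ fun w hw => ?_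
      · simp [hfd, inner_mulI_self]
      · obtain ⟨w', rfl⟩ := (mem_range_incl (n := 3) y).2 hw
        have h1 : inner ℝ ((F y : ℍ[ℝ]) * qi) (incl (F y) (mfderiv (𝓡 3) (𝓡 3) F y w')) =
          inner ℝ ((y : ℍ[ℝ]) * qi) (incl y w') := h y w'
        rw [incl_mfderiv_diffeomorph, ← extendMap_coe] at h1
        exact h1
    exact DFunLike.congr_fun key v
  · intro h x v
    have h1 := h x (ne_zero_of_mem_sphere x) (incl x v)
    rw [← incl_mfderiv_diffeomorph, extendMap_coe] at h1
    exact h1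

/-- The exterior derivative of f^*λ = λ: differentiate and antisymmetrise, so that the symmetric
second derivative cancels. -/
theorem symplectic_of_mem_strictContact {F : DiffS3} (hF : F ∈ strictContact) {x : ℍ[ℝ]}
    (hx : x ≠ 0) (u v : ℍ[ℝ]) :
    inner ℝ (mulI (fderiv ℝ (extendMap F) x u)) (fderiv ℝ (extendMap F) x v) =
      inner ℝ (mulI u) v := by
  set f := extendMap F with hf
  have hfs : ContDiffAt ℝ 2 f x := (contDiffAt_extendMap F hx).of_le two_le_infty
  have hd : HasFDerivAt f (fderiv ℝ f x) x := (hfs.differentiableAt two_ne_zero).hasFDerivAt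
  have hd2 : DifferentiableAt ℝ (fderiv ℝ f) x :=
    (hfs.fderiv_right (m := 1) (by norm_num)).differentiableAt one_ne_zero
  have hsymm : IsSymmSndFDerivAt ℝ f x := hfs.isSymmSndFDerivAt (by simp)
  have key : ∀ u v, inner ℝ (mulI (f x)) (fderiv ℝ (fderiv ℝ f) x u v) +
      inner ℝ (mulI (fderiv ℝ f x u)) (fderiv ℝ f x v) = inner ℝ (mulI u) v := by
    intro u v
    have h0 : HasFDerivAt (fun y => mulI (f y)) (mulI.comp (fderiv ℝ f x)) x :=
      mulI.hasFDerivAt.comp x hd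
    have h1 : HasFDerivAt (fun y => fderiv ℝ f y v) _ x :=
      (ContinuousLinearMap.apply ℝ ℍ[ℝ] v).hasFDerivAt.comp x hd2.hasFDerivAt
    have h2 := h0.inner ℝ h1
    have h3 := (mulI.hasFDerivAt (x := x)).inner ℝ
      (hasFDerivAt_const v x : HasFDerivAt (fun _ => v) (0 : ℍ[ℝ] →L[ℝ] ℍ[ℝ]) x)
    have h4 := h2.congr_of_eventuallyEq (f₁ := fun y => inner ℝ (mulI y) v) (by
      filter_upwards [isOpen_compl_singleton.mem_nhds hx] with y hy
      exact (mem_strictContact_iff.1 hF y hy v).symm)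
    have h5 := DFunLike.congr_fun (h4.unique h3) u
    simpa [fderivInnerCLM_apply] using h5
  have h1 := key u v
  have h2 := key v u
  rw [hsymm.eq v u, inner_mulI_comm _ (fderiv ℝ f x u), inner_mulI_comm v] at h2
  linarith

theorem inner_fderiv_of_norm_eq {f : ℍ[ℝ] → ℍ[ℝ]} (hf : ∀ x, ‖f x‖ = ‖x‖) {x : ℍ[ℝ]}
    (hd : DifferentiableAt ℝ f x) (v : ℍ[ℝ]) : inner ℝ (f x) (fderiv ℝ f x v) = inner ℝ x v := by
  have h1 := hd.hasFDerivAt.inner ℝ hd.hasFDerivAt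
  have h2 := (hasFDerivAt_id (𝕜 := ℝ) x).inner ℝ (hasFDerivAt_id (𝕜 := ℝ) x)
  have h3 := h1.congr_of_eventuallyEq (f₁ := fun y => inner ℝ (id y) (id y))
    (Filter.Eventually.of_forall fun y => by
      simp only [id, real_inner_self_eq_norm_sq, hf])
  have h4 := DFunLike.congr_fun (h3.unique h2) v
  simp [fderivInnerCLM_apply] at h4
  rw [real_inner_comm (f x), real_inner_comm x v] at h4
  linarith

/-- The field xi is determined by ω(xi, v) = -⟨x, v⟩, and the extension preserves both ω and ⟨x,·⟩.
Nondegeneracy of ω makes the derivative bijective, so every test vector is an image. -/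
theorem fderiv_extendMap_mulI {F : DiffS3} (hF : F ∈ strictContact) {x : ℍ[ℝ]} (hx : x ≠ 0) :
    fderiv ℝ (extendMap F) x (mulI x) = mulI (extendMap F x) := by
  have hd := differentiableAt_extendMap F hx
  have hnd : Function.Injective (fderiv ℝ (extendMap F) x) := by
    rw [injective_iff_map_eq_zero]
    intro u hu
    have h1 := symplectic_of_mem_strictContact hF hx u (mulI u)
    rw [hu, map_zero, inner_zero_left, real_inner_self_eq_norm_sq, norm_mulI] at h1
    exact norm_eq_zero.1 (pow_eq_zero_iff two_ne_zero |>.1 h1.symm)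
  have hsurj : Function.Surjective (fderiv ℝ (extendMap F) x) :=
    LinearMap.injective_iff_surjective
      (f := (fderiv ℝ (extendMap F) x : ℍ[ℝ] →ₗ[ℝ] ℍ[ℝ])).1 hnd
  have key : ∀ w, inner ℝ (mulI (fderiv ℝ (extendMap F) x (mulI x)) - mulI (mulI (extendMap F x))) w
      = 0 := by
    intro w
    obtain ⟨v, rfl⟩ := hsurj w
    rw [inner_sub_left, symplectic_of_mem_strictContact hF hx, mulI_mulI, mulI_mulI,
      inner_neg_left, inner_neg_left, inner_fderiv_of_norm_eq (norm_extendMap F) hd, sub_self]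
  have h := inner_self_eq_zero.1 (key _)
  rw [← map_sub] at h
  have h2 := norm_mulI (fderiv ℝ (extendMap F) x (mulI x) - mulI (extendMap F x))
  rw [h, norm_zero] at h2
  exact sub_eq_zero.1 (norm_eq_zero.1 h2.symm)

@[simp] theorem expI_re (θ : ℝ) : (expI θ).re = Real.cos θ := rfl
@[simp] theorem expI_imI (θ : ℝ) : (expI θ).imI = Real.sin θ := rfl
@[simp] theorem expI_imJ (θ : ℝ) : (expI θ).imJ = 0 := rfl
@[simp] theorem expI_imK (θ : ℝ) : (expI θ).imK = 0 := rfl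

theorem hasDerivAt_expI (θ : ℝ) : HasDerivAt expI (expI θ * qi) θ := by
  have h : expI = fun θ : ℝ => Real.cos θ • (1 : ℍ[ℝ]) + Real.sin θ • qi := by
    funext θ; ext <;> simp
  have h2 : expI θ * qi = -Real.sin θ • (1 : ℍ[ℝ]) + Real.cos θ • qi := by
    ext <;> simp
  rw [h2, h]
  exact ((Real.hasDerivAt_cos θ).smul_const _).add ((Real.hasDerivAt_sin θ).smul_const _)

theorem expI_zero : expI 0 = 1 := by ext <;> simp

theorem expI_mul_expI_neg (θ : ℝ) : expI θ * expI (-θ) = 1 := by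
  have := Real.cos_sq_add_sin_sq θ
  ext <;> simp <;> linarith

theorem expI_neg_mul_expI (θ : ℝ) : expI (-θ) * expI θ = 1 := by
  simpa using expI_mul_expI_neg (-θ)

theorem expI_mul_qi (θ : ℝ) : expI θ * qi = qi * expI θ := by
  ext <;> simp

theorem expI_ne_zero (θ : ℝ) : expI θ ≠ 0 := left_ne_zero_of_mul_eq_one (expI_mul_expI_neg θ)

theorem norm_expI (θ : ℝ) : ‖expI θ‖ = 1 := by
  have h : ‖expI θ‖ ^ 2 = 1 := by
    rw [← real_inner_self_eq_norm_sq, inner_eq]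
    simp [← sq]
  exact (pow_eq_one_iff_of_nonneg (norm_nonneg _) two_ne_zero).1 h

/-- Strict contactomorphisms commute with the Hopf rotations. -/
theorem extendMap_mul_expI {F : DiffS3} (hF : F ∈ strictContact) (x : ℍ[ℝ]) (θ : ℝ) :
    extendMap F (x * expI θ) = extendMap F x * expI θ := by
  by_cases hx : x = 0
  · rw [hx, zero_mul, (isHomogeneous_extendMap F).map_zero, zero_mul]
  have hd : ∀ t, HasDerivAt (fun t => extendMap F (x * expI t) * expI (-t)) 0 t := by
    intro t
    have hxt : x * expI t ≠ 0 := mul_ne_zero hx (expI_ne_zero t)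
    have h1 : HasDerivAt (fun t => x * expI t) (mulI (x * expI t)) t := by
      have := (hasDerivAt_expI t).const_mul x
      rwa [← mul_assoc] at this
    have h2 := (differentiableAt_extendMap F hxt).hasFDerivAt.comp_hasDerivAt t h1
    rw [fderiv_extendMap_mulI hF hxt] at h2
    have h3 : HasDerivAt (fun t => expI (-t)) (-(expI (-t) * qi)) t := by
      have := (hasDerivAt_expI (-t)).scomp t (hasDerivAt_neg t)
      rw [neg_smul, one_smul] at this
      exact this
    have h4 := h2.mul h3
    convert! h4 using 1
    rw [mulI_apply, expI_mul_qi, mul_assoc, mul_neg]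
    simp
  have h := is_const_of_deriv_eq_zero (fun t => (hd t).differentiableAt) (fun t => (hd t).deriv) θ 0
  simp only [neg_zero, expI_zero, mul_one] at h
  rw [← h, mul_assoc, expI_neg_mul_expI, mul_one]

theorem isHamiltonian_of_mem_tangentAtId {X : SmoothVF (𝓡 3) S3}
    (hX : X ∈ tangentAtId strictContact) : IsHamiltonian (extend X) := by
  obtain ⟨F, hF, hv⟩ := hX
  refine isHamiltonian_of_contact
    (fun x hx => (contDiffAt_extend X hx).of_le two_le_infty) fun x hx v => ?_
  have h0 : HasDerivAt (fun t => mulI (extendMap (F t) x)) (mulI (extend X x)) 0 :=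
    mulI.hasFDerivAt.comp_hasDerivAt (0 : ℝ) (hF.hasDerivAt_extendMap hv x)
  have h1 := h0.inner ℝ (hF.hasDerivAt_fderiv_extendMap hv hx v)
  have h2 : (fun t => inner ℝ (mulI (extendMap (F t) x)) (fderiv ℝ (extendMap (F t)) x v)) =
      fun _ => inner ℝ (mulI x) v :=
    funext fun t => mem_strictContact_iff.1 (hF.mem t) x hx v
  rw [h2] at h1
  have h3 := h1.unique (hasDerivAt_const (0 : ℝ) (inner ℝ (mulI x) v))
  rw [hF.extendMap_zero, hF.fderiv_extendMap_zero] at h3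
  linarith

/-- With `P` the derivative of the midpoint and A = DV(m), one has u = (1 - sA)Pu, and the
derivative of the step sends `u` to (1 + sA)Pu. The two values of ω differ by 2s(ω(APu, Pv) + ω(Pu,
APv)) = 0. -/
theorem cayley_symplectic {V : ℍ[ℝ] → ℍ[ℝ]} (hV : IsHamiltonian V) (hVh : IsHomogeneous V)
    (hVs : ∀ x ≠ 0, ContDiffAt ℝ ∞ V x) {C : ℝ} (hC0 : 0 ≤ C)
    (hC : ∀ x y, ‖V x - V y‖ ≤ C * ‖x - y‖) {s : ℝ} (hs : |s| * C < 1) {x : ℍ[ℝ]} (hx : x ≠ 0)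
    (u v : ℍ[ℝ]) :
    inner ℝ (mulI (fderiv ℝ (cayley V s) x u)) (fderiv ℝ (cayley V s) x v) =
      inner ℝ (mulI u) v := by
  have hs' : |(-s)| * C < 1 := by rwa [abs_neg]
  set g : ℍ[ℝ] → ℍ[ℝ] := eulerStepInv V (-s) with hg
  have hm : g x ≠ 0 := eulerStepInv_ne_zero hVh hC hs' hx
  have hgd : DifferentiableAt ℝ g x := by
    have h := contDiffAt_eulerStepInv hC hC0 (s := fun _ => -s) contDiff_const (fun _ => hs')
      (t := 0) (hVs _ hm)
    exact (ContDiffAt.comp x (f := fun y : ℍ[ℝ] => ((0 : ℝ), y)) h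
      (contDiffAt_const.prodMk contDiffAt_id)).differentiableAt (by simp)
  set P := fderiv ℝ g x with hP
  set A := fderiv ℝ V (g x) with hA
  have hVg : HasFDerivAt (fun y => V (g y)) (A.comp P) x :=
    ((hVs _ hm).differentiableAt (by simp)).hasFDerivAt.comp x hgd.hasFDerivAt
  have h1 : HasFDerivAt (cayley V s) (P + s • A.comp P) x :=
    hgd.hasFDerivAt.add (hVg.const_smul s)
  have h2 : P - s • A.comp P = ContinuousLinearMap.id ℝ ℍ[ℝ] := by
    refine (hgd.hasFDerivAt.sub (hVg.const_smul s)).unique ?_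
    refine (hasFDerivAt_id x).congr_of_eventuallyEq (Filter.Eventually.of_forall fun y => ?_)
    exact eulerStepInv_neg_sub hC hs y
  have h3 : ∀ w, w = P w - s • A (P w) := fun w => (DFunLike.congr_fun h2 w).symm
  rw [h1.fderiv]
  nth_rewrite 2 [h3 u]
  nth_rewrite 2 [h3 v]
  have h4 := hV (g x) hm (P u) (P v)
  simp only [add_apply, smul_apply, ContinuousLinearMap.comp_apply, map_add, map_sub, map_smul,
    inner_add_left, inner_add_right, inner_sub_left, inner_sub_right, inner_smul_left,
    inner_smul_right, conj_trivial]
  rw [← hA] at h4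
  linear_combination 2 * s * h4

theorem mem_tangentAtId_of_isHamiltonian {X : SmoothVF (𝓡 3) S3}
    (hX : IsHamiltonian (extend X)) : X ∈ tangentAtId strictContact := by
  have hVh := isHomogeneous_extend X
  have hVs : ∀ x ≠ 0, ContDiffAt ℝ ∞ (extend X) x := fun x hx => contDiffAt_extend X hx
  have hVi := inner_extend X
  obtain ⟨C, hCpos, -, hC⟩ := hVh.exists_lipschitz fun x hx => (hVs x hx).of_le (by simp)
  set V := extend X with hV
  -- The sine keeps |s|C ≤ 1/2 for all times. The slope 1/2 at 0 compensates the factor 2 in the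
  -- displacement 2sV(m) of a midpoint step.
  let s : ℝ → ℝ := fun t => (2 * C)⁻¹ * Real.sin (C * t)
  have hsm : ContDiff ℝ ∞ s :=
    contDiff_const.mul (Real.contDiff_sin.comp (contDiff_const.mul contDiff_id))
  have hsC : ∀ t, |s t| * C < 1 := fun t => by
    have h1 : |s t| ≤ (2 * C)⁻¹ := by
      rw [abs_mul, abs_of_pos (by positivity : 0 < (2 * C)⁻¹)]
      exact mul_le_of_le_one_right (by positivity) (Real.abs_sin_le_one _)
    calc |s t| * C ≤ (2 * C)⁻¹ * C := mul_le_mul_of_nonneg_right h1 hCpos.le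
      _ = 1 / 2 := by field_simp
      _ < 1 := by norm_num
  have hsC' : ∀ t, |(-s t)| * C < 1 := fun t => by rw [abs_neg]; exact hsC t
  have hs0 : s 0 = 0 := by simp [s]
  have hsd : HasDerivAt s (1 / 2) 0 := by
    have h := ((Real.hasDerivAt_sin (C * 0)).comp (0 : ℝ)
      ((hasDerivAt_id (0 : ℝ)).const_mul C)).const_mul (2 * C)⁻¹
    convert! h using 1
    simp
    field_simp
  have hcoe : ∀ x : S3, (x : ℍ[ℝ]) ≠ 0 := ne_zero_of_mem_sphere
  obtain ⟨F, hF, hFs⟩ := exists_diffeomorph_curve (E := ℍ[ℝ]) (n := 3)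
    (Φ := fun t => cayley V (s t)) (Ψ := fun t => cayley V (-s t))
    (fun t x => contDiffAt_cayley hVh hVs hC hCpos.le hsm hsC t (hcoe x))
    (fun t x => contDiffAt_cayley hVh hVs hC hCpos.le hsm.neg hsC' t (hcoe x))
    (fun t x => by rw [norm_cayley hC hVi (hsC t), norm_coe_sphere])
    (fun t x => by rw [norm_cayley hC hVi (hsC' t), norm_coe_sphere])
    (fun t x => cayley_neg_cayley hC (hsC t) x)
    (fun t x => by simpa using cayley_neg_cayley hC (hsC' t) x)
  have hext : ∀ t, extendMap (F t) = cayley V (s t) := fun t =>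
    funext (homExt_eq_of_isHomogeneous (isHomogeneous_cayley hVh hC (hsC t)) (hF t))
  have hm0 : ∀ x, eulerStepInv V (-s 0) x = x := fun x => by
    have h := eulerStepInv_neg_sub hC (hsC 0) x
    rw [hs0, zero_smul, sub_zero] at h
    rwa [hs0]
  have hzero : F 0 = Diffeomorph.refl (𝓡 3) S3 ∞ := by
    refine Diffeomorph.ext fun x => Subtype.ext ?_
    rw [hF, cayley, hm0, eulerStep, hs0, zero_smul, add_zero]
    rfl
  refine ⟨F, ⟨fun t => mem_strictContact_iff.2 fun x hx v => ?_, hzero, hFs⟩, ?_⟩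
  · rw [hext]
    have h1 : DifferentiableAt ℝ (cayley V (s t)) x := by
      rw [← hext]; exact differentiableAt_extendMap (F t) hx
    -- By Euler's relation, preserving λ is the case `u = x` of preserving ω.
    rw [← (isHomogeneous_cayley hVh hC (hsC t)).fderiv_self h1]
    exact cayley_symplectic hX hVh hVs hCpos.le hC (hsC t) hx x v
  · refine (hasInitialVelocity_iff hzero hFs X).2 fun x => ?_
    have h1 : DifferentiableAt ℝ (fun t => eulerStepInv V (-s t) (x : ℍ[ℝ])) 0 := by
      have h := contDiffAt_eulerStepInv hC hCpos.le hsm.neg hsC' (t := 0) (x := (x : ℍ[ℝ]))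
        (hVs _ (eulerStepInv_ne_zero hVh hC (hsC' 0) (hcoe x)))
      exact (ContDiffAt.comp (0 : ℝ) (f := fun t : ℝ => (t, (x : ℍ[ℝ]))) h
        (contDiffAt_id.prodMk contDiffAt_const)).differentiableAt (by simp)
    have h2 : DifferentiableAt ℝ (fun t => V (eulerStepInv V (-s t) (x : ℍ[ℝ]))) 0 := by
      refine DifferentiableAt.comp (0 : ℝ) (g := V) ?_ h1
      rw [hm0]
      exact (hVs _ (hcoe x)).differentiableAt (by simp)
    -- The step is x + 2s(t)V(m(t)). As s(0) = 0, the derivative of V(m(t)) does not contribute at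
    -- 0.
    have h3 := ((hsd.const_mul 2).smul h2.hasDerivAt).const_add (x : ℍ[ℝ])
    rw [hm0, hs0] at h3
    simp only [mul_zero, zero_smul, zero_add] at h3
    have h4 : ambient X x = ((2 : ℝ) * (1 / 2)) • V x := by
      rw [hV, extend_coe]; norm_num
    rw [h4]
    refine h3.congr_of_eventuallyEq (Filter.Eventually.of_forall fun t => ?_)
    have h5 := eulerStepInv_neg_sub hC (hsC t) (x : ℍ[ℝ])
    simp only [hF, cayley, eulerStep, Pi.smul_apply']
    nth_rewrite 3 [← h5]
    rw [two_mul, add_smul]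
    abel

theorem mem_tangentAtId_strictContact_iff {X : SmoothVF (𝓡 3) S3} :
    X ∈ tangentAtId strictContact ↔ IsHamiltonian (extend X) :=
  ⟨isHamiltonian_of_mem_tangentAtId, mem_tangentAtId_of_isHamiltonian⟩

end Strict

/-! ### The quadratic Hopf map, its fibres and local sections -/

section HopfMap

instance factFinrankEuclidean : Fact (finrank ℝ (EuclideanSpace ℝ (Fin 3)) = 2 + 1) :=
  ⟨finrank_euclideanSpace_fin⟩

/-- The imaginary part of a quaternion, as a vector of Euclidean three-space. -/
def im3 : ℍ[ℝ] →L[ℝ] EuclideanSpace ℝ (Fin 3) :=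
  LinearMap.toContinuousLinearMap
    { toFun := fun x => !₂[x.imI, x.imJ, x.imK]
      map_add' := fun x y => by ext i; fin_cases i <;> simp
      map_smul' := fun c x => by ext i; fin_cases i <;> simp }

/-- The quaternion with given components. -/
def mkQuat (a b c d : ℝ) : ℍ[ℝ] := ⟨a, b, c, d⟩

@[simp] theorem mkQuat_re (a b c d : ℝ) : (mkQuat a b c d).re = a := rfl
@[simp] theorem mkQuat_imI (a b c d : ℝ) : (mkQuat a b c d).imI = b := rfl
@[simp] theorem mkQuat_imJ (a b c d : ℝ) : (mkQuat a b c d).imJ = c := rfl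
@[simp] theorem mkQuat_imK (a b c d : ℝ) : (mkQuat a b c d).imK = d := rfl

/-- Quaternionic conjugation as a continuous real-linear map. -/
def conjL : ℍ[ℝ] →L[ℝ] ℍ[ℝ] :=
  LinearMap.toContinuousLinearMap
    { toFun := star
      map_add' := star_add
      map_smul' := fun c x => by ext <;> simp }

theorem conjL_apply (x : ℍ[ℝ]) : conjL x = star x := rfl

/-- The imaginary quaternion with given coordinates. -/
def quat : EuclideanSpace ℝ (Fin 3) →L[ℝ] ℍ[ℝ] :=
  LinearMap.toContinuousLinearMap
    { toFun := fun v => mkQuat 0 (v 0) (v 1) (v 2)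
      map_add' := fun x y => by ext <;> simp
      map_smul' := fun c x => by ext <;> simp }

@[simp] theorem im3_zero (x : ℍ[ℝ]) : im3 x 0 = x.imI := rfl
@[simp] theorem im3_one (x : ℍ[ℝ]) : im3 x 1 = x.imJ := rfl
@[simp] theorem im3_two (x : ℍ[ℝ]) : im3 x 2 = x.imK := rfl
@[simp] theorem quat_re (v : EuclideanSpace ℝ (Fin 3)) : (quat v).re = 0 := rfl
@[simp] theorem quat_imI (v : EuclideanSpace ℝ (Fin 3)) : (quat v).imI = v 0 := rfl
@[simp] theorem quat_imJ (v : EuclideanSpace ℝ (Fin 3)) : (quat v).imJ = v 1 := rfl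
@[simp] theorem quat_imK (v : EuclideanSpace ℝ (Fin 3)) : (quat v).imK = v 2 := rfl

theorem im3_quat (v : EuclideanSpace ℝ (Fin 3)) : im3 (quat v) = v := by
  ext i; fin_cases i <;> simp

theorem quat_im3 {x : ℍ[ℝ]} (hx : x.re = 0) : quat (im3 x) = x := by
  ext <;> simp [hx]

theorem star_quat (v : EuclideanSpace ℝ (Fin 3)) : star (quat v) = -quat v := by
  ext <;> simp

theorem inner_eq3 (a b : EuclideanSpace ℝ (Fin 3)) :
    inner ℝ a b = a 0 * b 0 + a 1 * b 1 + a 2 * b 2 := by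
  simp [PiLp.inner_apply, Fin.sum_univ_three, mul_comm]

theorem inner_quat (a b : EuclideanSpace ℝ (Fin 3)) :
    inner ℝ (quat a) (quat b) = inner ℝ a b := by
  simp [inner_eq, inner_eq3]

theorem norm_quat (a : EuclideanSpace ℝ (Fin 3)) : ‖quat a‖ = ‖a‖ := by
  refine (sq_eq_sq₀ (norm_nonneg _) (norm_nonneg _)).1 ?_
  rw [← real_inner_self_eq_norm_sq, ← real_inner_self_eq_norm_sq, inner_quat]

theorem self_mul_star_eq (x : ℍ[ℝ]) : x * star x = ((‖x‖ ^ 2 : ℝ) : ℍ[ℝ]) := by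
  rw [Quaternion.self_mul_star, Quaternion.normSq_eq_norm_mul_self, sq]

theorem star_mul_self_eq (x : ℍ[ℝ]) : star x * x = ((‖x‖ ^ 2 : ℝ) : ℍ[ℝ]) := by
  rw [Quaternion.star_mul_self, Quaternion.normSq_eq_norm_mul_self, sq]

/-- The quadratic map of the quaternions to Euclidean three-space that restricts to the Hopf
projection. -/
def hopfMap (x : ℍ[ℝ]) : EuclideanSpace ℝ (Fin 3) := im3 (mulI x * star x)

theorem coe_hopf (x : S3) : (hopf x : EuclideanSpace ℝ (Fin 3)) = hopfMap x := rfl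

theorem quat_hopfMap (x : ℍ[ℝ]) : quat (hopfMap x) = mulI x * star x :=
  quat_im3 (by simp [mulI_apply]; ring)

theorem hasFDerivAt_hopfMap (x : ℍ[ℝ]) : ∃ D : ℍ[ℝ] →L[ℝ] EuclideanSpace ℝ (Fin 3),
    HasFDerivAt hopfMap D x ∧ ∀ v, D v = (2 : ℝ) • im3 (mulI v * star x) := by
  have h1 := (mulI.hasFDerivAt (x := x)).mul' (conjL.hasFDerivAt (x := x))
  refine ⟨_, im3.hasFDerivAt.comp x h1, fun v => ?_⟩
  -- The two terms of the product rule are negative conjugates of each other, so their imaginary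
  -- parts coincide.
  have h2 : mulI x * star v = -star (mulI v * star x) := by
    rw [star_mul, star_star, mulI_apply, mulI_apply, star_mul]
    have : star qi = -qi := by ext <;> simp
    rw [this]
    noncomm_ring
  have h3 : im3 (mulI x * star v + mulI v * star x) = (2 : ℝ) • im3 (mulI v * star x) := by
    rw [h2]
    ext i; fin_cases i <;> simp <;> ring
  exact h3

theorem fderiv_hopfMap (x v : ℍ[ℝ]) : fderiv ℝ hopfMap x v = (2 : ℝ) • im3 (mulI v * star x) := by
  obtain ⟨D, hD, h⟩ := hasFDerivAt_hopfMap x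
  rw [hD.fderiv, h]

theorem differentiableAt_hopfMap (x : ℍ[ℝ]) : DifferentiableAt ℝ hopfMap x :=
  (hasFDerivAt_hopfMap x).choose_spec.1.differentiableAt

theorem contDiff_hopfMap : ContDiff ℝ ∞ hopfMap :=
  im3.contDiff.comp (mulI.contDiff.mul conjL.contDiff)

theorem hopfMap_smul (r : ℝ) (x : ℍ[ℝ]) : hopfMap (r • x) = r ^ 2 • hopfMap x := by
  rw [hopfMap, hopfMap, ← conjL_apply, ← conjL_apply, map_smul, map_smul, smul_mul_smul_comm,
    map_smul, sq]

theorem norm_hopfMap (x : ℍ[ℝ]) : ‖hopfMap x‖ = ‖x‖ ^ 2 := by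
  rw [← norm_quat, quat_hopfMap, norm_mul, norm_mulI, norm_star, sq]

theorem hopfMap_ne_zero {x : ℍ[ℝ]} (hx : x ≠ 0) : hopfMap x ≠ 0 := by
  rw [← norm_ne_zero_iff, norm_hopfMap]
  exact pow_ne_zero _ (norm_ne_zero_iff.2 hx)

theorem toSphere_hopfMap {x : ℍ[ℝ]} (hx : x ≠ 0) : toSphere (hopfMap x) = hopf (toSphere x) := by
  refine Subtype.ext ?_
  rw [coe_toSphere (hopfMap_ne_zero hx), coe_hopf, coe_toSphere hx, hopfMap_smul, norm_hopfMap,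
    inv_pow]

theorem hopfMap_mul_expI (x : ℍ[ℝ]) (θ : ℝ) : hopfMap (x * expI θ) = hopfMap x := by
  have h : star (expI θ) = expI (-θ) := by ext <;> simp
  rw [hopfMap, hopfMap, mulI_apply, mulI_apply, star_mul, h, mul_assoc x, expI_mul_qi, ← mul_assoc,
    ← mul_assoc, mul_assoc (x * qi), expI_mul_expI_neg, mul_one]

/-- The unit quaternion w = x̄y commutes with i, so its j and k components vanish, and w is a unit
complex number with an argument θ. -/
theorem eq_mul_expI_of_hopf_eq {x y : S3} (h : hopf x = hopf y) :
    ∃ θ, (y : ℍ[ℝ]) = (x : ℍ[ℝ]) * expI θ := by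
  have h1 : mulI (x : ℍ[ℝ]) * star (x : ℍ[ℝ]) = mulI (y : ℍ[ℝ]) * star (y : ℍ[ℝ]) := by
    rw [← quat_hopfMap, ← quat_hopfMap, ← coe_hopf, ← coe_hopf, h]
  have hx : star (x : ℍ[ℝ]) * x = 1 := by rw [star_mul_self_eq, norm_coe_sphere]; simp
  have hx' : (x : ℍ[ℝ]) * star (x : ℍ[ℝ]) = 1 := by rw [self_mul_star_eq, norm_coe_sphere]; simp
  have hy : star (y : ℍ[ℝ]) * y = 1 := by rw [star_mul_self_eq, norm_coe_sphere]; simp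
  set w := star (x : ℍ[ℝ]) * y with hw
  have hxw : (y : ℍ[ℝ]) = x * w := by rw [hw, ← mul_assoc, hx', one_mul]
  have h2 : qi * w = w * qi := by
    have h3 : star (x : ℍ[ℝ]) * (mulI (x : ℍ[ℝ]) * star (x : ℍ[ℝ])) * y =
        star (x : ℍ[ℝ]) * (mulI (y : ℍ[ℝ]) * star (y : ℍ[ℝ])) * y := by rw [h1]
    rw [mulI_apply, mulI_apply] at h3
    calc qi * w = (star (x : ℍ[ℝ]) * x) * qi * w := by rw [hx, one_mul]
      _ = star (x : ℍ[ℝ]) * (x * qi * star (x : ℍ[ℝ])) * y := by rw [hw]; noncomm_ring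
      _ = star (x : ℍ[ℝ]) * (y * qi * star (y : ℍ[ℝ])) * y := h3
      _ = w * qi * (star (y : ℍ[ℝ]) * y) := by rw [hw]; noncomm_ring
      _ = w * qi := by rw [hy, mul_one]
  have hJ : w.imJ = 0 := by
    have := congrArg (fun q : ℍ[ℝ] => q.imK) h2
    simp at this
    linarith
  have hK : w.imK = 0 := by
    have := congrArg (fun q : ℍ[ℝ] => q.imJ) h2
    simp at this
    linarith
  have hn : w.re ^ 2 + w.imI ^ 2 = 1 := by
    have h4 : ‖w‖ = 1 := by rw [hw, norm_mul, norm_star, norm_coe_sphere, norm_coe_sphere, one_mul]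
    have h5 := real_inner_self_eq_norm_sq w
    rw [inner_eq, h4, hJ, hK] at h5
    linarith
  have hc : ‖(⟨w.re, w.imI⟩ : ℂ)‖ = 1 := by
    rw [Complex.norm_def, Complex.normSq_mk, Real.sqrt_eq_one, ← sq, ← sq, hn]
  have hc0 : (⟨w.re, w.imI⟩ : ℂ) ≠ 0 := by
    rw [← norm_ne_zero_iff, hc]; exact one_ne_zero
  refine ⟨Complex.arg ⟨w.re, w.imI⟩, hxw.trans (congrArg _ ?_)⟩
  ext
  · simp [Complex.cos_arg hc0, hc]
  · simp [Complex.sin_arg, hc]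
  · exact hJ
  · exact hK

theorem hopf_eq_iff {x y : S3} : hopf x = hopf y ↔ ∃ θ, (y : ℍ[ℝ]) = (x : ℍ[ℝ]) * expI θ :=
  ⟨eq_mul_expI_of_hopf_eq, fun ⟨θ, h⟩ => Subtype.ext (by
    rw [coe_hopf, coe_hopf, h, hopfMap_mul_expI])⟩

/-- For imaginary units b and c, (b + c)c = b(b + c), so conjugation by b + c carries c to b when b
≠ -c. Normalising (b + c)x₀ gives a smooth section of the Hopf projection through `x₀`, away from
the antipode of its image. -/
theorem hopfMap_section {x₀ : S3} {q : S2} :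
    hopfMap ((quat q + quat (hopf x₀)) * x₀) =
      ‖(quat q + quat (hopf x₀)) * x₀‖ ^ 2 • (q : EuclideanSpace ℝ (Fin 3)) := by
  set b := quat q with hb
  set c := quat (hopf x₀) with hc
  have hbb : b * b = -1 := by
    have h := self_mul_star_eq b
    rw [hb, star_quat, norm_quat, norm_coe_sphere, ← hb] at h
    rw [← neg_neg (b * b), ← mul_neg, h]; simp
  have hcc : c * c = -1 := by
    have h := self_mul_star_eq c
    rw [hc, star_quat, norm_quat, norm_coe_sphere, ← hc] at h
    rw [← neg_neg (c * c), ← mul_neg, h]; simp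
  have hbc : c * b = ((-(2 * inner ℝ b c) : ℝ) : ℍ[ℝ]) - b * c := by
    rw [hb, hc, inner_quat, inner_eq3]
    ext <;> simp <;> ring
  have hn : ‖(b + c) * (x₀ : ℍ[ℝ])‖ ^ 2 = 2 + 2 * inner ℝ b c := by
    rw [norm_mul, norm_coe_sphere, mul_one, norm_add_sq_real, hb, hc, norm_quat, norm_quat,
      norm_coe_sphere, norm_coe_sphere]
    ring
  have h1 : mulI ((b + c) * x₀) * star ((b + c) * (x₀ : ℍ[ℝ])) = (2 + 2 * inner ℝ b c) • b := by
    have h2 : mulI (x₀ : ℍ[ℝ]) * star (x₀ : ℍ[ℝ]) = c := by rw [hc, coe_hopf, quat_hopfMap]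
    have h3 : star (b + c) = -(b + c) := by rw [star_add, hb, hc, star_quat, star_quat]; abel
    calc mulI ((b + c) * x₀) * star ((b + c) * (x₀ : ℍ[ℝ]))
        = (b + c) * (mulI (x₀ : ℍ[ℝ]) * star (x₀ : ℍ[ℝ])) * star (b + c) := by
          rw [star_mul, mulI_apply, mulI_apply]; noncomm_ring
      _ = -(b * (c * b)) - b * (c * c) - (c * c) * b - c * (c * c) := by
          rw [h2, h3]; noncomm_ring
      _ = (b * b) * c - b * ((-(2 * inner ℝ b c) : ℝ) : ℍ[ℝ]) + 2 * b + c := by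
          rw [hbc, hcc]; noncomm_ring
      _ = (2 + 2 * inner ℝ b c) • b := by
          rw [hbb, ← Quaternion.coe_commutes, Quaternion.coe_mul_eq_smul, add_smul, neg_smul,
            two_smul, two_mul]
          noncomm_ring
  rw [hopfMap, h1, hn, map_smul, hb, im3_quat]

theorem hopf_toSphere_section {x₀ : S3} {q : S2} (h : (quat q + quat (hopf x₀)) * x₀ ≠ 0) :
    hopf (toSphere ((quat q + quat (hopf x₀)) * x₀)) = q := by
  refine Subtype.ext ?_
  rw [coe_hopf, coe_toSphere h, hopfMap_smul, hopfMap_section, smul_smul, inv_pow,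
    inv_mul_cancel₀ (pow_ne_zero _ (norm_ne_zero_iff.2 h)), one_smul]

theorem hopf_surjective : Function.Surjective hopf := by
  intro q
  have key : ∀ x₀ : S3, quat q + quat (hopf x₀) ≠ 0 → ∃ x, hopf x = q := fun x₀ h =>
    ⟨_, hopf_toSphere_section (mul_ne_zero h (ne_zero_of_mem_sphere x₀))⟩
  -- The images of 1 and j are i and -i; no point is antipodal to both.
  let x₁ : S3 := ⟨1, by simp⟩
  let x₂ : S3 := ⟨mkQuat 0 0 1 0, by
    rw [mem_sphere_zero_iff_norm, ← sq_eq_sq₀ (norm_nonneg _) zero_le_one,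
      ← real_inner_self_eq_norm_sq, inner_eq]
    simp⟩
  by_cases h1 : quat q + quat (hopf x₁) = 0
  · refine key x₂ fun h2 => ?_
    have h3 := congrArg (fun z : ℍ[ℝ] => z.imI) (h1.trans h2.symm)
    simp [coe_hopf, hopfMap, mulI_apply, x₁, x₂] at h3
    norm_num at h3
  · exact key x₁ h1

theorem contMDiff_hopf : ContMDiff (𝓡 3) (𝓡 2) ∞ hopf := by
  have h : ContMDiff (𝓡 3) 𝓘(ℝ, EuclideanSpace ℝ (Fin 3)) ∞
      (fun x : S3 => hopfMap (x : ℍ[ℝ])) :=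
    contDiff_hopfMap.contMDiff.comp contMDiff_coe_sphere
  exact h.codRestrict_sphere (n := 2) fun x => (hopf x).2

theorem incl_mfderiv_hopf (x : S3) (v : TangentSpace (𝓡 3) x) :
    incl (hopf x) (mfderiv (𝓡 3) (𝓡 2) hopf x v) = fderiv ℝ hopfMap x (incl x v) := by
  rw [← mfderiv_comp_coe x (differentiableAt_hopfMap x)]
  have h := mfderiv_comp x (I' := 𝓡 2) (g := ((↑) : S2 → EuclideanSpace ℝ (Fin 3)))
    (mdifferentiableAt_coe (n := 2) (hopf x)) ((contMDiff_hopf x).mdifferentiableAt (by simp))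
  exact (DFunLike.congr_fun h v).symm

/-! ### Descent of smoothness through local sections -/

section Descent

variable {E' : Type*} [NormedAddCommGroup E'] [NormedSpace ℝ E'] {H' : Type*} [TopologicalSpace H']
  {I' : ModelWithCorners ℝ E' H'} {N : Type*} [TopologicalSpace N] [ChartedSpace H' N]

/-- Smoothness descends along the Hopf projection. -/
theorem contMDiff_of_comp_hopf_curve {g : ℝ × S2 → N}
    (hg : ContMDiff (𝓘(ℝ, ℝ).prod (𝓡 3)) I' ∞ (fun p : ℝ × S3 => g (p.1, hopf p.2))) :
    ContMDiff (𝓘(ℝ, ℝ).prod (𝓡 2)) I' ∞ g := by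
  rintro ⟨t, q₀⟩
  obtain ⟨x₀, rfl⟩ := hopf_surjective q₀
  let a : EuclideanSpace ℝ (Fin 3) → ℍ[ℝ] := fun q => (quat q + quat (hopf x₀)) * x₀
  have ha : ContDiff ℝ ∞ a := (quat.contDiff.add contDiff_const).mul contDiff_const
  have ha0 : a (hopf x₀) ≠ 0 := by
    refine mul_ne_zero ?_ (ne_zero_of_mem_sphere x₀)
    rw [← two_smul ℝ, ← norm_ne_zero_iff, norm_smul, norm_quat, norm_coe_sphere]
    norm_num
  have haS : ContMDiff (𝓡 2) 𝓘(ℝ, ℍ[ℝ]) ∞ (fun q : S2 => a q) :=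
    ha.contMDiff.comp contMDiff_coe_sphere
  have hs : ContMDiffAt (𝓡 2) (𝓡 3) ∞ (fun q : S2 => (toSphere (a q) : S3)) (hopf x₀) :=
    ContMDiffAt.comp (hopf x₀) (g := toSphere) (contMDiffAt_toSphere ha0) (haS _)
  have hps : ContMDiffAt (𝓘(ℝ, ℝ).prod (𝓡 2)) (𝓘(ℝ, ℝ).prod (𝓡 3)) ∞
      (fun p : ℝ × S2 => (p.1, (toSphere (a p.2) : S3))) (t, hopf x₀) :=
    contMDiffAt_fst.prodMk (ContMDiffAt.comp (t, hopf x₀) (g := fun q : S2 => (toSphere (a q) : S3))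
      hs contMDiffAt_snd)
  refine (ContMDiffAt.comp (t, hopf x₀) (hg _) hps).congr_of_eventuallyEq ?_
  have hc : ContinuousAt (fun p : ℝ × S2 => a p.2) (t, hopf x₀) :=
    (haS.continuous.comp continuous_snd).continuousAt
  filter_upwards [hc.eventually_ne ha0] with p hp
  change g p = g (p.1, hopf (toSphere (a p.2)))
  rw [hopf_toSphere_section hp]

theorem contMDiff_of_comp_hopf {g : S2 → N}
    (hg : ContMDiff (𝓡 3) I' ∞ (fun x => g (hopf x))) : ContMDiff (𝓡 2) I' ∞ g := by
  have h1 : ContMDiff (𝓘(ℝ, ℝ).prod (𝓡 3)) I' ∞ (fun p : ℝ × S3 => g (hopf p.2)) :=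
    hg.comp contMDiff_snd
  exact (contMDiff_of_comp_hopf_curve (g := fun p : ℝ × S2 => g p.2) h1).comp
    (contMDiff_const (c := (0 : ℝ)) |>.prodMk contMDiff_id)

end Descent

end HopfMap

/-! ### The area form and its pull-back -/

section Area

/-- The determinant of three vectors of Euclidean three-space. -/
def det3 (a b c : EuclideanSpace ℝ (Fin 3)) : ℝ :=
  a 0 * (b 1 * c 2 - b 2 * c 1) + a 1 * (b 2 * c 0 - b 0 * c 2) + a 2 * (b 0 * c 1 - b 1 * c 0)

theorem areaForm_eq (y : S2) (u v : TangentSpace (𝓡 2) y) :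
    areaForm y u v = det3 y (incl y u) (incl y v) := by
  rw [areaForm, Matrix.det_fin_three, det3]
  simp only [Matrix.of_apply, Matrix.cons_val]
  change (y : EuclideanSpace ℝ (Fin 3)) 0 * (incl y u) 1 * (incl y v) 2 -
    (y : EuclideanSpace ℝ (Fin 3)) 0 * (incl y u) 2 * (incl y v) 1 -
    (y : EuclideanSpace ℝ (Fin 3)) 1 * (incl y u) 0 * (incl y v) 2 +
    (y : EuclideanSpace ℝ (Fin 3)) 1 * (incl y u) 2 * (incl y v) 0 +
    (y : EuclideanSpace ℝ (Fin 3)) 2 * (incl y u) 0 * (incl y v) 1 -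
    (y : EuclideanSpace ℝ (Fin 3)) 2 * (incl y u) 1 * (incl y v) 0 = _
  ring

theorem det3_add_smul (x u v : EuclideanSpace ℝ (Fin 3)) (a b : ℝ) :
    det3 x (a • x + u) (b • x + v) = det3 x u v := by
  simp [det3]
  ring

theorem det3_smul_left (r : ℝ) (x u v : EuclideanSpace ℝ (Fin 3)) :
    det3 (r • x) u v = r * det3 x u v := by
  simp [det3]
  ring

/-- Radial components of the arguments do not change the determinant on either side, since Df(y)y =
f(y). -/
theorem mem_sDiffPlus_iff {f : DiffS2} : f ∈ sDiffPlus ↔ ∀ x ≠ 0, ∀ u v,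
    det3 (extendMap f x) (fderiv ℝ (extendMap f) x u) (fderiv ℝ (extendMap f) x v) =
      det3 x u v := by
  have hf := isHomogeneous_extendMap f
  constructor
  · intro h x hx u v
    obtain ⟨y, r, hr, rfl⟩ : ∃ (y : S2) (r : ℝ), 0 < r ∧ x = r • (y : EuclideanSpace ℝ (Fin 3)) :=
      ⟨toSphere x, ‖x‖, norm_pos_iff.2 hx, (norm_smul_toSphere hx).symm⟩
    rw [hf.fderiv_smul hr, hf r hr, det3_smul_left, det3_smul_left]
    congr 1
    have hfd : fderiv ℝ (extendMap f) (y : EuclideanSpace ℝ (Fin 3)) y = extendMap f y :=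
      hf.fderiv_self (differentiableAt_extendMap f (ne_zero_of_mem_sphere y))
    have hdec : ∀ w : EuclideanSpace ℝ (Fin 3), ∃ (a : ℝ) (w' : TangentSpace (𝓡 2) y),
        w = a • (y : EuclideanSpace ℝ (Fin 3)) + incl y w' := by
      intro w
      obtain ⟨w', hw'⟩ := (mem_range_incl (n := 2) y
        (w := w - inner ℝ (y : EuclideanSpace ℝ (Fin 3)) w • (y : EuclideanSpace ℝ (Fin 3)))).2 (by
          rw [inner_sub_right, inner_smul_right, real_inner_self_eq_norm_sq, norm_coe_sphere]
          ring)
      exact ⟨_, w', by rw [hw']; abel⟩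
    obtain ⟨a, u', rfl⟩ := hdec u
    obtain ⟨b, v', rfl⟩ := hdec v
    rw [map_add, map_add, map_smul, map_smul, hfd, det3_add_smul, det3_add_smul]
    have h1 := h y u' v'
    rwa [areaForm_eq, areaForm_eq, incl_mfderiv_diffeomorph, incl_mfderiv_diffeomorph,
      ← extendMap_coe] at h1
  · intro h y u v
    have h1 := h y (ne_zero_of_mem_sphere y) (incl y u) (incl y v)
    rwa [← incl_mfderiv_diffeomorph, ← incl_mfderiv_diffeomorph, extendMap_coe, ← areaForm_eq,
      ← areaForm_eq] at h1

/-- The right-hand side involves only the norm, ω, λ and ⟨x,·⟩, all preserved by extensions of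
strict contactomorphisms. On vectors tangent to the unit sphere it is -4ω, a multiple of dα. -/
theorem det3_fderiv_hopfMap (x u v : ℍ[ℝ]) :
    det3 (hopfMap x) (fderiv ℝ hopfMap x u) (fderiv ℝ hopfMap x v) =
      -4 * ‖x‖ ^ 2 * (‖x‖ ^ 2 * inner ℝ (mulI u) v - inner ℝ x u * inner ℝ (mulI x) v +
        inner ℝ x v * inner ℝ (mulI x) u) := by
  have hn : ‖x‖ ^ 2 = x.re ^ 2 + x.imI ^ 2 + x.imJ ^ 2 + x.imK ^ 2 := by
    rw [← real_inner_self_eq_norm_sq, inner_eq]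
    ring
  rw [fderiv_hopfMap, fderiv_hopfMap, hn]
  simp [det3, hopfMap, inner_eq, mulI_apply]
  ring

theorem fderiv_hopfMap_surjective {x : ℍ[ℝ]} (hx : x ≠ 0) :
    Function.Surjective (fderiv ℝ hopfMap x) := by
  intro w
  refine ⟨(-(2 * ‖x‖ ^ 2)⁻¹) • mulI (quat w * x), ?_⟩
  rw [fderiv_hopfMap, map_smul, mulI_mulI, smul_neg, neg_smul, neg_neg, smul_mul_assoc, mul_assoc,
    self_mul_star_eq, Quaternion.mul_coe_eq_smul, smul_smul, map_smul, im3_quat, smul_smul]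
  have : ‖x‖ ≠ 0 := norm_ne_zero_iff.2 hx
  rw [show 2 * ((2 * ‖x‖ ^ 2)⁻¹ * ‖x‖ ^ 2) = 1 by field_simp, one_smul]

end Area

/-! ### Strict contactomorphisms descend to the two-sphere -/

section Descend

variable {F : DiffS3} {f : DiffS2}

theorem extendMap_hopfMap (h : ∀ x, f (hopf x) = hopf (F x)) {x : ℍ[ℝ]} (hx : x ≠ 0) :
    extendMap f (hopfMap x) = hopfMap (extendMap F x) := by
  rw [extendMap, homExt, toSphere_hopfMap hx, h, coe_hopf, norm_hopfMap, ← hopfMap_smul]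
  rfl

theorem mem_sDiffPlus_of_strictContact (hF : F ∈ strictContact)
    (h : ∀ x, f (hopf x) = hopf (F x)) : f ∈ sDiffPlus := by
  rw [mem_sDiffPlus_iff]
  intro q hq
  obtain ⟨y, hy⟩ := hopf_surjective (toSphere q)
  obtain ⟨x, hx, rfl⟩ : ∃ x ≠ 0, hopfMap x = q := by
    -- The square root enters because the Hopf map is quadratic.
    have hs : √‖q‖ ≠ 0 := (Real.sqrt_pos.2 (norm_pos_iff.2 hq)).ne'
    refine ⟨√‖q‖ • (y : ℍ[ℝ]), smul_ne_zero hs (ne_zero_of_mem_sphere y), ?_⟩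
    rw [hopfMap_smul, ← coe_hopf, hy, Real.sq_sqrt (norm_nonneg q), norm_smul_toSphere hq]
  intro u' v'
  obtain ⟨u, rfl⟩ := fderiv_hopfMap_surjective hx u'
  obtain ⟨v, rfl⟩ := fderiv_hopfMap_surjective hx v'
  have hdF := differentiableAt_extendMap F hx
  have hD : ∀ w, fderiv ℝ (extendMap f) (hopfMap x) (fderiv ℝ hopfMap x w) =
      fderiv ℝ hopfMap (extendMap F x) (fderiv ℝ (extendMap F) x w) := by
    intro w
    have h1 := (differentiableAt_extendMap f (hopfMap_ne_zero hx)).hasFDerivAt.comp x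
      (differentiableAt_hopfMap x).hasFDerivAt
    have h2 := (differentiableAt_hopfMap (extendMap F x)).hasFDerivAt.comp x hdF.hasFDerivAt
    have h3 := h2.congr_of_eventuallyEq (f₁ := extendMap f ∘ hopfMap) (by
      filter_upwards [isOpen_compl_singleton.mem_nhds hx] with y hy using extendMap_hopfMap h hy)
    exact DFunLike.congr_fun (h1.unique h3) w
  rw [hD, hD, extendMap_hopfMap h hx, det3_fderiv_hopfMap, det3_fderiv_hopfMap, norm_extendMap,
    symplectic_of_mem_strictContact hF hx, inner_fderiv_of_norm_eq (norm_extendMap F) hdF,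
    inner_fderiv_of_norm_eq (norm_extendMap F) hdF, mem_strictContact_iff.1 hF x hx,
    mem_strictContact_iff.1 hF x hx]

theorem hopf_apply_eq_of_hopf_eq (hF : F ∈ strictContact) {x y : S3} (h : hopf x = hopf y) :
    hopf (F x) = hopf (F y) := by
  obtain ⟨θ, hθ⟩ := eq_mul_expI_of_hopf_eq h
  refine hopf_eq_iff.2 ⟨θ, ?_⟩
  rw [← extendMap_coe, hθ, extendMap_mul_expI hF, extendMap_coe]

/-- Applying `F` to the rotated point F⁻¹(x)·e^{iθ} gives `y`, so this point is F⁻¹(y). -/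
theorem hopf_symm_apply_eq_of_hopf_eq (hF : F ∈ strictContact) {x y : S3} (h : hopf x = hopf y) :
    hopf (F.symm x) = hopf (F.symm y) := by
  obtain ⟨θ, hθ⟩ := eq_mul_expI_of_hopf_eq h
  have hn : ‖(F.symm x : ℍ[ℝ]) * expI θ‖ = 1 := by
    rw [norm_mul, norm_coe_sphere, norm_expI, one_mul]
  have h1 : F ⟨(F.symm x : ℍ[ℝ]) * expI θ, mem_sphere_zero_iff_norm.2 hn⟩ = y := by
    refine Subtype.ext ?_
    rw [← extendMap_coe, hθ, extendMap_mul_expI hF, extendMap_coe, F.apply_symm_apply]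
  refine hopf_eq_iff.2 ⟨θ, ?_⟩
  rw [← h1, F.symm_apply_apply]

/-- A smooth curve of strict contactomorphisms descends to the two-sphere. -/
theorem exists_descend_curve {F : ℝ → DiffS3} (hF : IsSmoothCurveAtId strictContact F) :
    ∃ f : ℝ → DiffS2, IsSmoothCurveAtId sDiffPlus f ∧ ∀ t x, f t (hopf x) = hopf (F t x) := by
  -- An arbitrary set-theoretic section suffices: the induced maps do not depend on it, and their
  -- smoothness is checked after composing with the Hopf projection.
  let σ : S2 → S3 := Function.surjInv hopf_surjective
  have hσ : ∀ q, hopf (σ q) = q := Function.surjInv_eq hopf_surjective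
  have h1 : ∀ t x, hopf (F t (σ (hopf x))) = hopf (F t x) := fun t x =>
    hopf_apply_eq_of_hopf_eq (hF.mem t) (hσ _)
  have h2 : ∀ t x, hopf ((F t).symm (σ (hopf x))) = hopf ((F t).symm x) := fun t x =>
    hopf_symm_apply_eq_of_hopf_eq (hF.mem t) (hσ _)
  let f : ℝ → DiffS2 := fun t =>
    { toFun := fun q => hopf (F t (σ q))
      invFun := fun q => hopf ((F t).symm (σ q))
      left_inv := fun q => by
        change hopf ((F t).symm (σ (hopf (F t (σ q))))) = q
        rw [h2, (F t).symm_apply_apply, hσ]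
      right_inv := fun q => by
        change hopf (F t (σ (hopf ((F t).symm (σ q))))) = q
        rw [h1, (F t).apply_symm_apply, hσ]
      contMDiff_toFun := contMDiff_of_comp_hopf (g := fun q => hopf (F t (σ q))) (by
        simp only [h1]; exact contMDiff_hopf.comp (F t).contMDiff)
      contMDiff_invFun := contMDiff_of_comp_hopf (g := fun q => hopf ((F t).symm (σ q))) (by
        simp only [h2]; exact contMDiff_hopf.comp (F t).symm.contMDiff) }
  have hf : ∀ t x, f t (hopf x) = hopf (F t x) := h1
  refine ⟨f, ⟨fun t => mem_sDiffPlus_of_strictContact (hF.mem t) (hf t), ?_, ?_⟩, hf⟩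
  · refine Diffeomorph.ext fun q => ?_
    obtain ⟨x, rfl⟩ := hopf_surjective q
    rw [hf, hF.zero]
    rfl
  · refine contMDiff_of_comp_hopf_curve (g := fun p : ℝ × S2 => f p.1 p.2) ?_
    simp only [hf]
    exact contMDiff_hopf.comp hF.smooth

end Descend

/-! ### Push-forward of vector fields along the Hopf projection -/

section PushForward

/-- The vector field `Y` is the push-forward of `X` along the Hopf projection. -/
def IsPushForward (X : SmoothVF (𝓡 3) S3) (Y : SmoothVF (𝓡 2) S2) : Prop :=
  ∀ x : S3, ambient Y (hopf x) = fderiv ℝ hopfMap x (ambient X x)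

variable {X X' : SmoothVF (𝓡 3) S3} {Y Y' : SmoothVF (𝓡 2) S2}

theorem IsPushForward.unique (h : IsPushForward X Y) (h' : IsPushForward X Y') : Y = Y' :=
  ambient_injective <| funext fun q => by
    obtain ⟨x, rfl⟩ := hopf_surjective q
    rw [h, h']

theorem IsPushForward.mfderiv_hopf (h : IsPushForward X Y) (x : S3) :
    mfderiv (𝓡 3) (𝓡 2) hopf x (X x) = Y (hopf x) :=
  incl_injective (hopf x) ((incl_mfderiv_hopf x (X x)).trans (h x).symm)

/-- Both sides have degree two in `x`: on the left the derivative of the quadratic map and the field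
each contribute one, on the right the quadratic map contributes two. -/
theorem IsPushForward.extend (h : IsPushForward X Y) {x : ℍ[ℝ]} (hx : x ≠ 0) :
    fderiv ℝ hopfMap x (extend X x) = extend Y (hopfMap x) := by
  have h1 := h (toSphere x)
  rw [Hopf.extend, Hopf.extend, homExt, homExt, toSphere_hopfMap hx, h1, norm_hopfMap,
    fderiv_hopfMap, fderiv_hopfMap, coe_toSphere hx, ← conjL_apply, ← conjL_apply, map_smul,
    map_smul, smul_mul_assoc, mul_smul_comm, map_smul, map_smul, smul_smul, smul_smul,
    smul_smul]
  have := norm_ne_zero_iff.2 hx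
  congr 1
  field_simp

theorem IsPushForward.add (h : IsPushForward X Y) (h' : IsPushForward X' Y') :
    IsPushForward (X + X') (Y + Y') := fun x => by
  rw [ambient_add, ambient_add, map_add, h, h']

theorem IsPushForward.smul (c : ℝ) (h : IsPushForward X Y) :
    IsPushForward (c • X) (c • Y) := fun x => by
  rw [ambient_smul, ambient_smul, map_smul, h]

theorem IsPushForward.lie (h : IsPushForward X Y) (h' : IsPushForward X' Y') :
    IsPushForward ⁅X, X'⁆ ⁅Y, Y'⁆ := fun x => by
  have hx := ne_zero_of_mem_sphere x
  have hev : ∀ᶠ y in nhds (x : ℍ[ℝ]), y ≠ 0 := isOpen_compl_singleton.mem_nhds hx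
  rw [← extend_coe, ← extend_coe, extend_lie, extend_lie, coe_hopf]
  exact (fderiv_lieBracket_of_related (contDiff_hopfMap.contDiffAt.of_le two_le_infty)
    (differentiableAt_extend X hx) (differentiableAt_extend X' hx)
    (differentiableAt_extend Y (hopfMap_ne_zero hx))
    (differentiableAt_extend Y' (hopfMap_ne_zero hx))
    (hev.mono fun y hy => h.extend hy) (hev.mono fun y hy => h'.extend hy)).symm

theorem hasDerivAt_coe_hopf {F : ℝ → DiffS3} (hF : IsSmoothCurveAtId strictContact F)
    (hX : HasInitialVelocity F X) (x : S3) :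
    HasDerivAt (fun t => (hopf (F t x) : EuclideanSpace ℝ (Fin 3)))
      (fderiv ℝ hopfMap x (ambient X x)) 0 := by
  have h1 := (hasInitialVelocity_iff hF.zero hF.smooth X).1 hX x
  have h2 : (F 0 x : ℍ[ℝ]) = x := by rw [hF.zero]; rfl
  have h3 : HasFDerivAt hopfMap (fderiv ℝ hopfMap x) (F 0 x : ℍ[ℝ]) := by
    rw [h2]; exact (differentiableAt_hopfMap _).hasFDerivAt
  exact h3.comp_hasDerivAt (0 : ℝ) h1

theorem exists_isPushForward (hX : X ∈ tangentAtId strictContact) :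
    ∃ Y : SmoothVF (𝓡 2) S2, IsPushForward X Y := by
  obtain ⟨F, hF, hv⟩ := hX
  let W : S3 → EuclideanSpace ℝ (Fin 3) := fun x => fderiv ℝ hopfMap x (ambient X x)
  have hW : ContMDiff (𝓡 3) 𝓘(ℝ, EuclideanSpace ℝ (Fin 3)) ∞ W := by
    have h1 : ContMDiff (𝓡 3) 𝓘(ℝ, ℍ[ℝ] →L[ℝ] EuclideanSpace ℝ (Fin 3)) ∞
        (fun x : S3 => fderiv ℝ hopfMap x) :=
      (contDiff_hopfMap.fderiv_right (m := ∞) (by simp)).contMDiff.comp contMDiff_coe_sphere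
    exact h1.clm_apply (contMDiff_ambient X)
  let σ : S2 → S3 := Function.surjInv hopf_surjective
  have hσ : ∀ q, hopf (σ q) = q := Function.surjInv_eq hopf_surjective
  -- Two points of a fibre have the same projected trajectory, hence the same projected velocity.
  have hWσ : ∀ x, W (σ (hopf x)) = W x := fun x => by
    have h1 := hasDerivAt_coe_hopf hF hv x
    have h2 := hasDerivAt_coe_hopf hF hv (σ (hopf x))
    simp only [fun t => hopf_apply_eq_of_hopf_eq (hF.mem t) (hσ (hopf x))] at h2
    exact h2.unique h1
  have hWt : ∀ x : S3, inner ℝ (hopf x : EuclideanSpace ℝ (Fin 3)) (W x) = 0 := fun x => by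
    have h1 := inner_incl (hopf x) (mfderiv (𝓡 3) (𝓡 2) hopf x (X x))
    rwa [incl_mfderiv_hopf] at h1
  obtain ⟨Y, hY⟩ := exists_ambient_eq (n := 2) (V := fun q => W (σ q))
    (contMDiff_of_comp_hopf (by simpa only [hWσ] using hW)) (fun q => by
      have h1 := hWt (σ q)
      rwa [hσ] at h1)
  exact ⟨Y, fun x => by rw [hY, hWσ]⟩

theorem hasInitialVelocity_descend {F : ℝ → DiffS3} (hF : IsSmoothCurveAtId strictContact F)
    (hX : HasInitialVelocity F X) {f : ℝ → DiffS2} (hf : IsSmoothCurveAtId sDiffPlus f)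
    (hfF : ∀ t x, f t (hopf x) = hopf (F t x)) (hY : IsPushForward X Y) :
    HasInitialVelocity f Y := by
  refine (hasInitialVelocity_iff hf.zero hf.smooth Y).2 fun q => ?_
  obtain ⟨x, rfl⟩ := hopf_surjective q
  simp only [hfF]
  rw [hY]
  exact hasDerivAt_coe_hopf hF hX x

end PushForward

/-! ### The cross product through imaginary quaternions -/

section Cross

/-- The cross product of Euclidean three-space. -/
def cross (a b : EuclideanSpace ℝ (Fin 3)) : EuclideanSpace ℝ (Fin 3) := im3 (quat a * quat b)

theorem inner_cross (a b c : EuclideanSpace ℝ (Fin 3)) : inner ℝ (cross a b) c = det3 a b c := by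
  simp [cross, inner_eq3, det3]
  ring

theorem cross_smul_left (r : ℝ) (a b : EuclideanSpace ℝ (Fin 3)) :
    cross (r • a) b = r • cross a b := by
  rw [cross, map_smul, smul_mul_assoc, map_smul, cross]

theorem cross_smul_right (r : ℝ) (a b : EuclideanSpace ℝ (Fin 3)) :
    cross a (r • b) = r • cross a b := by
  rw [cross, map_smul, mul_smul_comm, map_smul, cross]

theorem cross_add_left (a b c : EuclideanSpace ℝ (Fin 3)) :
    cross (a + b) c = cross a c + cross b c := by
  rw [cross, map_add, add_mul, map_add, cross, cross]

theorem cross_self (a : EuclideanSpace ℝ (Fin 3)) : cross a a = 0 := by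
  ext i
  fin_cases i <;> simp [cross] <;> ring

theorem cross_cross_self (a b : EuclideanSpace ℝ (Fin 3)) :
    cross (cross a b) a = inner ℝ a a • b - inner ℝ a b • a := by
  rw [inner_eq3, inner_eq3]
  ext i
  fin_cases i <;> simp [cross] <;> ring

theorem contDiffAt_cross {f : EuclideanSpace ℝ (Fin 3) → EuclideanSpace ℝ (Fin 3)}
    {q : EuclideanSpace ℝ (Fin 3)} (hf : ContDiffAt ℝ ∞ f q) :
    ContDiffAt ℝ ∞ (fun q => cross q (f q)) q :=
  im3.contDiff.contDiffAt.comp q (quat.contDiff.contDiffAt.mul (quat.contDiff.contDiffAt.comp q hf))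

theorem fderiv_cross {f : EuclideanSpace ℝ (Fin 3) → EuclideanSpace ℝ (Fin 3)}
    {q : EuclideanSpace ℝ (Fin 3)} (hf : DifferentiableAt ℝ f q) (u : EuclideanSpace ℝ (Fin 3)) :
    fderiv ℝ (fun q => cross q (f q)) q u = cross u (f q) + cross q (fderiv ℝ f q u) := by
  have h1 := im3.hasFDerivAt.comp q ((quat.hasFDerivAt (x := q)).mul'
    (quat.hasFDerivAt.comp q hf.hasFDerivAt))
  have h2 : HasFDerivAt (fun q => cross q (f q)) _ q := h1
  rw [h2.fderiv, add_comm, cross, cross, ← map_add]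
  rfl

theorem hasDerivAt_det3 {a b c : ℝ → EuclideanSpace ℝ (Fin 3)} {a' b' c' : EuclideanSpace ℝ (Fin 3)}
    {t : ℝ} (ha : HasDerivAt a a' t) (hb : HasDerivAt b b' t) (hc : HasDerivAt c c' t) :
    HasDerivAt (fun t => det3 (a t) (b t) (c t))
      (det3 a' (b t) (c t) + det3 (a t) b' (c t) + det3 (a t) (b t) c') t := by
  have hp : ∀ {a : ℝ → EuclideanSpace ℝ (Fin 3)} {a'} (_ : HasDerivAt a a' t) (i : Fin 3),
      HasDerivAt (fun t => a t i) (a' i) t := fun ha i =>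
    (EuclideanSpace.proj (𝕜 := ℝ) i).hasFDerivAt.comp_hasDerivAt t ha
  have h := (((hp ha 0).mul (((hp hb 1).mul (hp hc 2)).sub ((hp hb 2).mul (hp hc 1)))).add
    ((hp ha 1).mul (((hp hb 2).mul (hp hc 0)).sub ((hp hb 0).mul (hp hc 2))))).add
    ((hp ha 2).mul (((hp hb 0).mul (hp hc 1)).sub ((hp hb 1).mul (hp hc 0))))
  convert! h using 1
  simp only [det3, Pi.sub_apply, Pi.mul_apply]
  ring

end Cross

/-! ### Lifting area-preserving fields to contact fields -/

section Lift

variable {Y : SmoothVF (𝓡 2) S2}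

theorem det3_extend (hY : Y ∈ tangentAtId sDiffPlus) {q : EuclideanSpace ℝ (Fin 3)} (hq : q ≠ 0)
    (u v : EuclideanSpace ℝ (Fin 3)) :
    det3 (extend Y q) u v + det3 q (fderiv ℝ (extend Y) q u) v +
      det3 q u (fderiv ℝ (extend Y) q v) = 0 := by
  obtain ⟨F, hF, hv⟩ := hY
  have h1 := hasDerivAt_det3 (hF.hasDerivAt_extendMap hv q)
    (hF.hasDerivAt_fderiv_extendMap hv hq u) (hF.hasDerivAt_fderiv_extendMap hv hq v)
  simp only [fun t => mem_sDiffPlus_iff.1 (hF.mem t) q hq u v] at h1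
  have h2 := h1.unique (hasDerivAt_const (0 : ℝ) (det3 q u v))
  rwa [hF.extendMap_zero, hF.fderiv_extendMap_zero, hF.fderiv_extendMap_zero] at h2

theorem hasFDerivAt_norm_inner {E : Type*} [NormedAddCommGroup E] [InnerProductSpace ℝ E] {q : E}
    (hq : q ≠ 0) : HasFDerivAt (fun q : E => ‖q‖) (‖q‖⁻¹ • innerSL ℝ q) q := by
  have h1 := ((hasStrictFDerivAt_norm_sq q).hasFDerivAt).sqrt
    (pow_ne_zero 2 (norm_ne_zero_iff.2 hq))
  simp only [Real.sqrt_sq (norm_nonneg _)] at h1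
  convert! h1 using 1
  ext v
  simp
  ring

/-- The one-form `⟨q × Y, ·⟩ / (2 |q|³)`, as a vector field. -/
def liftForm (Y : SmoothVF (𝓡 2) S2) (q : EuclideanSpace ℝ (Fin 3)) : EuclideanSpace ℝ (Fin 3) :=
  (2 * ‖q‖ ^ 3)⁻¹ • cross q (extend Y q)

theorem contDiffAt_liftForm (Y : SmoothVF (𝓡 2) S2) {q : EuclideanSpace ℝ (Fin 3)} (hq : q ≠ 0) :
    ContDiffAt ℝ ∞ (liftForm Y) q :=
  (ContDiffAt.inv (contDiffAt_const.mul ((contDiffAt_norm ℝ hq).pow 3))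
    (mul_ne_zero two_ne_zero (pow_ne_zero 3 (norm_ne_zero_iff.2 hq)))).smul
    (contDiffAt_cross (contDiffAt_extend Y hq))

theorem inner_fderiv_liftForm (Y : SmoothVF (𝓡 2) S2) {q : EuclideanSpace ℝ (Fin 3)} (hq : q ≠ 0)
    (u v : EuclideanSpace ℝ (Fin 3)) :
    2 * ‖q‖ ^ 5 * inner ℝ (fderiv ℝ (liftForm Y) q u) v =
      ‖q‖ ^ 2 * (det3 u (extend Y q) v + det3 q (fderiv ℝ (extend Y) q u) v) -
        3 * inner ℝ q u * det3 q (extend Y q) v := by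
  have hn : ‖q‖ ≠ 0 := norm_ne_zero_iff.2 hq
  have h1 := ((hasFDerivAt_norm_inner hq).pow 3).const_mul 2
  have h2 := (hasDerivAt_inv (mul_ne_zero two_ne_zero (pow_ne_zero 3 hn))).comp_hasFDerivAt q h1
  have h3 := h2.smul ((contDiffAt_cross (contDiffAt_extend Y hq)).differentiableAt
    (by simp)).hasFDerivAt
  have h4 : HasFDerivAt (liftForm Y) _ q := h3
  rw [h4.fderiv]
  simp only [add_apply, smul_apply, ContinuousLinearMap.smulRight_apply,
    fderiv_cross (differentiableAt_extend Y hq), inner_add_left, inner_smul_left, inner_cross,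
    conj_trivial, innerSL_apply_apply, smul_eq_mul]
  simp
  field_simp
  ring

/-- The one-form is closed. This combines the infinitesimal invariance of the area form with the
linear relation among four vectors of three-space, where Y ⟂ q removes a term. -/
theorem inner_fderiv_liftForm_comm (hY : Y ∈ tangentAtId sDiffPlus)
    {q : EuclideanSpace ℝ (Fin 3)} (hq : q ≠ 0) (u v : EuclideanSpace ℝ (Fin 3)) :
    inner ℝ (fderiv ℝ (liftForm Y) q u) v = inner ℝ (fderiv ℝ (liftForm Y) q v) u := by
  have hn : ‖q‖ ≠ 0 := norm_ne_zero_iff.2 hq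
  refine mul_left_cancel₀ (mul_ne_zero two_ne_zero (pow_ne_zero 5 hn)) ?_
  rw [inner_fderiv_liftForm Y hq, inner_fderiv_liftForm Y hq]
  have h1 := det3_extend hY hq u v
  have h2 := inner_extend Y q
  have h3 : ∀ a b c d : EuclideanSpace ℝ (Fin 3), inner ℝ a a * det3 b c d =
      inner ℝ a b * det3 a c d - inner ℝ a c * det3 a b d + inner ℝ a d * det3 a b c := by
    intro a b c d
    simp only [inner_eq3, det3]
    ring
  have h4 := h3 q (extend Y q) u v
  rw [h2, real_inner_self_eq_norm_sq] at h4
  have h5 : ∀ a b c : EuclideanSpace ℝ (Fin 3), det3 a b c = -det3 b a c := by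
    intro a b c; simp only [det3]; ring
  have h6 : ∀ a b c : EuclideanSpace ℝ (Fin 3), det3 a b c = -det3 a c b := by
    intro a b c; simp only [det3]; ring
  rw [h5 u, h5 v, h6 _ v u, h6 q _ u]
  linear_combination ‖q‖ ^ 2 * h1 - 3 * h4

theorem inner_liftForm_self (Y : SmoothVF (𝓡 2) S2) (q : EuclideanSpace ℝ (Fin 3)) (r : ℝ) :
    inner ℝ (liftForm Y (r • q)) q = 0 := by
  have h : det3 q (extend Y (r • q)) q = 0 := by simp only [det3]; ring
  rw [liftForm, cross_smul_left, inner_smul_left, inner_smul_left, inner_cross, h, mul_zero,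
    mul_zero]

theorem liftForm_smul (Y : SmoothVF (𝓡 2) S2) {r : ℝ} (hr : 0 < r)
    (q : EuclideanSpace ℝ (Fin 3)) : liftForm Y (r • q) = r⁻¹ • liftForm Y q := by
  rw [liftForm, liftForm, isHomogeneous_extend Y r hr, cross_smul_left, cross_smul_right,
    norm_smul, Real.norm_of_nonneg hr.le, smul_smul, smul_smul, smul_smul]
  congr 1
  field_simp

/-- The primitive is constant on rays because the one-form annihilates the radial direction. -/
theorem exists_primitive_liftForm (hY : Y ∈ tangentAtId sDiffPlus) :
    ∃ H : EuclideanSpace ℝ (Fin 3) → ℝ, (∀ q ≠ 0, HasFDerivAt H (innerSL ℝ (liftForm Y q)) q) ∧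
      (∀ q ≠ 0, ContDiffAt ℝ ∞ H q) ∧ ∀ r : ℝ, 0 < r → ∀ q ≠ 0, H (r • q) = H q := by
  have hs : ∀ q ≠ 0, ContDiffAt ℝ ∞ (fun q => innerSL ℝ (liftForm Y q)) q := fun q hq =>
    (innerSL ℝ).contDiff.contDiffAt.comp q (contDiffAt_liftForm Y hq)
  have hD : ∀ q ≠ 0, ∀ u v, fderiv ℝ (fun q => innerSL ℝ (liftForm Y q)) q u v =
      inner ℝ (fderiv ℝ (liftForm Y) q u) v := fun q hq u v => by
    have h := (innerSL ℝ).hasFDerivAt.comp q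
      ((contDiffAt_liftForm Y hq).differentiableAt (by simp)).hasFDerivAt
    have h1 : HasFDerivAt (fun q => innerSL ℝ (liftForm Y q)) _ q := h
    rw [h1.fderiv]
    rfl
  obtain ⟨H, hH⟩ := exists_primitive_compl_zero (β := fun q => innerSL ℝ (liftForm Y q))
    (fun q hq => (hs q hq).differentiableAt (by simp)) (fun q hq u v => by
      rw [hD q hq, hD q hq, inner_fderiv_liftForm_comm hY hq])
  have ho : IsOpen ({0}ᶜ : Set (EuclideanSpace ℝ (Fin 3))) := isOpen_compl_singleton
  refine ⟨H, hH, fun q hq => ?_, fun r hr q hq => ?_⟩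
  · have h1 : ContDiffOn ℝ ∞ H {0}ᶜ := by
      refine (contDiffOn_infty_iff_fderiv_of_isOpen ho).2
        ⟨fun q hq => (hH q hq).differentiableAt.differentiableWithinAt, ?_⟩
      refine ContDiffOn.congr (fun q hq => (hs q hq).contDiffWithinAt) fun q hq => (hH q hq).fderiv
    exact h1.contDiffAt (ho.mem_nhds hq)
  · have h1 : ∀ s ∈ Set.Ioi (0 : ℝ), HasDerivAt (fun s : ℝ => H (s • q)) 0 s := fun s hs => by
      have h2 : HasDerivAt (fun s : ℝ => s • q) q s := by
        simpa using (hasDerivAt_id s).smul_const q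
      have h3 := (hH (s • q) (smul_ne_zero (ne_of_gt hs) hq)).comp_hasDerivAt s h2
      rwa [innerSL_apply_apply, inner_liftForm_self] at h3
    have h2 := isOpen_Ioi.is_const_of_deriv_eq_zero isPreconnected_Ioi
      (fun s hs => (h1 s hs).differentiableAt.differentiableWithinAt)
      (fun s hs => (h1 s hs).deriv) (Set.mem_Ioi.2 hr) (Set.mem_Ioi.2 one_pos)
    simpa using h2

/-- The Hopf map is, up to a factor, the moment map of left multiplication by imaginary quaternions.
-/
theorem inner_mulI_quat_mul (a : EuclideanSpace ℝ (Fin 3)) (x v : ℍ[ℝ]) :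
    inner ℝ (mulI (quat a * x)) v = -(1 / 2) * inner ℝ a (fderiv ℝ hopfMap x v) := by
  rw [fderiv_hopfMap]
  simp [inner_eq, inner_eq3, mulI_apply]
  ring

/-- Left multiplication by an imaginary quaternion is skew and commutes with right multiplication by
i. -/
theorem inner_mulI_quat_mul_add (a : EuclideanSpace ℝ (Fin 3)) (u v : ℍ[ℝ]) :
    inner ℝ (mulI (quat a * u)) v + inner ℝ (mulI u) (quat a * v) = 0 := by
  simp [inner_eq, mulI_apply]
  ring

/-- Multiplication by the pull-back of a gradient field along the quadratic Hopf map is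
Hamiltonian. -/
theorem isHamiltonian_quat_mul {h : EuclideanSpace ℝ (Fin 3) → EuclideanSpace ℝ (Fin 3)}
    (hd : ∀ q ≠ 0, DifferentiableAt ℝ h q)
    (hsymm : ∀ q ≠ 0, ∀ u v, inner ℝ (fderiv ℝ h q u) v = inner ℝ (fderiv ℝ h q v) u) :
    IsHamiltonian (fun x => quat (h (hopfMap x)) * x) := by
  intro x hx u v
  have hq := hopfMap_ne_zero hx
  have h1 := (quat.hasFDerivAt.comp x ((hd _ hq).hasFDerivAt.comp x
    (differentiableAt_hopfMap x).hasFDerivAt)).mul' (hasFDerivAt_id x)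
  have h2 : HasFDerivAt (fun x => quat (h (hopfMap x)) * x) _ x := h1
  have h3 : ∀ w, fderiv ℝ (fun x => quat (h (hopfMap x)) * x) x w = quat (h (hopfMap x)) * w +
      quat (fderiv ℝ h (hopfMap x) (fderiv ℝ hopfMap x w)) * x := fun w => by
    rw [h2.fderiv]
    rfl
  -- By the moment map identity, the terms containing Dh are ∓½⟨Dh(Dp u), Dp v⟩ and its transpose;
  -- they cancel because Dh is symmetric.
  rw [h3, h3, map_add, inner_add_left, inner_add_right, inner_mulI_comm u (quat _ * x),
    inner_mulI_quat_mul _ x v, inner_mulI_quat_mul _ x u, hsymm _ hq]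
  linear_combination inner_mulI_quat_mul_add (h (hopfMap x)) u v

theorem inner_self_quat_mul (a : EuclideanSpace ℝ (Fin 3)) (x : ℍ[ℝ]) :
    inner ℝ x (quat a * x) = 0 := by
  simp [inner_eq]
  ring

theorem fderiv_hopfMap_quat_mul (a : EuclideanSpace ℝ (Fin 3)) (x : ℍ[ℝ]) :
    fderiv ℝ hopfMap x (quat a * x) = (2 : ℝ) • cross a (hopfMap x) := by
  rw [fderiv_hopfMap, cross, quat_hopfMap, mulI_apply, mulI_apply, mul_assoc, mul_assoc, mul_assoc]

/-- An initial velocity of area-preserving diffeomorphisms lifts to a contact vector field. -/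
theorem exists_lift (hY : Y ∈ tangentAtId sDiffPlus) :
    ∃ X : SmoothVF (𝓡 3) S3, IsHamiltonian (extend X) ∧ IsPushForward X Y := by
  obtain ⟨H, hH, hHs, hHh⟩ := exists_primitive_liftForm hY
  -- This is the gradient of |q|H(q). The factor |q| makes `h` homogeneous of degree zero, so that
  -- the lifted field has degree one.
  let h : EuclideanSpace ℝ (Fin 3) → EuclideanSpace ℝ (Fin 3) := fun q =>
    (H q * ‖q‖⁻¹) • q + ‖q‖ • liftForm Y q
  have hs : ∀ q ≠ 0, ContDiffAt ℝ ∞ h q := fun q hq =>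
    (((hHs q hq).mul ((contDiffAt_norm ℝ hq).inv (norm_ne_zero_iff.2 hq))).smul contDiffAt_id).add
      ((contDiffAt_norm ℝ hq).smul (contDiffAt_liftForm Y hq))
  have hgrad : ∀ q ≠ 0, HasFDerivAt (fun q => H q * ‖q‖) (innerSL ℝ (h q)) q := fun q hq => by
    have h1 := (hH q hq).mul (hasFDerivAt_norm_inner hq)
    convert! h1 using 1
    ext v
    simp [h]
    ring
  have hsymm : ∀ q ≠ 0, ∀ u v, inner ℝ (fderiv ℝ h q u) v = inner ℝ (fderiv ℝ h q v) u := by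
    intro q hq u v
    have h1 := (innerSL ℝ).hasFDerivAt.comp q ((hs q hq).differentiableAt (by simp)).hasFDerivAt
    exact second_derivative_symmetric_of_eventually (f := fun q => H q * ‖q‖)
      ((isOpen_compl_singleton.mem_nhds hq : {0}ᶜ ∈ nhds q) |> Filter.mem_of_superset <| hgrad) h1 u v
  have hh : ∀ r : ℝ, 0 < r → ∀ q ≠ 0, h (r • q) = h q := fun r hr q hq => by
    simp only [h]
    rw [hHh r hr q hq, liftForm_smul Y hr, norm_smul, Real.norm_of_nonneg hr.le, smul_smul,
      smul_smul]
    congr 2 <;> field_simp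
  obtain ⟨X, hX⟩ := exists_ambient_eq (n := 3) (V := fun x : S3 => quat (h (hopfMap x)) * (x : ℍ[ℝ]))
    (fun x => by
      have hx := ne_zero_of_mem_sphere x
      have h1 : ContDiffAt ℝ ∞ (fun x => quat (h (hopfMap x)) * x) (x : ℍ[ℝ]) :=
        (quat.contDiff.contDiffAt.comp _ ((hs _ (hopfMap_ne_zero hx)).comp _
          contDiff_hopfMap.contDiffAt)).mul contDiffAt_id
      exact h1.contMDiffAt.comp x (contMDiff_coe_sphere x))
    (fun x => inner_self_quat_mul _ _)
  have hext : extend X = fun x => quat (h (hopfMap x)) * x := by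
    refine funext (homExt_eq_of_isHomogeneous (fun r hr x => ?_) hX)
    by_cases hx : x = 0
    · simp [hx]
    · rw [hopfMap_smul, hh _ (by positivity) _ (hopfMap_ne_zero hx), mul_smul_comm]
  refine ⟨X, ?_, fun x => ?_⟩
  · rw [hext]
    exact isHamiltonian_quat_mul (fun q hq => (hs q hq).differentiableAt (by simp)) hsymm
  · have h1 : ‖hopfMap (x : ℍ[ℝ])‖ = 1 := by rw [norm_hopfMap, norm_coe_sphere, one_pow]
    have h2 := inner_ambient Y (hopf x)
    rw [coe_hopf] at h2
    rw [hX, fderiv_hopfMap_quat_mul]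
    simp only [h, h1, liftForm, inv_one, mul_one, one_smul, one_pow]
    -- On the unit sphere the projection is 2h × q. The radial part of `h` drops out, and the rest
    -- is 2·½(q × Y) × q = Y.
    rw [cross_add_left, cross_smul_left, cross_smul_left, cross_self, cross_cross_self,
      real_inner_self_eq_norm_sq, h1, ← coe_hopf, extend_coe, coe_hopf, h2]
    simp

end Lift

/-! ### The Hopf field and the circle of rotations -/

section Circle

theorem exists_hopfField : ∃ A : SmoothVF (𝓡 3) S3, ∀ x, ambient A x = mulI (x : ℍ[ℝ]) :=
  exists_ambient_eq (mulI.contDiff.contMDiff.comp contMDiff_coe_sphere) fun x => by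
    rw [real_inner_comm, inner_mulI_self]

/-- The unit vector field `x ↦ x i` tangent to the Hopf circles. -/
def hopfField : SmoothVF (𝓡 3) S3 := exists_hopfField.choose

theorem ambient_hopfField (x : S3) : ambient hopfField x = mulI (x : ℍ[ℝ]) :=
  exists_hopfField.choose_spec x

theorem extend_smul_hopfField (c : ℝ) : extend (c • hopfField) = ⇑(c • mulI) :=
  funext <| homExt_eq_of_isHomogeneous (fun r _ x => map_smul (c • mulI) r x) fun x => by
    rw [ambient_smul, ambient_hopfField]
    rfl

theorem isHamiltonian_smul_hopfField (c : ℝ) : IsHamiltonian (extend (c • hopfField)) := by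
  intro x _ u v
  rw [extend_smul_hopfField, ContinuousLinearMap.fderiv]
  simp only [smul_apply, map_smul, inner_smul_left, inner_smul_right, mulI_mulI, inner_neg_left,
    conj_trivial]
  have h : inner ℝ (mulI u) (mulI v) = inner ℝ u v := by
    rw [inner_mulI_left, mulI_mulI, inner_neg_right, neg_neg]
  rw [h]
  ring

theorem fderiv_hopfMap_mulI (x : ℍ[ℝ]) : fderiv ℝ hopfMap x (mulI x) = 0 := by
  have h : ∀ r : ℝ, im3 (r : ℍ[ℝ]) = 0 := fun r => by
    ext i
    fin_cases i <;> simp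
  rw [fderiv_hopfMap, mulI_mulI, neg_mul, self_mul_star_eq, map_neg, h, neg_zero, smul_zero]

theorem isPushForward_smul_hopfField (c : ℝ) : IsPushForward (c • hopfField) 0 := fun x => by
  rw [ambient_zero, ambient_smul, ambient_hopfField, map_smul, fderiv_hopfMap_mulI, smul_zero]

theorem contDiff_expI : ContDiff ℝ ∞ expI := by
  have h : expI = fun θ => Real.cos θ • (1 : ℍ[ℝ]) + Real.sin θ • qi := by
    funext θ
    ext <;> simp
  rw [h]
  exact (Real.contDiff_cos.smul contDiff_const).add (Real.contDiff_sin.smul contDiff_const)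

theorem mem_tangentAtId_circleRotations_iff {X : SmoothVF (𝓡 3) S3} :
    X ∈ tangentAtId circleRotations ↔ ∃ c : ℝ, c • hopfField = X := by
  constructor
  · rintro ⟨F, hF, hv⟩
    have h1 := (hasInitialVelocity_iff hF.zero hF.smooth X).1 hv
    -- The angles are chosen without any continuity. Differentiability of the curve of unit complex
    -- numbers is read off from the orbit of the point 1.
    choose θ hθ using hF.mem
    let e : S3 := ⟨1, by simp⟩
    have h2 : HasDerivAt (fun t => expI (θ t)) (ambient X e) 0 := by
      have h := h1 e
      simp only [hθ] at h
      simpa [e] using h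
    have h3 : ∀ x : S3, ambient X x = x * ambient X e := fun x => by
      have h := h1 x
      simp only [hθ] at h
      exact h.unique (h2.const_mul (x : ℍ[ℝ]))
    -- Tangency at 1 kills the real part, and the j and k components vanish along the whole curve;
    -- only a multiple of i remains.
    have h4 : (ambient X e).re = 0 := by
      have h := inner_ambient X e
      simpa [inner_eq, e] using h
    have hJ : (ambient X e).imJ = 0 := by
      have h := (EuclideanSpace.proj (𝕜 := ℝ) (1 : Fin 3)).hasFDerivAt.comp_hasDerivAt (0 : ℝ)
        (im3.hasFDerivAt.comp_hasDerivAt (0 : ℝ) h2)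
      exact h.unique (hasDerivAt_const (0 : ℝ) (0 : ℝ))
    have hK : (ambient X e).imK = 0 := by
      have h := (EuclideanSpace.proj (𝕜 := ℝ) (2 : Fin 3)).hasFDerivAt.comp_hasDerivAt (0 : ℝ)
        (im3.hasFDerivAt.comp_hasDerivAt (0 : ℝ) h2)
      exact h.unique (hasDerivAt_const (0 : ℝ) (0 : ℝ))
    have h6 : ambient X e = (ambient X e).imI • qi := by ext <;> simp [h4, hJ, hK]
    refine ⟨(ambient X e).imI, ambient_injective (funext fun x => ?_)⟩
    rw [ambient_smul, ambient_hopfField, h3 x, mulI_apply, ← mul_smul_comm, ← h6]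
  · rintro ⟨c, rfl⟩
    have hs : ContDiff ℝ ∞ (fun q : ℝ × ℍ[ℝ] => q.2 * expI (c * q.1)) :=
      contDiff_snd.mul (contDiff_expI.comp (contDiff_const.mul contDiff_fst))
    have hs' : ContDiff ℝ ∞ (fun q : ℝ × ℍ[ℝ] => q.2 * expI (-(c * q.1))) :=
      contDiff_snd.mul (contDiff_expI.comp (contDiff_const.mul contDiff_fst).neg)
    obtain ⟨F, hF, hFs⟩ := exists_diffeomorph_curve (E := ℍ[ℝ]) (n := 3)
      (Φ := fun t x => x * expI (c * t)) (Ψ := fun t x => x * expI (-(c * t)))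
      (fun t x => hs.contDiffAt) (fun t x => hs'.contDiffAt)
      (fun t x => by rw [norm_mul, norm_coe_sphere, norm_expI, one_mul])
      (fun t x => by rw [norm_mul, norm_coe_sphere, norm_expI, one_mul])
      (fun t x => by rw [mul_assoc, expI_mul_expI_neg, mul_one])
      (fun t x => by rw [mul_assoc, expI_neg_mul_expI, mul_one])
    have h0 : F 0 = Diffeomorph.refl (𝓡 3) S3 ∞ := by
      refine Diffeomorph.ext fun x => Subtype.ext ?_
      rw [hF, mul_zero, expI_zero, mul_one]
      rfl
    refine ⟨F, ⟨fun t => ⟨c * t, hF t⟩, h0, hFs⟩, ?_⟩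
    refine (hasInitialVelocity_iff h0 hFs _).2 fun x => ?_
    simp only [hF]
    have h1 : HasDerivAt (fun t : ℝ => c * t) c 0 := by
      simpa using (hasDerivAt_id (0 : ℝ)).const_mul c
    have h2 := ((hasDerivAt_expI (c * 0)).scomp (0 : ℝ) h1).const_mul (x : ℍ[ℝ])
    convert! h2 using 1
    rw [ambient_smul, ambient_hopfField, mulI_apply, mul_zero, expI_zero, one_mul, mul_smul_comm]

end Circle

/-! ### Vertical contact fields -/

section Kernel

/-- A vector in the kernel of the differential of the quadratic Hopf map is vertical. -/
theorem eq_smul_mulI_of_fderiv_hopfMap_eq_zero {x v : ℍ[ℝ]}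
    (h : fderiv ℝ hopfMap x v = 0) :
    ‖x‖ ^ 2 • v = inner ℝ (mulI x) v • mulI x := by
  have h1 : im3 (mulI v * star x) = 0 := by
    rw [fderiv_hopfMap] at h
    exact (smul_eq_zero.1 h).resolve_left two_ne_zero
  have h2 : mulI v * star x = ((-inner ℝ (mulI x) v : ℝ) : ℍ[ℝ]) := by
    ext
    · simp [inner_eq, mulI_apply]
      ring
    · simpa using congrArg (fun w => w 0) h1
    · simpa using congrArg (fun w => w 1) h1
    · simpa using congrArg (fun w => w 2) h1
  have h3 : mulI v * star x * x = ‖x‖ ^ 2 • mulI v := by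
    rw [mul_assoc, star_mul_self_eq, Quaternion.mul_coe_eq_smul]
  rw [h2, Quaternion.coe_mul_eq_smul, neg_smul] at h3
  have h4 := congrArg mulI h3
  rw [map_neg, map_smul, map_smul, mulI_mulI, smul_neg] at h4
  exact (neg_injective h4).symm

/-- The contact fields that project to zero are the constant multiples of the Hopf field. -/
theorem eq_smul_hopfField_of_isPushForward_zero {X : SmoothVF (𝓡 3) S3}
    (hX : IsHamiltonian (extend X)) (h : IsPushForward X 0) : ∃ c : ℝ, c • hopfField = X := by
  let K : ℍ[ℝ] → ℝ := fun x => inner ℝ (mulI x) (extend X x)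
  have hV : ∀ x ≠ 0, ‖x‖ ^ 2 • extend X x = K x • mulI x := fun x hx =>
    eq_smul_mulI_of_fderiv_hopfMap_eq_zero (by rw [h.extend hx, extend_zero]; rfl)
  -- The contact identity gives dK(v) = -2ω(X, v). Since X = K|x|⁻²·xi, this is 2K|x|⁻²⟨x, v⟩, so
  -- K|x|⁻² has zero derivative on the connected punctured space.
  have hK : ∀ x ≠ 0, HasFDerivAt K ((2 * K x * (‖x‖ ^ 2)⁻¹) • innerSL ℝ x) x := fun x hx => by
    have hd := differentiableAt_extend X hx
    have h1 := (mulI.hasFDerivAt (x := x)).inner ℝ hd.hasFDerivAt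
    convert! h1 using 1
    ext v
    have h2 := hX.contact (isHomogeneous_extend X) hx hd v
    have h3 : extend X x = (K x * (‖x‖ ^ 2)⁻¹) • mulI x := by
      have hn : ‖x‖ ^ 2 ≠ 0 := pow_ne_zero 2 (norm_ne_zero_iff.2 hx)
      rw [mul_comm, mul_smul, ← hV x hx, smul_smul, inv_mul_cancel₀ hn, one_smul]
    have h4 : inner ℝ (mulI (extend X x)) v = -(K x * (‖x‖ ^ 2)⁻¹) * inner ℝ x v := by
      rw [h3, map_smul, mulI_mulI, inner_smul_left, inner_neg_left, conj_trivial]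
      ring
    have h5 : inner ℝ (mulI v) (extend X x) = -inner ℝ (mulI (extend X x)) v :=
      inner_mulI_comm _ _
    simp only [ContinuousLinearMap.comp_apply, fderivInnerCLM_apply, smul_apply,
      innerSL_apply_apply, ContinuousLinearMap.prod_apply, smul_eq_mul]
    linarith
  have hC : ∀ x ≠ 0, HasFDerivAt (fun x => K x * (‖x‖ ^ 2)⁻¹) (0 : ℍ[ℝ] →L[ℝ] ℝ) x := by
    intro x hx
    have hn : ‖x‖ ≠ 0 := norm_ne_zero_iff.2 hx
    have h1 := (hasDerivAt_inv (pow_ne_zero 2 hn)).comp_hasFDerivAt x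
      (hasStrictFDerivAt_norm_sq x).hasFDerivAt
    convert! (hK x hx).mul h1 using 1
    ext v
    simp
    field_simp
    ring
  have hconn : IsPreconnected ({0}ᶜ : Set ℍ[ℝ]) :=
    (isConnected_compl_singleton_of_one_lt_rank (by
      rw [← finrank_eq_rank, Quaternion.finrank_eq_four]; norm_num) 0).isPreconnected
  obtain ⟨c, hc⟩ := isOpen_compl_singleton.exists_is_const_of_fderiv_eq_zero (𝕜 := ℝ) hconn
    (fun x hx => (hC x hx).differentiableAt.differentiableWithinAt)
    (fun x hx => (hC x hx).fderiv)
  refine ⟨c, ambient_injective (funext fun x => ?_)⟩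
  have hx := ne_zero_of_mem_sphere x
  have h1 := hV x hx
  have h2 := hc x hx
  rw [norm_coe_sphere, one_pow, one_smul, extend_coe] at h1
  rw [norm_coe_sphere, one_pow, inv_one, mul_one] at h2
  rw [ambient_smul, ambient_hopfField, h1, h2]

end Kernel

/-! ### The Lie algebras and the exact sequence -/

section Sequence

/-- The Lie algebra of multiples of the Hopf field. -/
def circleAlgebra : LieSubalgebra ℝ (SmoothVF (𝓡 3) S3) where
  toSubmodule := Submodule.span ℝ {hopfField}
  lie_mem' := by
    intro X Y hX hY
    obtain ⟨a, rfl⟩ := Submodule.mem_span_singleton.1 hX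
    obtain ⟨b, rfl⟩ := Submodule.mem_span_singleton.1 hY
    change ⁅a • hopfField, b • hopfField⁆ ∈ Submodule.span ℝ {hopfField}
    rw [smul_lie, lie_smul, lie_self, smul_zero, smul_zero]
    exact Submodule.zero_mem _

theorem mem_circleAlgebra {X : SmoothVF (𝓡 3) S3} :
    X ∈ circleAlgebra ↔ ∃ c : ℝ, c • hopfField = X :=
  Submodule.mem_span_singleton

/-- The Lie algebra of strict contact vector fields. -/
def contactAlgebra : LieSubalgebra ℝ (SmoothVF (𝓡 3) S3) where
  carrier := {X | IsHamiltonian (extend X)}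
  add_mem' := by
    intro X Y hX hY x hx u v
    have h := (differentiableAt_extend X hx).hasFDerivAt.add
      (differentiableAt_extend Y hx).hasFDerivAt
    have h1 : HasFDerivAt (fun x => extend X x + extend Y x) _ x := h
    rw [extend_add, h1.fderiv]
    simp only [add_apply, map_add, inner_add_left, inner_add_right]
    linear_combination hX x hx u v + hY x hx u v
  zero_mem' := by
    have h := isHamiltonian_smul_hopfField 0
    rwa [zero_smul] at h
  smul_mem' := by
    intro c X hX x hx u v
    have h := (differentiableAt_extend X hx).hasFDerivAt.const_smul c
    have h1 : HasFDerivAt (fun x => c • extend X x) _ x := h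
    rw [extend_smul, h1.fderiv]
    simp only [smul_apply, map_smul, inner_smul_left, inner_smul_right, conj_trivial]
    linear_combination c * hX x hx u v
  lie_mem' := by
    intro X Y hX hY
    have h := isHamiltonian_lieBracket hX hY (isHomogeneous_extend X) (isHomogeneous_extend Y)
      (fun x hx => contDiffAt_extend X hx) (fun x hx => contDiffAt_extend Y hx)
    rw [← funext (extend_lie X Y)] at h
    exact h

theorem exists_isPushForward_contactAlgebra (X : contactAlgebra) :
    ∃ Y : SmoothVF (𝓡 2) S2, IsPushForward (X : SmoothVF (𝓡 3) S3) Y :=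
  exists_isPushForward (mem_tangentAtId_strictContact_iff.2 X.2)

/-- The push-forward of a contact field along the Hopf projection. -/
def pushFun (X : contactAlgebra) : SmoothVF (𝓡 2) S2 :=
  (exists_isPushForward_contactAlgebra X).choose

theorem isPushForward_pushFun (X : contactAlgebra) :
    IsPushForward (X : SmoothVF (𝓡 3) S3) (pushFun X) :=
  (exists_isPushForward_contactAlgebra X).choose_spec

/-- The push-forward along the Hopf projection, as a homomorphism of Lie algebras. -/
def pushHom : contactAlgebra →ₗ⁅ℝ⁆ SmoothVF (𝓡 2) S2 where
  toFun := pushFun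
  map_add' X Y := (isPushForward_pushFun (X + Y)).unique
    ((isPushForward_pushFun X).add (isPushForward_pushFun Y))
  map_smul' c X := (isPushForward_pushFun (c • X)).unique ((isPushForward_pushFun X).smul c)
  map_lie' {X Y} := (isPushForward_pushFun ⁅X, Y⁆).unique
    ((isPushForward_pushFun X).lie (isPushForward_pushFun Y))

/-- Curves are built only upstairs: a contact field is integrated to a curve, which descends, and
conversely every velocity downstairs lifts. In particular these velocities form a Lie subalgebra. -/
theorem mem_range_pushHom {Y : SmoothVF (𝓡 2) S2} :
    Y ∈ pushHom.range ↔ Y ∈ tangentAtId sDiffPlus := by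
  rw [LieHom.mem_range]
  constructor
  · rintro ⟨X, rfl⟩
    obtain ⟨F, hF, hv⟩ := mem_tangentAtId_strictContact_iff.2 X.2
    obtain ⟨f, hf, hfF⟩ := exists_descend_curve hF
    exact ⟨f, hf, hasInitialVelocity_descend hF hv hf hfF (isPushForward_pushFun X)⟩
  · intro hY
    obtain ⟨X, hX, hXY⟩ := exists_lift hY
    exact ⟨⟨X, hX⟩, (isPushForward_pushFun ⟨X, hX⟩).unique hXY⟩

theorem circleAlgebra_le_contactAlgebra : circleAlgebra ≤ contactAlgebra := fun X hX => by
  obtain ⟨c, rfl⟩ := mem_circleAlgebra.1 hX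
  exact isHamiltonian_smul_hopfField c

theorem pushHom_eq_zero_iff {X : contactAlgebra} :
    pushHom X = 0 ↔ (X : SmoothVF (𝓡 3) S3) ∈ circleAlgebra := by
  rw [mem_circleAlgebra]
  constructor
  · intro h
    have h1 := isPushForward_pushFun X
    rw [show pushFun X = 0 from h] at h1
    exact eq_smul_hopfField_of_isPushForward_zero X.2 h1
  · rintro ⟨c, hc⟩
    exact (isPushForward_pushFun X).unique (hc ▸ isPushForward_smul_hopfField c)

end Sequence

end Hopf

end

theorem mainTheorem6 :
    ∃ (𝔰 𝔞 : LieSubalgebra ℝ (Hopf.SmoothVF (𝓡 3) Hopf.S3))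
      (𝔡 : LieSubalgebra ℝ (Hopf.SmoothVF (𝓡 2) Hopf.S2)),
      (𝔰 : Set (Hopf.SmoothVF (𝓡 3) Hopf.S3)) = Hopf.tangentAtId Hopf.circleRotations ∧
      (𝔞 : Set (Hopf.SmoothVF (𝓡 3) Hopf.S3)) = Hopf.tangentAtId Hopf.strictContact ∧
      (𝔡 : Set (Hopf.SmoothVF (𝓡 2) Hopf.S2)) = Hopf.tangentAtId Hopf.sDiffPlus ∧
      ∃ (J : 𝔰 →ₗ⁅ℝ⁆ 𝔞) (P : 𝔞 →ₗ⁅ℝ⁆ 𝔡),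
        -- `J` is the inclusion
        (∀ X : 𝔰, (J X : Hopf.SmoothVF (𝓡 3) Hopf.S3) = X) ∧
        -- `P` is the push-forward of vector fields along the Hopf projection
        (∀ (X : 𝔞) (x : Hopf.S3),
          mfderiv (𝓡 3) (𝓡 2) Hopf.hopf x ((X : Hopf.SmoothVF (𝓡 3) Hopf.S3) x) =
            (P X : Hopf.SmoothVF (𝓡 2) Hopf.S2) (Hopf.hopf x)) ∧
        -- `P` is the differential at the identity of the map of groups sending `F` to the
        -- diffeomorphism that `F` induces on the space of Hopf fibres
        (∀ F : ℝ → Hopf.DiffS3, Hopf.IsSmoothCurveAtId Hopf.strictContact F →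
          ∀ X : 𝔞, Hopf.HasInitialVelocity F (X : Hopf.SmoothVF (𝓡 3) Hopf.S3) →
            ∃ f : ℝ → Hopf.DiffS2, Hopf.IsSmoothCurveAtId Hopf.sDiffPlus f ∧
              (∀ t x, f t (Hopf.hopf x) = Hopf.hopf (F t x)) ∧
              Hopf.HasInitialVelocity f (P X : Hopf.SmoothVF (𝓡 2) Hopf.S2)) ∧
        Function.Injective J ∧ Function.Exact J P ∧ Function.Surjective P := by
  -- Taking the third algebra to be the range of the push-forward makes surjectivity of `P`
  -- automatic; the content lies in identifying this range.
  refine ⟨Hopf.circleAlgebra, Hopf.contactAlgebra, Hopf.pushHom.range,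
    Set.ext fun X => Hopf.mem_circleAlgebra.trans Hopf.mem_tangentAtId_circleRotations_iff.symm,
    Set.ext fun X => Hopf.mem_tangentAtId_strictContact_iff.symm,
    Set.ext fun Y => Hopf.mem_range_pushHom,
    LieSubalgebra.inclusion Hopf.circleAlgebra_le_contactAlgebra, Hopf.pushHom.rangeRestrict,
    fun X => rfl, fun X x => (Hopf.isPushForward_pushFun X).mfderiv_hopf x,
    fun F hF X hX => ?_, LieSubalgebra.inclusion_injective _, fun X => ?_,
    Hopf.pushHom.surjective_rangeRestrict⟩
  · obtain ⟨f, hf, hfF⟩ := Hopf.exists_descend_curve hF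
    exact ⟨f, hf, hfF,
      Hopf.hasInitialVelocity_descend hF hX hf hfF (Hopf.isPushForward_pushFun X)⟩
  · have h : Hopf.pushHom.rangeRestrict X = 0 ↔ Hopf.pushHom X = 0 := Subtype.ext_iff
    rw [h, Hopf.pushHom_eq_zero_iff]
    exact ⟨fun hX => ⟨⟨X, hX⟩, rfl⟩, by rintro ⟨Z, rfl⟩; exact Z.2⟩
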